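/- **Setting.** Let $a>0$, $\epsilon>0$, let $\mathrm P$ be a probability law on $\mathbb R^d$ with $\mathbb E\|X\|^4<\infty$ for $X\sim\mathrm P$, and let $X_1,\dots,X_n$ be an i.i.d. sample of $\mathrm P$. Put $G=\mathbb E(XX^\top)$, with largest eigenvalue $\lambda_1$, $s_4^2=\mathbb E(\|X\|^4)^{1/2}$, $\kappa=\sup\{\mathbb E\langle\theta,X\rangle^4/(\mathbb E\langle\theta,X\rangle^2)^2:\ \mathbb E\langle\theta,X\rangle^2>0\}$, $\|M\|_F=\mathbf{Tr}(M^\top M)^{1/2}$, $$c=\tfrac{15}{8\log 2\,(\sqrt2-1)}\exp\bigl(\tfrac{1+2\sqrt2}{2}\bigr),\qquad K=1+\Bigl\lceil a^{-1}\log\Bigl(\frac{n}{72(2+c)\kappa^{1/2}}\Bigr)\Bigr\rceil ,$$ $$\zeta(t)=\sqrt{2(\kappa-1)\Bigl(\frac{(2+3c)s_4^2}{4(2+c)\kappa^{1/2}t}+\log(K/\epsilon)\Bigr)}\cosh(a/4)+\sqrt{\frac{2(2+c)\kappa^{1/2}s_4^2}{t}}\cosh(a/2).$$ Let $\sigma$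 be a threshold, $B_*(t)=\dfrac{n^{-1/2}\zeta(\max\{t,\sigma\})}{1-4n^{-1/2}\zeta(\max\{t,\sigma\})}$ if $[6+(\kappa-1)^{-1}]\zeta(\max\{t,\sigma\})\le\sqrt n$ and $B_*(t)=+\infty$ otherwise, and, for $\delta>0$, $$B(t)=2\max\{t,\sigma\}B_*(\min\{t,s_4^2\})+7\delta\|G\|_F+\sigma .$$ Assume $0<\sigma\le s_4^2$, $8\zeta(\sigma)\le\sqrt n$ and $\kappa\ge 3/2$ (then $B_*$ is finite). **Estimator.** Let $\psi$ be the odd function with $\psi(t)=-\log(1-t+t^2/2)$ on $[0,1]$ and $\psi(t)=\log 2$ for $t\ge1$, and $r_\lambda(\theta)=\frac1n\sum_{i=1}^n\psi(\langle\theta,X_i\rangle^2-\lambda)$. For $0\le j<K$ put $t_j=s_4^2e^{-ja}$, $\beta_j=\sqrt{2(2+c)\kappa^{1/2}s_4^2\,n\,t_j}$, $\lambda^{(j)}=\sqrt{\frac{2}{n(\kappa-1)}\bigl(\frac{(2+3c)s_4^2}{4(2+c)\kappa^{1/2}t_j}+\log(K/\epsilon)\bigr)}$ and $$\eta_j(N,v)=\tfrac12\bigl(\kappa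 N^2-2\lambda^{(j)}N+(\lambda^{(j)})^2\bigr)+\frac{(2+c)\kappa^{1/2}s_4^2N}{\beta_j}+\frac{(2+3c)s_4^4}{2\beta_j^2}+\frac{\beta_jv}{2n}+\frac{\log(K/\epsilon)}{n}.$$ The confidence interval $I(\theta)$ for $\theta^\top G\theta$ is the convex hull of the set of $t\ge0$ such that $|r_{\lambda^{(j)}}(\alpha\theta)-(\alpha^2t-\lambda^{(j)})|\le\eta_j(\alpha^2t,\alpha^2\|\theta\|^2)$ for all $0\le j<K$ and $\alpha\ge0$. Let $\Theta$ be a finite $\delta$-net of the unit sphere, and let $Q$ be a symmetric matrix of least Frobenius norm among those with $\theta^\top Q\theta\in I(\theta)$ for all $\theta\in\Theta$ (any symmetric matrix if there are none). Let $\widehat G=Q_+=\sum_i\widehat\lambda_iq_iq_i^\top$ (orthonormal eigenvectors $q_i$) and $\widetilde G=\sum_i[\widehat\lambda_i-B(\widehat\lambda_i)]_+q_iq_i^\top$. For a symmetric $M=U\,\mathrm{diag}(\mu_1,\dots,\mu_d)U^\top$, with $U$ orthogonal, put $f(M)=U\,\mathrm{diag}(f(\mu_1),\dots,f(\mu_d))U^\top$.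 **Statement.** (1) With probability at least $1-2\epsilon$, for every $L>0$ and every $1/L$-Lipschitz $f:\mathbb R\to\mathbb R$, $$\|f(G)-f(\widetilde G)\|_F\le L^{-1}\sqrt{11\,\mathbf{Tr}(G)\,B(\lambda_1)+13\,B(\lambda_1)^2}.$$ (2) In the worst case this bound decreases at speed $n^{-1/4}$, up to the iterated logarithm that comes from $\log K$: for all $a,\epsilon>0$, $\kappa\ge3/2$ and $s>0$ there are $C$ and $n_0$, depending only on $a,\epsilon,\kappa,s$, such that for all $n\ge n_0$ the threshold $\sigma=n^{-1/2}$ is admissible (that is, with $s_4^2=s$, $0<\sigma\le s_4^2$ and $8\zeta(\sigma)\le\sqrt n$) and, with this threshold, for every dimension $d$, every law $\mathrm P$ on $\mathbb R^d$ with $\mathbb E\|X\|^4<\infty$, kurtosis coefficient $\kappa$ and $s_4^2=s$, every $0<\delta\le n^{-1/2}$ and every $L>0$, $$L^{-1}\sqrt{11\,\mathbf{Tr}(G)\,B(\lambda_1)+13\,B(\lambda_1)^2}\le L^{-1}\,C\,(\log\log n)^{1/4}\,n^{-1/4}.$$ -/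

import Mathlib

open MeasureTheory ProbabilityTheory

noncomputable section

namespace RobustPCA

/-! ### Population quantities of a law `P` on `ℝ^d` -/

/-- The Gram matrix `G = 𝔼 (X Xᵀ)`. -/
def gram {d : ℕ} (P : Measure (EuclideanSpace ℝ (Fin d))) : Matrix (Fin d) (Fin d) ℝ :=
  Matrix.of fun i j => ∫ x, x i * x j ∂P

/-- `κ = sup { 𝔼 ⟨θ, X⟩⁴ / (𝔼 ⟨θ, X⟩²)² : θ ∈ ℝ^d, 𝔼 ⟨θ, X⟩² > 0 }`. -/
def kurtosis {d : ℕ} (P : Measure (EuclideanSpace ℝ (Fin d))) : ℝ :=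
  sSup {k : ℝ | ∃ θ : EuclideanSpace ℝ (Fin d), 0 < ∫ x, (inner ℝ θ x) ^ 2 ∂P ∧
    k = (∫ x, (inner ℝ θ x) ^ 4 ∂P) / (∫ x, (inner ℝ θ x) ^ 2 ∂P) ^ 2}

/-- `s₄² = (𝔼 ‖X‖⁴)^{1/2}`. -/
def s4sq {d : ℕ} (P : Measure (EuclideanSpace ℝ (Fin d))) : ℝ :=
  Real.sqrt (∫ x, ‖x‖ ^ 4 ∂P)

/-! ### Matrices -/

/-- The Frobenius norm `‖M‖_F = Tr(Mᵀ M)^{1/2}`. -/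
def frob {d : ℕ} (M : Matrix (Fin d) (Fin d) ℝ) : ℝ :=
  Real.sqrt (Matrix.trace (M.transpose * M))

/-- The largest eigenvalue of a symmetric matrix. -/
def topEig {d : ℕ} (M : Matrix (Fin d) (Fin d) ℝ) : ℝ :=
  sSup (spectrum ℝ M)

/-- The quadratic form `θᵀ M θ`. -/
def quad {d : ℕ} (M : Matrix (Fin d) (Fin d) ℝ) (θ : EuclideanSpace ℝ (Fin d)) : ℝ :=
  ∑ i, ∑ j, θ i * M i j * θ j

/-! ### The bound `B` -/

/-- The numbers on which the estimator and its bound depend: the sample size `n`, the grid step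
`a`, the confidence level `ε`, the constants `κ` and `s = s₄²`, and the threshold `σ`. -/
structure Params where
  n : ℕ
  a : ℝ
  ε : ℝ
  κ : ℝ
  s : ℝ
  σ : ℝ

/-- `c = 15 / (8 log 2 (√2 - 1)) · exp ((1 + 2 √2) / 2)`. -/
def c : ℝ :=
  15 / (8 * Real.log 2 * (Real.sqrt 2 - 1)) * Real.exp ((1 + 2 * Real.sqrt 2) / 2)

namespace Params

variable (p : Params)

/-- `K = 1 + ⌈a⁻¹ log (n / (72 (2 + c) κ^{1/2}))⌉`. The logarithm is positive as soon as
`8 ζ(σ) ≤ √n` and `0 < σ ≤ s₄²`, so that the ceiling is then a natural number. -/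
def K : ℕ :=
  1 + ⌈p.a⁻¹ * Real.log (p.n / (72 * (2 + c) * Real.sqrt p.κ))⌉₊

def zeta (t : ℝ) : ℝ :=
  Real.sqrt (2 * (p.κ - 1) * ((2 + 3 * c) * p.s / (4 * (2 + c) * Real.sqrt p.κ * t)
      + Real.log (p.K / p.ε))) * Real.cosh (p.a / 4)
    + Real.sqrt (2 * (2 + c) * Real.sqrt p.κ * p.s / t) * Real.cosh (p.a / 2)

open Classical in
/-- `B_*`, with values in the extended reals. -/
def Bstar (t : ℝ) : EReal :=
  if (6 + (p.κ - 1)⁻¹) * p.zeta (max t p.σ) ≤ Real.sqrt p.n then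
    (((Real.sqrt p.n)⁻¹ * p.zeta (max t p.σ)
      / (1 - 4 * (Real.sqrt p.n)⁻¹ * p.zeta (max t p.σ)) : ℝ) : EReal)
  else ⊤

/-- The standing assumptions `0 < σ ≤ s₄²`, `8 ζ(σ) ≤ √n` and `κ ≥ 3/2`. -/
structure Admissible : Prop where
  sigma_pos : 0 < p.σ
  sigma_le : p.σ ≤ p.s
  zeta_le : 8 * p.zeta p.σ ≤ Real.sqrt p.n
  kappa_ge : 3 / 2 ≤ p.κ

/-- `B(t) = 2 max(t, σ) B_*(min(t, s₄²)) + 7 δ ‖G‖_F + σ`, where `g` stands for `‖G‖_F`.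
Under the standing assumptions `B_*` is finite (see `Bstar_ne_top` below). -/
def B (δ g t : ℝ) : ℝ :=
  2 * max t p.σ * (p.Bstar (min t p.s)).toReal + 7 * δ * g + p.σ

end Params

lemma c_pos : 0 < c := by
  have h1 : 0 < Real.log 2 := Real.log_pos (by norm_num)
  have h2 : 0 < Real.sqrt 2 - 1 := by
    have : (1 : ℝ) < Real.sqrt 2 := by
      rw [Real.lt_sqrt (by norm_num)]; norm_num
    linarith
  unfold c
  positivity

lemma Params.zeta_anti (p : Params) (hs : 0 ≤ p.s) (hκ : 1 ≤ p.κ) {t u : ℝ} (ht : 0 < t)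
    (htu : t ≤ u) : p.zeta u ≤ p.zeta t := by
  have hc := c_pos
  have hk : 0 < Real.sqrt p.κ := Real.sqrt_pos.2 (by linarith)
  have hk1 : 0 ≤ p.κ - 1 := by linarith
  unfold Params.zeta
  gcongr

lemma Params.Bstar_ne_top (p : Params) (hp : p.Admissible) (t : ℝ) : p.Bstar t ≠ ⊤ := by
  obtain ⟨h1, h2, h3, h4⟩ := hp
  have hz := p.zeta_anti (by linarith) (by linarith) h1 (le_max_right t p.σ)
  have hz0 : 0 ≤ p.zeta (max t p.σ) := by unfold Params.zeta; positivity
  have hi : (p.κ - 1)⁻¹ ≤ 2 := by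
    rw [inv_le_comm₀ (by linarith) (by norm_num)]; linarith
  have hh : (6 + (p.κ - 1)⁻¹) * p.zeta (max t p.σ) ≤ Real.sqrt p.n := by nlinarith
  unfold Params.Bstar
  rw [if_pos hh]
  exact EReal.coe_ne_top _

/-! ### The PAC-Bayesian confidence region for `θᵀ G θ` -/

/-- The truncated influence function: odd, equal to `- log (1 - t + t² / 2)` on `[0, 1]` and to
`log 2` on `[1, ∞)`. -/
def psi (t : ℝ) : ℝ :=
  if 0 ≤ t then - Real.log (1 - min t 1 + (min t 1) ^ 2 / 2)
  else Real.log (1 - min (-t) 1 + (min (-t) 1) ^ 2 / 2)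

/-- `r_λ(θ) = n⁻¹ ∑ᵢ ψ(⟨θ, xᵢ⟩² - λ)`. -/
def risk {d n : ℕ} (x : Fin n → EuclideanSpace ℝ (Fin d)) (lam : ℝ)
    (θ : EuclideanSpace ℝ (Fin d)) : ℝ :=
  (n : ℝ)⁻¹ * ∑ i, psi ((inner ℝ θ (x i)) ^ 2 - lam)

namespace Params

variable (p : Params)

/-- The geometric grid `t_j = s₄² e^{-ja}`, `0 ≤ j < K`, of possible energies. -/
def level (j : ℕ) : ℝ := p.s * Real.exp (-(j * p.a))

/-- The inverse variance of the Gaussian perturbation at level `t_j`. -/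
def beta (j : ℕ) : ℝ :=
  Real.sqrt (2 * (2 + c) * Real.sqrt p.κ * p.s * p.n * p.level j)

/-- The scale at level `t_j`. -/
def lam (j : ℕ) : ℝ :=
  Real.sqrt (2 / (p.n * (p.κ - 1)) *
    ((2 + 3 * c) * p.s / (4 * (2 + c) * Real.sqrt p.κ * p.level j) + Real.log (p.K / p.ε)))

/-- The deviation allowed by the PAC-Bayesian inequality with parameters `(λ_j, β_j)` between
`r_{λ_j}(θ)` and `N - λ_j`, where `N = θᵀ G θ` and `v = ‖θ‖²`. -/
def slack (j : ℕ) (N v : ℝ) : ℝ :=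
  (p.κ * N ^ 2 - 2 * p.lam j * N + p.lam j ^ 2) / 2
    + (2 + c) * Real.sqrt p.κ * p.s * N / p.beta j
    + (2 + 3 * c) * p.s ^ 2 / (2 * p.beta j ^ 2)
    + p.beta j * v / (2 * p.n)
    + Real.log (p.K / p.ε) / p.n

/-- The confidence region for `θᵀ G θ`: the values `t ≥ 0` that are compatible with all the
PAC-Bayesian inequalities along the half-line spanned by `θ`. -/
def region {d : ℕ} (x : Fin p.n → EuclideanSpace ℝ (Fin d)) (θ : EuclideanSpace ℝ (Fin d)) :
    Set ℝ :=
  {t : ℝ | 0 ≤ t ∧ ∀ j < p.K, ∀ α : ℝ, 0 ≤ α →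
    |risk x (p.lam j) (α • θ) - (α ^ 2 * t - p.lam j)|
      ≤ p.slack j (α ^ 2 * t) (α ^ 2 * ‖θ‖ ^ 2)}

/-- The confidence interval for `θᵀ G θ`. -/
def interval {d : ℕ} (x : Fin p.n → EuclideanSpace ℝ (Fin d)) (θ : EuclideanSpace ℝ (Fin d)) :
    Set ℝ :=
  convexHull ℝ (p.region x θ)

/-- The symmetric matrices whose quadratic form belongs to the confidence interval in every
direction of the finite set `Θ`. -/
def feasible {d : ℕ} (x : Fin p.n → EuclideanSpace ℝ (Fin d))
    (Θ : Finset (EuclideanSpace ℝ (Fin d))) : Set (Matrix (Fin d) (Fin d) ℝ) :=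
  {M | M.IsSymm ∧ ∀ θ ∈ Θ, quad M θ ∈ p.interval x θ}

/-- `Q` is the symmetric matrix of least Frobenius norm satisfying the constraints in the
directions of `Θ` (an arbitrary symmetric matrix if the constraints are incompatible). -/
def IsEstimate {d : ℕ} (x : Fin p.n → EuclideanSpace ℝ (Fin d))
    (Θ : Finset (EuclideanSpace ℝ (Fin d))) (Q : Matrix (Fin d) (Fin d) ℝ) : Prop :=
  Q.IsSymm ∧
    ((p.feasible x Θ).Nonempty → Q ∈ p.feasible x Θ ∧ ∀ M ∈ p.feasible x Θ, frob Q ≤ frob M)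

end Params

/-- `Θ` is a finite `δ`-net of the unit sphere. -/
def IsNet {d : ℕ} (δ : ℝ) (Θ : Finset (EuclideanSpace ℝ (Fin d))) : Prop :=
  (∀ θ ∈ Θ, ‖θ‖ = 1) ∧ ∀ θ : EuclideanSpace ℝ (Fin d), ‖θ‖ = 1 → ∃ ξ ∈ Θ, ‖θ - ξ‖ ≤ δ

/-! ### The estimators
For a symmetric matrix `M = U diag(μ₁, …, μ_d) Uᵀ`, the matrix `U diag(f(μ₁), …, f(μ_d)) Uᵀ` is
Mathlib's `cfc f M`. -/

/-- `Ĝ = Q₊`, the positive part of `Q`. -/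
def hatG {d : ℕ} (Q : Matrix (Fin d) (Fin d) ℝ) : Matrix (Fin d) (Fin d) ℝ :=
  cfc (fun t : ℝ => max t 0) Q

/-- `G̃ = ∑ᵢ [λ̂ᵢ - B(λ̂ᵢ)]₊ qᵢ qᵢᵀ`, where `Ĝ = ∑ᵢ λ̂ᵢ qᵢ qᵢᵀ`; here `g` stands for `‖G‖_F`. -/
def tildeG {d : ℕ} (p : Params) (δ g : ℝ) (Q : Matrix (Fin d) (Fin d) ℝ) :
    Matrix (Fin d) (Fin d) ℝ :=
  cfc (fun t : ℝ => max (t - p.B δ g t) 0) (hatG Q)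

/-- `11 Tr(G) B(λ₁) + 13 B(λ₁)²`, where `λ₁` is the largest eigenvalue of `G`. -/
def worstCase {d : ℕ} (p : Params) (δ : ℝ) (G : Matrix (Fin d) (Fin d) ℝ) : ℝ :=
  11 * Matrix.trace G * p.B δ (frob G) (topEig G) + 13 * p.B δ (frob G) (topEig G) ^ 2

end RobustPCA

end

noncomputable section

namespace RobustPCA

/-! ### A quadratic minorant at every point for `log (1 + y + y² / 2)` -/

/-! The argument has a probabilistic half, which brackets `quad Q θ` around the energy N(θ) = 𝔼⟨θ,
X⟩² for all unit θ at once, and a deterministic half, which turns this bracket into a Frobenius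
bound.

Probabilistic half. The influence function ψ is bounded, but a PAC-Bayesian bound needs an average
over Gaussian perturbations θ + τg of the direction. `psi_le_integral_log_perturb` dominates
ψ(±(⟨θ,x⟩² − λ)) by the Gaussian average of the logarithm of a quartic polynomial, whose average is
explicit (`integral_perturb`). The product of these polynomials over the sample, divided by its
expectation, has mean one for each fixed direction. Integrating it against a Gaussian prior,
applying Markov's inequality once, and shifting the prior by the Cameron–Martin formula and Jensen's
inequality (`exp_integral_shift_le`) gives a deviation inequality valid for every θ simultaneously
(`exists_pacBayes_event`). A union bound over the K grid levels and the two signs puts N(θ) in the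
confidence region of every θ with probability at least 1 − 2ε (`exists_event_energy_mem_region`).

Two points of one region satisfy the same family of inequalities, so they are close. At a grid level
within a factor e^a of the energy, the parameters λ and β are nearly optimal, and the free scaling α
along the half-line excludes large outliers (`width_above`, `abs_sub_le_of_mem_region`). Since G
itself is feasible, least norm gives ‖Q‖_F ≤ ‖G‖_F. This carries the bound from the net to the
sphere: |θᵀQθ − N(θ)| ≤ B(N(θ)) (`abs_quad_sub_energy_le`).

Deterministic half. The squared cosines between two eigenbases form a doubly stochastic matrix, and
‖f(A) − g(C)‖_F² is the corresponding weighted sum of (f(a_k) − g(c_l))² (`frob_cfc_sub_cfc_sq`).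
Lipschitz functions therefore reduce to the identity. Because B is nondecreasing and 1/2-Lipschitz,
the thresholded eigenvalues never exceed the energy in their own direction, and lose at most
3B(λ₁)/2. Expanding the square then yields ‖G − G̃‖_F² ≤ 5 Tr(G) B(λ₁) (`frob_sub_cfc_sq_le`), which
is stronger than what is claimed.

Rate. λ₁, Tr G and ‖G‖_F are all at most s₄², while K is of order log n. Hence B(λ₁) = O((log log n
/ n)^{1/2}) uniformly in the law and the dimension, and the square root in the bound halves this
exponent. -/

lemma quadratic_pos (y : ℝ) : 0 < 1 + y + y ^ 2 / 2 := by nlinarith [sq_nonneg (y + 1)]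

lemma half_le_quadratic (y : ℝ) : 1 / 2 ≤ 1 + y + y ^ 2 / 2 := by nlinarith [sq_nonneg (y + 1)]

lemma neg_log_two_le_log {y : ℝ} (hy : 1 / 2 ≤ y) : -Real.log 2 ≤ Real.log y := by
  rw [← Real.log_inv]
  exact Real.log_le_log (by norm_num) (by linarith)

lemma hasDerivAt_log_quadratic (y : ℝ) :
    HasDerivAt (fun y : ℝ => Real.log (1 + y + y ^ 2 / 2) + y ^ 2 / 8)
      ((1 + y) / (1 + y + y ^ 2 / 2) + y / 4) y := by
  have h1 : HasDerivAt (fun y : ℝ => 1 + y + y ^ 2 / 2) (1 + y) y := by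
    have := ((hasDerivAt_id' y).const_add 1).add ((hasDerivAt_pow 2 y).div_const 2)
    refine this.congr_deriv ?_
    simp
  have h2 := (h1.log (quadratic_pos y).ne').add ((hasDerivAt_pow 2 y).div_const 8)
  refine h2.congr_deriv ?_
  norm_num
  ring

/-- With t = (1 + y)², the second derivative of log(1 + y + y²/2) is 2(1 − t)/(1 + t)², whose
minimum −1/4 is reached at t = 3. Adding y²/8 exactly compensates it. -/
lemma convexOn_log_quadratic :
    ConvexOn ℝ Set.univ (fun y : ℝ => Real.log (1 + y + y ^ 2 / 2) + y ^ 2 / 8) := by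
  refine Monotone.convexOn_univ_of_deriv (fun y => (hasDerivAt_log_quadratic y).differentiableAt) ?_
  intro y z hyz
  rw [(hasDerivAt_log_quadratic y).deriv, (hasDerivAt_log_quadratic z).deriv]
  have hy := quadratic_pos y
  have hz := quadratic_pos z
  have key : ∀ a b : ℝ, 0 < a → 0 < b →
      (1 + z) / b + z / 4 - ((1 + y) / a + y / 4)
        = ((z - y) * (a * b) - 4 * ((1 + y) * b - (1 + z) * a)) / (4 * (a * b)) := by
    intro a b ha hb
    field_simp
    ring
  have hnum : 0 ≤ (z - y) * ((1 + y + y ^ 2 / 2) * (1 + z + z ^ 2 / 2))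
      - 4 * ((1 + y) * (1 + z + z ^ 2 / 2) - (1 + z) * (1 + y + y ^ 2 / 2)) := by
    -- The numerator of the increment of the derivative is z − y times a sum of squares, which
    -- vanishes only at the points of extremal curvature (1 + y)² = 3.
    have : 0 ≤ (z - y) * ((((1 + y) * (1 + z) - 3) ^ 2 + (y - z) ^ 2) / 4) :=
      mul_nonneg (sub_nonneg.2 hyz) (by positivity)
    refine this.trans (le_of_eq ?_)
    ring
  have := key _ _ hy hz
  have h0 : 0 ≤ (1 + z) / (1 + z + z ^ 2 / 2) + z / 4 - ((1 + y) / (1 + y + y ^ 2 / 2) + y / 4) := by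
    rw [this]
    positivity
  linarith

lemma tangent_le_log_quadratic (z y : ℝ) :
    Real.log (1 + z + z ^ 2 / 2) + (1 + z) / (1 + z + z ^ 2 / 2) * (y - z) - (y - z) ^ 2 / 8
      ≤ Real.log (1 + y + y ^ 2 / 2) := by
  have hd := hasDerivAt_log_quadratic z
  have hc := convexOn_log_quadratic
  rcases lt_trichotomy z y with h | h | h
  · have := hc.le_slope_of_hasDerivAt (Set.mem_univ z) (Set.mem_univ y) h hd
    rw [slope_def_field, le_div_iff₀ (by linarith)] at this
    nlinarith
  · subst h; simp
  · have := hc.slope_le_of_hasDerivAt (Set.mem_univ y) (Set.mem_univ z) h hd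
    rw [slope_def_field, div_le_iff₀ (by linarith)] at this
    nlinarith

/-- The Taylor remainder estimate is available on [0, 1] only. Halving the exponent and squaring
extends it to [0, 2]. -/
lemma exp_le_of_sq {x a b : ℝ} (h0 : 0 ≤ x) (h1 : x ≤ 2)
    (ha : (∑ m ∈ Finset.range 7, (x / 2) ^ m / (m.factorial : ℝ)) + (x / 2) ^ 7 * (7 + 1) / (5040 * 7) ≤ a)
    (hb : a ^ 2 ≤ b) : Real.exp x ≤ b := by
  have h := Real.exp_bound' (x := x / 2) (by linarith) (by linarith) (n := 7) (by norm_num)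
  have h2 : Real.exp x = Real.exp (x / 2) ^ 2 := by
    rw [← Real.exp_nat_mul]; congr 1; push_cast; ring
  have h3 : Real.exp (x / 2) ≤ a := by
    refine h.trans (le_trans (le_of_eq ?_) ha)
    norm_num [Nat.factorial]
  rw [h2]
  exact (pow_le_pow_left₀ (Real.exp_pos _).le h3 2).trans hb

lemma slope_anti {y z : ℝ} (hy : 0 ≤ y) (hyz : y ≤ z) :
    (1 + z) / (1 + z + z ^ 2 / 2) ≤ (1 + y) / (1 + y + y ^ 2 / 2) := by
  rw [div_le_div_iff₀ (quadratic_pos z) (quadratic_pos y)]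
  nlinarith [mul_nonneg hy (hy.trans hyz), mul_nonneg (sub_nonneg.2 hyz) hy,
    mul_nonneg (sub_nonneg.2 hyz) (mul_nonneg hy (hy.trans hyz))]

lemma exp_slope_le {y z b : ℝ} (hy : 0 ≤ y) (hyz : y ≤ z)
    (hb : Real.exp (((1 + y) / (1 + y + y ^ 2 / 2)) ^ 2 / (4 / 5)) ≤ b) :
    Real.exp (((1 + z) / (1 + z + z ^ 2 / 2)) ^ 2 / (4 / 5)) ≤ b := by
  refine le_trans (Real.exp_le_exp.2 ?_) hb
  have h0 : 0 ≤ (1 + z) / (1 + z + z ^ 2 / 2) :=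
    div_nonneg (by linarith) (quadratic_pos z).le
  have := slope_anti hy hyz
  gcongr

/-- Both sides decrease on [0, 1]. On each of five subintervals it is enough to compare the left
side at the left endpoint with the right side at the right endpoint; the breakpoints leave just
enough room for this. -/
lemma exp_slope_le_mul {z : ℝ} (h0 : 0 ≤ z) (h1 : z ≤ 1) :
    Real.exp (((1 + z) / (1 + z + z ^ 2 / 2)) ^ 2 / (4 / 5)) ≤ 51 / 10 * (1 - z + z ^ 2 / 2) := by
  have step : ∀ y w : ℝ, 0 ≤ y → y ≤ z → z ≤ w → w ≤ 1 →
      Real.exp (((1 + y) / (1 + y + y ^ 2 / 2)) ^ 2 / (4 / 5)) ≤ 51 / 10 * (1 - w + w ^ 2 / 2) →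
      Real.exp (((1 + z) / (1 + z + z ^ 2 / 2)) ^ 2 / (4 / 5)) ≤ 51 / 10 * (1 - z + z ^ 2 / 2) := by
    intro y w hy hyz hzw hw h
    refine (exp_slope_le hy hyz h).trans ?_
    nlinarith [mul_nonneg (sub_nonneg.2 hzw) (by linarith : (0:ℝ) ≤ 2 - z - w)]
  rcases le_total z (38 / 100) with h | h
  · refine step 0 (38 / 100) le_rfl h0 h (by norm_num) ?_
    refine exp_le_of_sq (a := 1869 / 1000) ?_ ?_ ?_ ?_ <;>
      norm_num [Finset.sum_range_succ, Nat.factorial]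
  rcases le_total z (53 / 100) with h' | h'
  · refine step (38 / 100) (53 / 100) (by norm_num) h h' (by norm_num) ?_
    refine exp_le_of_sq (a := 1759 / 1000) ?_ ?_ ?_ ?_ <;>
      norm_num [Finset.sum_range_succ, Nat.factorial]
  rcases le_total z (65 / 100) with h'' | h''
  · refine step (53 / 100) (65 / 100) (by norm_num) h' h'' (by norm_num) ?_
    refine exp_le_of_sq (a := 16903 / 10000) ?_ ?_ ?_ ?_ <;>
      norm_num [Finset.sum_range_succ, Nat.factorial]
  rcases le_total z (78 / 100) with h3 | h3
  · refine step (65 / 100) (78 / 100) (by norm_num) h'' h3 (by norm_num) ?_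
    refine exp_le_of_sq (a := 16348 / 10000) ?_ ?_ ?_ ?_ <;>
      norm_num [Finset.sum_range_succ, Nat.factorial]
  · refine step (78 / 100) 1 (by norm_num) h3 h1 le_rfl ?_
    refine exp_le_of_sq (a := 1580 / 1000) ?_ ?_ ?_ ?_ <;>
      norm_num [Finset.sum_range_succ, Nat.factorial]

/-! ### The influence function -/

lemma psi_neg (t : ℝ) : psi (-t) = -psi t := by
  unfold psi
  rcases lt_trichotomy t 0 with h | h | h
  · rw [if_pos (by linarith), if_neg (by linarith)]
  · subst h; simp
  · rw [if_neg (by linarith), if_pos h.le, neg_neg, neg_neg]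

lemma psi_of_mem {t : ℝ} (h0 : 0 ≤ t) (h1 : t ≤ 1) :
    psi t = -Real.log (1 - t + t ^ 2 / 2) := by
  rw [psi, if_pos h0, min_eq_left h1]

lemma psi_of_one_le {t : ℝ} (h1 : 1 ≤ t) : psi t = Real.log 2 := by
  rw [psi, if_pos (by linarith), min_eq_right h1, ← Real.log_inv]
  norm_num

lemma psi_of_nonpos {t : ℝ} (h0 : t ≤ 0) (h1 : -1 ≤ t) :
    psi t = Real.log (1 + t + t ^ 2 / 2) := by
  have := psi_neg (-t)
  rw [neg_neg] at this
  rw [this, psi_of_mem (by linarith) (by linarith)]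
  ring_nf

lemma psi_of_le_neg_one {t : ℝ} (h1 : t ≤ -1) : psi t = -Real.log 2 := by
  have := psi_neg (-t)
  rw [neg_neg] at this
  rw [this, psi_of_one_le (by linarith)]

lemma psi_le_log_two (t : ℝ) : psi t ≤ Real.log 2 := by
  have h2 := Real.log_pos (by norm_num : (1 : ℝ) < 2)
  rcases le_total t (-1) with h | h
  · rw [psi_of_le_neg_one h]; linarith
  rcases le_total t 0 with h' | h'
  · rw [psi_of_nonpos h' h]
    exact Real.log_le_log (quadratic_pos t) (by nlinarith)
  rcases le_total t 1 with h'' | h''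
  · rw [psi_of_mem h' h'']
    have := neg_log_two_le_log (y := 1 - t + t ^ 2 / 2) (by nlinarith [sq_nonneg (t - 1)])
    linarith
  · rw [psi_of_one_le h'']

lemma psi_nonpos {t : ℝ} (ht : t ≤ 0) : psi t ≤ 0 := by
  have h2 := Real.log_pos (by norm_num : (1 : ℝ) < 2)
  rcases le_total t (-1) with h | h
  · rw [psi_of_le_neg_one h]; linarith
  · rw [psi_of_nonpos ht h]
    exact Real.log_nonpos (quadratic_pos t).le (by nlinarith)

lemma psi_le_log_quadratic (t : ℝ) : psi t ≤ Real.log (1 + t + t ^ 2 / 2) := by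
  rcases le_total t (-1) with h | h
  · rw [psi_of_le_neg_one h]
    exact neg_log_two_le_log (half_le_quadratic t)
  rcases le_total t 0 with h' | h'
  · rw [psi_of_nonpos h' h]
  rcases le_total t 1 with h'' | h''
  · rw [psi_of_mem h' h'', ← Real.log_inv]
    have h3 : 0 < 1 - t + t ^ 2 / 2 := by nlinarith [sq_nonneg (t - 1)]
    refine Real.log_le_log (by positivity) ?_
    rw [inv_le_iff_one_le_mul₀ h3]
    nlinarith [sq_nonneg (t ^ 2)]
  · rw [psi_of_one_le h'']
    exact Real.log_le_log (by norm_num) (by nlinarith)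

/-- The parabola ψ(z) + p(y − z) − (y − z)²/5 has its peak at height ψ(z) + 5p²/4. The bound says
that, with p the slope of log(1 + y + y²/2) at z, no such peak exceeds the cap log(51/10). -/
lemma psi_add_slope_le (z : ℝ) :
    psi z + ((1 + z) / (1 + z + z ^ 2 / 2)) ^ 2 / (4 / 5) ≤ Real.log (51 / 10) := by
  have hq := quadratic_pos z
  rw [Real.le_log_iff_exp_le (by norm_num), Real.exp_add]
  rcases le_total z 0 with h | h
  · have h1 : Real.exp (psi z) ≤ 1 := Real.exp_le_one_iff.2 (psi_nonpos h)
    have h2 : Real.exp (((1 + z) / (1 + z + z ^ 2 / 2)) ^ 2 / (4 / 5)) ≤ 51 / 10 := by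
      have h3 : ((1 + z) / (1 + z + z ^ 2 / 2)) ^ 2 ≤ 1 := by
        rw [sq_le_one_iff_abs_le_one, abs_le]
        constructor
        · rw [le_div_iff₀ hq]; nlinarith [sq_nonneg (z + 2)]
        · rw [div_le_one hq]; nlinarith
      refine (Real.exp_le_exp.2 (by linarith : _ ≤ (5 / 4 : ℝ))).trans ?_
      refine exp_le_of_sq (a := 1869 / 1000) ?_ ?_ ?_ ?_ <;>
        norm_num [Finset.sum_range_succ, Nat.factorial]
    calc _ ≤ 1 * (51 / 10 : ℝ) := by gcongr
      _ = _ := by ring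
  rcases le_total z 1 with h' | h'
  · have h3 : 0 < 1 - z + z ^ 2 / 2 := by nlinarith [sq_nonneg (z - 1)]
    rw [psi_of_mem h h', Real.exp_neg, Real.exp_log h3, inv_mul_le_iff₀ h3]
    linarith [exp_slope_le_mul h h']
  · rw [psi_of_one_le h', Real.exp_log (by norm_num)]
    have := exp_slope_le (b := 51 / 20) zero_le_one h' (by
      have := exp_slope_le_mul zero_le_one le_rfl
      refine this.trans (by norm_num))
    linarith

/-- A quadratic minorant makes Jensen's inequality work in reverse: averaging over a variable y of
mean z loses only a fifth of its variance. Curvature 1/8 would suffice without the cap; the larger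
1/5 lowers the peaks below it. -/
lemma exists_tangent_psi (z : ℝ) : ∃ p : ℝ, ∀ y : ℝ, psi z + p * (y - z) - (y - z) ^ 2 / 5
    ≤ min (Real.log (51 / 10)) (Real.log (1 + y + y ^ 2 / 2)) := by
  refine ⟨(1 + z) / (1 + z + z ^ 2 / 2), fun y => le_min ?_ ?_⟩
  · have := psi_add_slope_le z
    nlinarith [sq_nonneg ((y - z) - 5 / 2 * ((1 + z) / (1 + z + z ^ 2 / 2)))]
  · have := tangent_le_log_quadratic z y
    have := psi_le_log_quadratic z
    nlinarith [sq_nonneg (y - z)]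

/-! ### The constant `c` -/

/-- The three factors are the cap on the exponential of the truncated logarithm, the rate of the
compensating term, and the slope of a chord of exp. The product falls short of c by less than one
percent, hence the sharp numerical bounds on √2 and exp. -/
lemma le_c : 51 / 10 * (8 / 5) * (15 / (4 * Real.log 2)) ≤ c := by
  have h2 := Real.log_pos (by norm_num : (1 : ℝ) < 2)
  have hs1 : (1414 / 1000 : ℝ) ≤ Real.sqrt 2 := Real.le_sqrt_of_sq_le (by norm_num)
  have hs2 : Real.sqrt 2 ≤ 14143 / 10000 := Real.sqrt_le_iff.2 ⟨by norm_num, by norm_num⟩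
  have hE : (6779 / 1000 : ℝ) ≤ Real.exp ((1 + 2 * Real.sqrt 2) / 2) := by
    refine le_trans ?_ (Real.exp_le_exp.2 (by linarith : (1914 / 1000 : ℝ) ≤ _))
    have : Real.exp (1914 / 1000) = Real.exp (957 / 1000) ^ 2 := by
      rw [← Real.exp_nat_mul]; norm_num
    rw [this]
    have h := Real.sum_le_exp_of_nonneg (x := 957 / 1000) (by norm_num) 9
    have h' : (26037 / 10000 : ℝ) ≤ Real.exp (957 / 1000) := by
      refine le_trans ?_ h
      norm_num [Finset.sum_range_succ, Nat.factorial]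
    nlinarith
  have hs : 0 < Real.sqrt 2 - 1 := by linarith
  unfold c
  rw [div_mul_eq_mul_div (15 : ℝ) (8 * Real.log 2 * (Real.sqrt 2 - 1)), le_div_iff₀ (by positivity)]
  have : 51 / 10 * (8 / 5) * (15 / (4 * Real.log 2)) * (8 * Real.log 2 * (Real.sqrt 2 - 1))
      = 51 / 10 * (8 / 5) * 30 * (Real.sqrt 2 - 1) := by
    field_simp
    norm_num
  rw [this]
  nlinarith

/-- By convexity, exp lies below its chord on [0, 4 log 2], whose slope is (16 − 1)/(4 log 2). -/
lemma exp_min_le {t : ℝ} (ht : 0 ≤ t) :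
    Real.exp (min (4 * Real.log 2) t) ≤ 1 + 15 / (4 * Real.log 2) * t := by
  have h2 := Real.log_pos (by norm_num : (1 : ℝ) < 2)
  set u := min (4 * Real.log 2) t with hu
  have hu0 : 0 ≤ u := le_min (by positivity) ht
  have hu1 : u ≤ 4 * Real.log 2 := min_le_left _ _
  have h16 : Real.exp (4 * Real.log 2) = 16 := by
    rw [show (4 : ℝ) * Real.log 2 = Real.log (2 ^ 4) by rw [Real.log_pow]; norm_num,
      Real.exp_log (by norm_num)]
    norm_num
  have hc := convexOn_exp.right (Set.mem_univ (0 : ℝ)) (Set.mem_univ (4 * Real.log 2))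
    (show 0 ≤ 1 - u / (4 * Real.log 2) by rw [sub_nonneg, div_le_one (by positivity)]; exact hu1)
    (show 0 ≤ u / (4 * Real.log 2) by positivity) (by ring)
  simp only [smul_eq_mul, mul_zero, zero_add, Real.exp_zero, mul_one, h16] at hc
  rw [div_mul_cancel₀ _ (by positivity)] at hc
  have : u ≤ t := min_le_right _ _
  calc Real.exp u ≤ 1 + 15 / (4 * Real.log 2) * u := by
        refine hc.trans (le_of_eq ?_); ring
    _ ≤ _ := by gcongr

/-- After exponentiation, the first factor is bounded both by 1 + y + y²/2 and by 51/10. The first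
bound serves for the constant part of the chord, the second for its linear part, and `le_c` absorbs
the product. -/
lemma min_add_min_le_log {y h : ℝ} (hh : 0 ≤ h) :
    min (Real.log (51 / 10)) (Real.log (1 + y + y ^ 2 / 2)) + min (4 * Real.log 2) (8 / 5 * h)
      ≤ Real.log (1 + y + y ^ 2 / 2 + c * h) := by
  have h2 := Real.log_pos (by norm_num : (1 : ℝ) < 2)
  have hq := quadratic_pos y
  have hc := c_pos
  rw [Real.le_log_iff_exp_le (by positivity), Real.exp_add]
  set E := Real.exp (min (Real.log (51 / 10)) (Real.log (1 + y + y ^ 2 / 2)))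
  have hE0 : 0 < E := Real.exp_pos _
  have hE1 : E ≤ 51 / 10 := by
    refine (Real.exp_le_exp.2 (min_le_left _ _)).trans ?_
    rw [Real.exp_log (by norm_num)]
  have hE2 : E ≤ 1 + y + y ^ 2 / 2 := by
    refine (Real.exp_le_exp.2 (min_le_right _ _)).trans ?_
    rw [Real.exp_log hq]
  have h1 := exp_min_le (t := 8 / 5 * h) (by positivity)
  have hd : 0 ≤ 15 / (4 * Real.log 2) := by positivity
  calc _ ≤ E * (1 + 15 / (4 * Real.log 2) * (8 / 5 * h)) := by gcongr
    _ = E + E * (8 / 5) * (15 / (4 * Real.log 2)) * h := by ring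
    _ ≤ E + 51 / 10 * (8 / 5) * (15 / (4 * Real.log 2)) * h := by gcongr
    _ ≤ _ := by
      have := mul_le_mul_of_nonneg_right le_c hh
      linarith

/-! ### Moments of the Gaussian law -/

section Moments

open scoped NNReal

variable (v : ℝ≥0)

lemma hasDerivAt_mul_gaussian_exp (p q : ℝ → ℝ) (t : ℝ) (hp : HasDerivAt p (q t - v * t * p t) t) :
    HasDerivAt (fun t => p t * Real.exp (v * t ^ 2 / 2)) (q t * Real.exp (v * t ^ 2 / 2)) t := by
  have h1 : HasDerivAt (fun t : ℝ => v * t ^ 2 / 2) (v * t) t := by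
    refine (((hasDerivAt_pow 2 t).const_mul (v : ℝ)).div_const 2).congr_deriv ?_
    norm_num
    ring
  refine (hp.mul h1.exp).congr_deriv ?_
  ring

lemma integrable_pow_gaussian (k : ℕ) : Integrable (fun w => w ^ k) (gaussianReal 0 v) := by
  rcases Nat.eq_zero_or_pos k with rfl | hk
  · simp
  have := (memLp_id_gaussianReal (μ := 0) (v := v) (k : ℝ≥0)).integrable_norm_rpow
    (by simpa using hk.ne') (by simp)
  refine (integrable_norm_iff (by fun_prop)).1 ?_
  simpa [norm_pow] using this

/-- Moments are derivatives at 0 of the moment generating function exp(vt²/2); each differentiation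
multiplies out to a polynomial times the same exponential. -/
lemma integral_pow_gaussian (k : ℕ) (p : ℕ → ℝ → ℝ) (h0 : ∀ t, p 0 t = 1)
    (hp : ∀ i t, HasDerivAt (p i) (p (i + 1) t - v * t * p i t) t) :
    ∫ w, w ^ k ∂(gaussianReal 0 v) = p k 0 := by
  have hD : ∀ i, iteratedDeriv i (fun t : ℝ => Real.exp (v * t ^ 2 / 2))
      = fun t => p i t * Real.exp (v * t ^ 2 / 2) := by
    intro i
    induction i with
    | zero => ext t; simp [h0]
    | succ i ih =>
      rw [iteratedDeriv_succ, ih]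
      ext t
      exact (hasDerivAt_mul_gaussian_exp v (p i) (p (i + 1)) t (hp i t)).deriv
  have h := iteratedDeriv_mgf_zero (X := id) (μ := gaussianReal 0 v)
    (by rw [integrableExpSet_id_gaussianReal]; simp) k
  rw [mgf_id_gaussianReal] at h
  have e : (fun t : ℝ => Real.exp (0 * t + v * t ^ 2 / 2)) = fun t : ℝ => Real.exp (v * t ^ 2 / 2) := by
    ext t; simp
  rw [e, hD k] at h
  simpa using h.symm

open Polynomial in
/-- The polynomials `H_k` with `(d/dt)^k exp (v t² / 2) = H_k(t) exp (v t² / 2)`. -/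
def mgfPoly : ℕ → Polynomial ℝ
  | 0 => 1
  | k + 1 => derivative (mgfPoly k) + C (v : ℝ) * X * mgfPoly k

lemma integral_pow_gaussian_eq_eval (k : ℕ) :
    ∫ w, w ^ k ∂(gaussianReal 0 v) = (mgfPoly v k).eval 0 := by
  refine integral_pow_gaussian v k (fun i t => (mgfPoly v i).eval t) (by simp [mgfPoly]) ?_
  intro i t
  refine ((mgfPoly v i).hasDerivAt t).congr_deriv ?_
  simp [mgfPoly]

lemma integral_quartic_gaussian (a b d e f : ℝ) :
    ∫ w, (a + b * w + d * w ^ 2 + e * w ^ 3 + f * w ^ 4) ∂(gaussianReal 0 v)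
      = a + d * v + 3 * f * v ^ 2 := by
  have h := integrable_pow_gaussian v
  have h1 : Integrable (fun w : ℝ => w) (gaussianReal 0 v) := by simpa using h 1
  have e1 : ∫ w, w ∂(gaussianReal 0 v) = 0 := by simp
  have e2 : ∫ w, w ^ 2 ∂(gaussianReal 0 v) = v := by
    rw [integral_pow_gaussian_eq_eval]; simp [mgfPoly]
  have e3 : ∫ w, w ^ 3 ∂(gaussianReal 0 v) = 0 := by
    rw [integral_pow_gaussian_eq_eval]; simp [mgfPoly]
  have e4 : ∫ w, w ^ 4 ∂(gaussianReal 0 v) = 3 * v ^ 2 := by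
    rw [integral_pow_gaussian_eq_eval]; simp [mgfPoly]; ring
  have i1 : Integrable (fun w => a + b * w) (gaussianReal 0 v) :=
    (integrable_const a).add (h1.const_mul b)
  have i2 : Integrable (fun w => a + b * w + d * w ^ 2) (gaussianReal 0 v) :=
    i1.add ((h 2).const_mul d)
  have i3 : Integrable (fun w => a + b * w + d * w ^ 2 + e * w ^ 3) (gaussianReal 0 v) :=
    i2.add ((h 3).const_mul e)
  rw [integral_add i3 ((h 4).const_mul _), integral_add i2 ((h 3).const_mul _),
    integral_add i1 ((h 2).const_mul _), integral_add (integrable_const _) (h1.const_mul _),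
    integral_const_mul, integral_const_mul, integral_const_mul, integral_const_mul, e1, e2, e3, e4]
  simp
  ring

lemma integrable_quartic_gaussian (a b d e f : ℝ) :
    Integrable (fun w => a + b * w + d * w ^ 2 + e * w ^ 3 + f * w ^ 4) (gaussianReal 0 v) := by
  have h := integrable_pow_gaussian v
  have h1 : Integrable (fun w : ℝ => w) (gaussianReal 0 v) := by simpa using h 1
  exact (((((integrable_const a).add (h1.const_mul b)).add ((h 2).const_mul d)).add
    ((h 3).const_mul e)).add ((h 4).const_mul f))

/-- Half of the mass of a centred Gaussian shift increases the modulus. -/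
lemma half_le_integral_gaussian_shift {f : ℝ → ℝ} (hf : Measurable f) {C : ℝ}
    (hC : ∀ t, f t ≤ C) (h0 : ∀ t, 0 ≤ f t) (hmono : ∀ s t, s ^ 2 ≤ t ^ 2 → f s ≤ f t) (m : ℝ) :
    f m / 2 ≤ ∫ w, f (m + w) ∂(gaussianReal 0 v) := by
  have hint : ∀ g : ℝ → ℝ, Measurable g → Integrable (fun w => f (g w)) (gaussianReal 0 v) := by
    intro g hg
    refine Integrable.of_bound (C := C) (hf.comp hg).aestronglyMeasurable
      (Filter.Eventually.of_forall fun w => ?_)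
    rw [Real.norm_of_nonneg (h0 _)]
    exact hC _
  have hsymm : ∫ w, f (m + w) ∂(gaussianReal 0 v) = ∫ w, f (m - w) ∂(gaussianReal 0 v) := by
    have h := gaussianReal_map_neg (μ := 0) (v := v)
    rw [neg_zero] at h
    conv_lhs => rw [← h]
    have hm : Measurable fun w => f (m + w) := hf.comp (by fun_prop)
    rw [integral_map (by fun_prop) hm.aestronglyMeasurable]
    rfl
  -- For every w, at least one of m + w and m − w has modulus at least |m|.
  have h2 : f m ≤ ∫ w, (f (m + w) + f (m - w)) ∂(gaussianReal 0 v) := by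
    have : ∫ _, f m ∂(gaussianReal 0 v) = f m := by simp
    rw [← this]
    refine integral_mono (integrable_const _)
      ((hint _ (by fun_prop)).add (hint _ (by fun_prop))) fun w => ?_
    rcases le_total 0 (m * w) with h | h
    · have := hmono m (m + w) (by nlinarith [sq_nonneg w])
      have := h0 (m - w)
      linarith
    · have := hmono m (m - w) (by nlinarith [sq_nonneg w])
      have := h0 (m + w)
      linarith
  rw [integral_add (hint _ (by fun_prop)) (hint _ (by fun_prop)), ← hsymm] at h2
  linarith

/-! ### The perturbed influence function -/

/-- The polynomial `1 + s Y + Y² / 2 + c h`, where `Y = u² - v - λ` and `h = v (u² + v / 2)`. -/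
def perturb (s lam v u : ℝ) : ℝ :=
  1 + s * (u ^ 2 - v - lam) + (u ^ 2 - v - lam) ^ 2 / 2 + c * (v * (u ^ 2 + v / 2))

lemma half_le_perturb {s lam v : ℝ} (hs : s ^ 2 = 1) (hv : 0 ≤ v) (u : ℝ) :
    1 / 2 ≤ perturb s lam v u := by
  have hc := c_pos
  have : 0 ≤ c * (v * (u ^ 2 + v / 2)) := by positivity
  unfold perturb
  nlinarith [sq_nonneg (s + (u ^ 2 - v - lam))]

lemma perturb_pos {s lam v : ℝ} (hs : s ^ 2 = 1) (hv : 0 ≤ v) (u : ℝ) :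
    0 < perturb s lam v u := by
  linarith [half_le_perturb (lam := lam) hs hv u]

lemma perturb_eq_quartic (s lam v m w : ℝ) : perturb s lam v (m + w)
    = (1 + s * (m ^ 2 - v - lam) + (m ^ 2 - v - lam) ^ 2 / 2 + c * (v * (m ^ 2 + v / 2)))
      + (2 * m * (s + (m ^ 2 - v - lam) + c * v)) * w
      + (s + (m ^ 2 - v - lam) + c * v + 2 * m ^ 2) * w ^ 2 + (2 * m) * w ^ 3 + 1 / 2 * w ^ 4 := by
  unfold perturb
  ring

lemma integrable_perturb (s lam m : ℝ) :
    Integrable (fun w => perturb s lam v (m + w)) (gaussianReal 0 v) := by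
  simp_rw [perturb_eq_quartic]
  exact integrable_quartic_gaussian v _ _ _ _ _

/-- The correction −v centres Y at m² − λ. Half its variance contributes 2vm² + v², and h has mean
vm² + 3v²/2, whence the coefficients 2 + c and (2 + 3c)/2. -/
lemma integral_perturb (s lam m : ℝ) :
    ∫ w, perturb s lam v (m + w) ∂(gaussianReal 0 v)
      = 1 + s * (m ^ 2 - lam) + (m ^ 2 - lam) ^ 2 / 2 + (2 + c) * (v * m ^ 2)
        + (2 + 3 * c) / 2 * v ^ 2 := by
  simp_rw [perturb_eq_quartic]
  rw [integral_quartic_gaussian]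
  ring

lemma measurable_perturb (s lam v : ℝ) : Measurable (perturb s lam v) := by
  unfold perturb
  fun_prop

lemma integrable_log_perturb {s : ℝ} (hs : s ^ 2 = 1) (lam m : ℝ) :
    Integrable (fun w => Real.log (perturb s lam v (m + w))) (gaussianReal 0 v) := by
  refine Integrable.mono' ((integrable_perturb v s lam m).add (integrable_const (Real.log 2)))
    ((measurable_perturb s lam v).comp
      (measurable_const.add measurable_id)).log.aestronglyMeasurable (Filter.Eventually.of_forall fun w => ?_)
  have h1 := half_le_perturb (lam := lam) hs v.2 (m + w)
  have h2 := neg_log_two_le_log h1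
  have h3 := Real.log_le_sub_one_of_pos (perturb_pos (lam := lam) hs v.2 (m + w))
  have h4 := Real.log_pos (by norm_num : (1 : ℝ) < 2)
  rw [Real.norm_eq_abs, abs_le]
  simp only [Pi.add_apply]
  change (1:ℝ) / 2 ≤ perturb s lam (v : ℝ) (m + w) at h1
  change -Real.log 2 ≤ Real.log (perturb s lam (v : ℝ) (m + w)) at h2
  change Real.log (perturb s lam (v : ℝ) (m + w)) ≤ perturb s lam (v : ℝ) (m + w) - 1 at h3
  constructor <;> linarith

/-- The influence function is dominated by a Gaussian average of the perturbed logarithm. -/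
lemma psi_le_integral_log_perturb {s : ℝ} (hs : s ^ 2 = 1) (lam m : ℝ) :
    psi (s * (m ^ 2 - lam))
      ≤ ∫ w, Real.log (perturb s lam v (m + w)) ∂(gaussianReal 0 v) := by
  have hl := Real.log_pos (by norm_num : (1 : ℝ) < 2)
  have hv : (0 : ℝ) ≤ v := v.2
  set z := s * (m ^ 2 - lam) with hz
  set Y : ℝ → ℝ := fun w => s * ((m + w) ^ 2 - v - lam) with hY
  set chi : ℝ → ℝ := fun y => min (Real.log (51 / 10)) (Real.log (1 + y + y ^ 2 / 2)) with hchi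
  set f : ℝ → ℝ := fun u => min (4 * Real.log 2) (8 / 5 * (v * (u ^ 2 + v / 2))) with hf
  have hl51 : 0 ≤ Real.log (51 / 10) := Real.log_nonneg (by norm_num)
  have hchi0 : ∀ y, -Real.log 2 ≤ chi y := fun y =>
    le_min (by linarith) (neg_log_two_le_log (half_le_quadratic y))
  have hchi_int : Integrable (fun w => chi (Y w)) (gaussianReal 0 v) := by
    refine Integrable.of_bound (C := Real.log 2 + Real.log (51 / 10)) ?_
      (Filter.Eventually.of_forall fun w => ?_)
    · apply Measurable.aestronglyMeasurable
      simp only [hchi, hY]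
      fun_prop
    · rw [Real.norm_eq_abs, abs_le]
      have h1 := hchi0 (Y w)
      have h2 : chi (Y w) ≤ Real.log (51 / 10) := min_le_left _ _
      constructor <;> linarith
  have hf0 : ∀ u, 0 ≤ f u := fun u => le_min (by positivity) (by positivity)
  have hf_meas : Measurable f := by simp only [hf]; fun_prop
  have hf_int : Integrable (fun w => f (m + w)) (gaussianReal 0 v) := by
    refine Integrable.of_bound (C := 4 * Real.log 2) (by fun_prop)
      (Filter.Eventually.of_forall fun w => ?_)
    rw [Real.norm_of_nonneg (hf0 _)]
    exact min_le_left _ _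
  have hfm : f m / 2 ≤ ∫ w, f (m + w) ∂(gaussianReal 0 v) := by
    refine half_le_integral_gaussian_shift v hf_meas (C := 4 * Real.log 2)
      (fun t => min_le_left _ _) hf0 (fun a b hab => ?_) m
    simp only [hf]
    gcongr
  have hchi1 : -Real.log 2 ≤ ∫ w, chi (Y w) ∂(gaussianReal 0 v) := by
    have : ∫ _, -Real.log 2 ∂(gaussianReal 0 v) = -Real.log 2 := by simp
    rw [← this]
    exact integral_mono (integrable_const _) hchi_int fun w => hchi0 _
  -- Y has mean z, so the linear term of the minorant disappears, and its variance 4m²v + 2v² is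
  -- divided by 5.
  have hchi2 : psi z - (4 / 5 * m ^ 2 * v + 2 / 5 * v ^ 2)
      ≤ ∫ w, chi (Y w) ∂(gaussianReal 0 v) := by
    obtain ⟨p, hp⟩ := exists_tangent_psi z
    have e : ∀ w, psi z + p * (Y w - z) - (Y w - z) ^ 2 / 5
        = (psi z - p * s * v - v ^ 2 / 5) + (2 * m * p * s + 4 / 5 * m * v) * w
          + (p * s - (4 * m ^ 2 - 2 * v) / 5) * w ^ 2 + (-(4 / 5) * m) * w ^ 3
          + (-(1 / 5)) * w ^ 4 := by
      intro w
      have e1 : Y w - z = s * (2 * m * w + w ^ 2 - v) := by simp only [hY, hz]; ring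
      rw [e1, mul_pow, hs]
      ring
    have h := integral_mono (μ := gaussianReal 0 v)
      (by simpa only [e] using integrable_quartic_gaussian v _ _ _ _ _) hchi_int
      (fun w => hp (Y w))
    simp only [e] at h
    rw [integral_quartic_gaussian] at h
    refine le_trans (le_of_eq ?_) h
    ring
  have hsum : ∫ w, chi (Y w) ∂(gaussianReal 0 v) + ∫ w, f (m + w) ∂(gaussianReal 0 v)
      ≤ ∫ w, Real.log (perturb s lam v (m + w)) ∂(gaussianReal 0 v) := by
    rw [← integral_add hchi_int hf_int]
    refine integral_mono (hchi_int.add hf_int) (integrable_log_perturb v hs lam m) fun w => ?_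
    have h := min_add_min_le_log (y := Y w) (h := v * ((m + w) ^ 2 + v / 2)) (by positivity)
    refine h.trans (le_of_eq ?_)
    congr 1
    simp only [hY, perturb, mul_pow, hs, one_mul]
  have hpsi := psi_le_log_two z
  have hm : min (2 * Real.log 2) (4 / 5 * m ^ 2 * v + 2 / 5 * v ^ 2) ≤ f m / 2 := by
    simp only [hf]
    rw [le_div_iff₀ (by norm_num)]
    refine le_min ?_ ?_
    · have := min_le_left (2 * Real.log 2) (4 / 5 * m ^ 2 * v + 2 / 5 * (v : ℝ) ^ 2)
      linarith
    · have := min_le_right (2 * Real.log 2) (4 / 5 * m ^ 2 * v + 2 / 5 * (v : ℝ) ^ 2)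
      nlinarith
  -- Either the compensating term is saturated, and its 2 log 2 covers the gap between ψ ≤ log 2 and
  -- χ ≥ −log 2, or it equals exactly the variance loss.
  rcases min_cases (2 * Real.log 2) (4 / 5 * m ^ 2 * v + 2 / 5 * (v : ℝ) ^ 2) with h | h <;>
    linarith [h.1]

end Moments

/-! ### The Cameron–Martin formula for the standard Gaussian law -/

section CameronMartin

variable {d : ℕ}

local notation "E" => EuclideanSpace ℝ (Fin d)

/-- The standard Gaussian law on `ℝ^d`. -/
abbrev gauss (d : ℕ) : Measure (EuclideanSpace ℝ (Fin d)) :=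
  stdGaussian (EuclideanSpace ℝ (Fin d))

lemma map_inner_gauss (x : E) (τ : ℝ) :
    (gauss d).map (fun g => inner ℝ (τ • g) x) = gaussianReal 0 ((τ ^ 2 * ‖x‖ ^ 2).toNNReal) := by
  have h := IsGaussian.map_eq_gaussianReal (μ := gauss d) (innerSL ℝ (τ • x))
  rw [integral_strongDual_stdGaussian, variance_dual_stdGaussian, innerSL_apply_norm, norm_smul,
    mul_pow, Real.norm_eq_abs, sq_abs] at h
  rw [← h]
  congr 1
  ext g
  simp [inner_smul_left, real_inner_comm]

/-- Mixing a real and an imaginary exponent yields at once the normalisation of the tilted law (t =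
0) and its characteristic function. -/
lemma integral_cexp_gauss (η t : E) :
    ∫ g, Complex.exp ((inner ℝ η g : ℝ) + (inner ℝ g t : ℝ) * Complex.I) ∂(gauss d)
      = Complex.exp ((‖η‖ ^ 2 / 2 : ℝ) + (inner ℝ η t : ℝ) * Complex.I - (‖t‖ ^ 2 / 2 : ℝ)) := by
  rw [gauss, ← map_pi_eq_stdGaussian, integral_map (by fun_prop)
    (by apply Continuous.aestronglyMeasurable; fun_prop)]
  have e : ∀ g : Fin d → ℝ,
      Complex.exp ((inner ℝ η (WithLp.toLp 2 g) : ℝ)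
        + (inner ℝ (WithLp.toLp 2 g : E) t : ℝ) * Complex.I)
      = ∏ k, Complex.exp (((η k : ℂ) + t k * Complex.I) * (g k : ℝ)) := by
    intro g
    rw [← Complex.exp_sum]
    congr 1
    simp only [PiLp.inner_apply, Complex.ofReal_sum, Finset.sum_mul, ← Finset.sum_add_distrib]
    refine Finset.sum_congr rfl fun k _ => ?_
    simp
    ring
  simp_rw [e]
  rw [integral_fintype_prod_eq_prod (f := fun k (y : ℝ) =>
    Complex.exp (((η k : ℂ) + t k * Complex.I) * (y : ℝ)))]
  have h1 : ∀ z : ℂ, ∫ y : ℝ, Complex.exp (z * y) ∂(gaussianReal 0 1) = Complex.exp (z ^ 2 / 2) := by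
    intro z
    have := complexMGF_id_gaussianReal (μ := 0) (v := 1) z
    simpa [complexMGF] using this
  simp_rw [h1]
  rw [← Complex.exp_sum]
  congr 1
  rw [EuclideanSpace.real_norm_sq_eq, EuclideanSpace.real_norm_sq_eq]
  simp only [PiLp.inner_apply, Complex.ofReal_sum, Complex.ofReal_div, Finset.sum_mul,
    Finset.sum_div, ← Finset.sum_add_distrib, ← Finset.sum_sub_distrib]
  refine Finset.sum_congr rfl fun k _ => ?_
  have : Complex.I ^ 2 = -1 := Complex.I_sq
  simp
  linear_combination (t k : ℂ) ^ 2 / 2 * this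

lemma integral_exp_inner_gauss (η : E) :
    ∫ g, Real.exp (inner ℝ η g) ∂(gauss d) = Real.exp (‖η‖ ^ 2 / 2) := by
  have h := integral_cexp_gauss η 0
  simp only [inner_zero_right, norm_zero] at h
  have e : ∀ g : E, Complex.exp ((inner ℝ η g : ℝ) + ((0 : ℝ) : ℂ) * Complex.I)
      = ((Real.exp (inner ℝ η g) : ℝ) : ℂ) := by intro g; simp
  simp_rw [e] at h
  rw [integral_complex_ofReal] at h
  have h' : ((∫ g, Real.exp (inner ℝ η g) ∂(gauss d) : ℝ) : ℂ)
      = ((Real.exp (‖η‖ ^ 2 / 2) : ℝ) : ℂ) := by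
    rw [h]; simp
  exact_mod_cast h'

lemma integrable_exp_inner_gauss (η : E) :
    Integrable (fun g => Real.exp (inner ℝ η g)) (gauss d) := by
  by_contra h
  have h1 := integral_exp_inner_gauss η
  rw [integral_undef h] at h1
  exact (Real.exp_pos _).ne h1

/-- The Cameron–Martin formula. -/
lemma map_add_gauss (η : E) :
    (gauss d).map (fun g => g + η) = (gauss d).tilted (fun g => inner ℝ η g) := by
  have := isProbabilityMeasure_tilted (integrable_exp_inner_gauss η)
  refine Measure.ext_of_charFun ?_
  ext t
  rw [charFun_apply, charFun_apply, integral_map (by fun_prop)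
    (by apply Continuous.aestronglyMeasurable; fun_prop), integral_tilted,
    integral_exp_inner_gauss]
  have e1 : ∀ g : E, Complex.exp ((inner ℝ (g + η) t : ℝ) * Complex.I)
      = Complex.exp ((inner ℝ η t : ℝ) * Complex.I)
        * Complex.exp ((inner ℝ (0 : E) g : ℝ) + (inner ℝ g t : ℝ) * Complex.I) := by
    intro g
    rw [← Complex.exp_add, inner_add_left]
    congr 1
    simp
    ring
  have e2 : ∀ g : E, (Real.exp (inner ℝ η g) / Real.exp (‖η‖ ^ 2 / 2))
        • Complex.exp ((inner ℝ g t : ℝ) * Complex.I)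
      = ((Real.exp (‖η‖ ^ 2 / 2))⁻¹ : ℝ)
        * Complex.exp ((inner ℝ η g : ℝ) + (inner ℝ g t : ℝ) * Complex.I) := by
    intro g
    rw [Complex.exp_add, Complex.real_smul, div_eq_inv_mul]
    push_cast
    ring
  simp_rw [e1, e2]
  rw [integral_const_mul, integral_const_mul, integral_cexp_gauss, integral_cexp_gauss,
    ← Real.exp_neg, Complex.ofReal_exp, ← Complex.exp_add, ← Complex.exp_add]
  congr 1
  simp
  ring

lemma lintegral_add_gauss (η : E) {F : E → ENNReal} (hF : Measurable F) :
    ∫⁻ g, F (g + η) ∂(gauss d)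
      = ∫⁻ g, ENNReal.ofReal (Real.exp (inner ℝ η g - ‖η‖ ^ 2 / 2)) * F g ∂(gauss d) := by
  rw [← lintegral_map (f := F) hF (by fun_prop : Measurable fun g : E => g + η), map_add_gauss,
    lintegral_tilted, integral_exp_inner_gauss]
  simp_rw [Real.exp_sub]

/-- Jensen's inequality for the exponential, with an extended-valued right-hand side. -/
lemma ofReal_exp_integral_le {α : Type*} [MeasurableSpace α] (μ : Measure α)
    [IsProbabilityMeasure μ] {f : α → ℝ} (hf : Integrable f μ) :
    ENNReal.ofReal (Real.exp (∫ a, f a ∂μ)) ≤ ∫⁻ a, ENNReal.ofReal (Real.exp (f a)) ∂μ := by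
  by_cases h : Integrable (fun a => Real.exp (f a)) μ
  · rw [← ofReal_integral_eq_lintegral_ofReal h (Filter.Eventually.of_forall fun a =>
      (Real.exp_pos _).le)]
    exact ENNReal.ofReal_le_ofReal (convexOn_exp.map_integral_le Real.continuous_exp.continuousOn
      isClosed_univ (by simp) hf h)
  · have hm : AEStronglyMeasurable (fun a => Real.exp (f a)) μ :=
      Real.continuous_exp.comp_aestronglyMeasurable hf.1
    have : ∫⁻ a, ENNReal.ofReal (Real.exp (f a)) ∂μ = ⊤ := by
      by_contra hne
      exact h ((lintegral_ofReal_ne_top_iff_integrable hm (Filter.Eventually.of_forall fun a =>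
        (Real.exp_pos _).le)).1 hne)
    rw [this]
    exact le_top

/-- The PAC-Bayesian change of measure between Gaussian laws with the same covariance. -/
lemma exp_integral_shift_le {H : E → ℝ} (hH : Measurable H) {τ : ℝ} (hτ : 0 < τ) (θ : E)
    (hint : Integrable (fun g => H (θ + τ • g)) (gauss d)) :
    ENNReal.ofReal (Real.exp (∫ g, H (θ + τ • g) ∂(gauss d) - ‖θ‖ ^ 2 / (2 * τ ^ 2)))
      ≤ ∫⁻ g, ENNReal.ofReal (Real.exp (H (τ • g))) ∂(gauss d) := by
  set η : E := τ⁻¹ • θ with hη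
  have hτη : τ • η = θ := by rw [hη, smul_smul, mul_inv_cancel₀ hτ.ne', one_smul]
  have hηn : ‖η‖ ^ 2 = ‖θ‖ ^ 2 / τ ^ 2 := by
    rw [hη, norm_smul, mul_pow, Real.norm_eq_abs, sq_abs]; field_simp
  have hlin : Integrable (fun g : E => inner ℝ η g) (gauss d) :=
    IsGaussian.integrable_dual (gauss d) (innerSL ℝ η)
  have hlin0 : ∫ g : E, inner ℝ η g ∂(gauss d) = 0 :=
    integral_strongDual_stdGaussian (innerSL ℝ η)
  -- F contains the inverse of the Cameron–Martin density: integrating F against the shifted law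
  -- recovers the prior average of exp H. After the shift, its exponent is H(θ + τg) minus a centred
  -- linear term and the entropy cost ‖η‖²/2 = ‖θ‖²/(2τ²).
  set F : E → ENNReal := fun g =>
    ENNReal.ofReal (Real.exp (H (τ • g) - inner ℝ η g + ‖η‖ ^ 2 / 2)) with hF
  have hFm : Measurable F := by simp only [hF]; fun_prop
  have h1 := lintegral_add_gauss η hFm
  have h2 : ∀ g, ENNReal.ofReal (Real.exp (inner ℝ η g - ‖η‖ ^ 2 / 2)) * F g
      = ENNReal.ofReal (Real.exp (H (τ • g))) := by
    intro g
    simp only [hF]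
    rw [← ENNReal.ofReal_mul (Real.exp_pos _).le, ← Real.exp_add]
    congr 2
    ring
  simp_rw [h2] at h1
  rw [← h1]
  have h3 : ∀ g, F (g + η)
      = ENNReal.ofReal (Real.exp (H (θ + τ • g) - inner ℝ η g - ‖η‖ ^ 2 / 2)) := by
    intro g
    simp only [hF]
    congr 2
    rw [smul_add, hτη, add_comm (τ • g) θ, inner_add_right, real_inner_self_eq_norm_sq]
    ring
  simp_rw [h3]
  have hi : Integrable (fun g => H (θ + τ • g) - inner ℝ η g - ‖η‖ ^ 2 / 2) (gauss d) :=
    (hint.sub hlin).sub (integrable_const _)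
  refine le_trans (le_of_eq ?_) (ofReal_exp_integral_le (gauss d) hi)
  have i1 : Integrable (fun g => H (θ + τ • g) - inner ℝ η g) (gauss d) := hint.sub hlin
  rw [integral_sub i1 (integrable_const _), integral_sub hint hlin, hlin0, hηn]
  simp
  congr 2
  field_simp

end CameronMartin

/-! ### Deviation inequality for one pair (λ, τ), uniform over directions -/

section PacBayes

variable {d : ℕ}

local notation "E" => EuclideanSpace ℝ (Fin d)

/-! ### Moments of a law with a finite fourth moment -/

section FourthMoment

variable {P : Measure (EuclideanSpace ℝ (Fin d))}

lemma integrable_norm_pow_four (hP : MemLp (fun x : E => x) 4 P) :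
    Integrable (fun x => ‖x‖ ^ 4) P := by
  have := hP.integrable_norm_rpow (by simp) (by simp)
  refine this.congr (Filter.Eventually.of_forall fun x => ?_)
  simp only [ENNReal.toReal_ofNat]
  norm_cast

lemma abs_inner_le (θ x : E) : |(inner ℝ θ x : ℝ)| ≤ ‖θ‖ * ‖x‖ := abs_real_inner_le_norm θ x

lemma inner_sq_le (θ x : E) : (inner ℝ θ x : ℝ) ^ 2 ≤ ‖θ‖ ^ 2 * ‖x‖ ^ 2 := by
  rw [← mul_pow, ← sq_abs]
  gcongr
  exact abs_inner_le θ x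

lemma integrable_norm_sq_mul_inner_sq (hP : MemLp (fun x : E => x) 4 P) (θ : E) :
    Integrable (fun x => ‖x‖ ^ 2 * (inner ℝ θ x : ℝ) ^ 2) P := by
  refine ((integrable_norm_pow_four hP).const_mul (‖θ‖ ^ 2)).mono' (by fun_prop)
    (Filter.Eventually.of_forall fun x => ?_)
  rw [Real.norm_of_nonneg (by positivity)]
  nlinarith [inner_sq_le θ x, sq_nonneg ‖x‖]

lemma integrable_inner_pow_four (hP : MemLp (fun x : E => x) 4 P) (θ : E) :
    Integrable (fun x => (inner ℝ θ x : ℝ) ^ 4) P := by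
  refine ((integrable_norm_pow_four hP).const_mul (‖θ‖ ^ 4)).mono' (by fun_prop)
    (Filter.Eventually.of_forall fun x => ?_)
  rw [Real.norm_of_nonneg (by positivity)]
  have := pow_le_pow_left₀ (by positivity) (inner_sq_le θ x) 2
  nlinarith

variable [IsProbabilityMeasure P]

lemma integrable_norm_sq (hP : MemLp (fun x : E => x) 4 P) : Integrable (fun x => ‖x‖ ^ 2) P := by
  refine ((integrable_const 1).add (integrable_norm_pow_four hP)).mono' (by fun_prop)
    (Filter.Eventually.of_forall fun x => ?_)
  rw [Real.norm_of_nonneg (by positivity)]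
  simp only [Pi.add_apply]
  nlinarith [sq_nonneg (‖x‖ ^ 2 - 1)]

lemma integrable_inner_sq (hP : MemLp (fun x : E => x) 4 P) (θ : E) :
    Integrable (fun x => (inner ℝ θ x : ℝ) ^ 2) P := by
  refine ((integrable_norm_sq hP).const_mul (‖θ‖ ^ 2)).mono' (by fun_prop)
    (Filter.Eventually.of_forall fun x => ?_)
  rw [Real.norm_of_nonneg (by positivity)]
  exact inner_sq_le θ x

/-! ### The PAC-Bayesian inequality -/

variable (P) in
/-- The expectation of the averaged perturbation, up to the additive constant `1`. -/
def meanPerturb (s lam τ : ℝ) (θ : EuclideanSpace ℝ (Fin d)) : ℝ :=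
  ∫ x, (s * ((inner ℝ θ x : ℝ) ^ 2 - lam) + ((inner ℝ θ x : ℝ) ^ 2 - lam) ^ 2 / 2
    + (2 + c) * (τ ^ 2 * ‖x‖ ^ 2 * (inner ℝ θ x : ℝ) ^ 2)
    + (2 + 3 * c) / 2 * (τ ^ 2 * ‖x‖ ^ 2) ^ 2) ∂P

lemma integrable_meanPerturb (hP : MemLp (fun x : E => x) 4 P) (s lam τ : ℝ) (θ : E) :
    Integrable (fun x => s * ((inner ℝ θ x : ℝ) ^ 2 - lam) + ((inner ℝ θ x : ℝ) ^ 2 - lam) ^ 2 / 2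
    + (2 + c) * (τ ^ 2 * ‖x‖ ^ 2 * (inner ℝ θ x : ℝ) ^ 2)
    + (2 + 3 * c) / 2 * (τ ^ 2 * ‖x‖ ^ 2) ^ 2) P := by
  have h := (((((integrable_inner_sq hP θ).const_mul (s - lam)).add
    ((integrable_inner_pow_four hP θ).const_mul (1 / 2))).add
    ((integrable_norm_sq_mul_inner_sq hP θ).const_mul ((2 + c) * τ ^ 2))).add
    ((integrable_norm_pow_four hP).const_mul ((2 + 3 * c) / 2 * τ ^ 4))).add
    (integrable_const (μ := P) (-s * lam + lam ^ 2 / 2))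
  refine h.congr (Filter.Eventually.of_forall fun x => ?_)
  simp only [Pi.add_apply]
  ring

lemma integral_meanPerturb (hP : MemLp (fun x : E => x) 4 P) (s lam τ : ℝ) (θ : E) :
    meanPerturb P s lam τ θ = s * (∫ x, (inner ℝ θ x : ℝ) ^ 2 ∂P - lam)
      + (∫ x, (inner ℝ θ x : ℝ) ^ 4 ∂P - 2 * lam * ∫ x, (inner ℝ θ x : ℝ) ^ 2 ∂P + lam ^ 2) / 2
      + (2 + c) * τ ^ 2 * ∫ x, ‖x‖ ^ 2 * (inner ℝ θ x : ℝ) ^ 2 ∂P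
      + (2 + 3 * c) / 2 * τ ^ 4 * ∫ x, ‖x‖ ^ 4 ∂P := by
  have i1 : Integrable (fun x => (s - lam) * (inner ℝ θ x : ℝ) ^ 2) P :=
    (integrable_inner_sq hP θ).const_mul _
  have i2 : Integrable (fun x => 1 / 2 * (inner ℝ θ x : ℝ) ^ 4) P :=
    (integrable_inner_pow_four hP θ).const_mul _
  have i3 : Integrable (fun x => (2 + c) * τ ^ 2 * (‖x‖ ^ 2 * (inner ℝ θ x : ℝ) ^ 2)) P :=
    (integrable_norm_sq_mul_inner_sq hP θ).const_mul _
  have i4 : Integrable (fun x : E => (2 + 3 * c) / 2 * τ ^ 4 * ‖x‖ ^ 4) P :=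
    (integrable_norm_pow_four hP).const_mul _
  have i5 := integrable_const (μ := P) (-s * lam + lam ^ 2 / 2)
  have h : meanPerturb P s lam τ θ = ∫ x, ((s - lam) * (inner ℝ θ x : ℝ) ^ 2
      + 1 / 2 * (inner ℝ θ x : ℝ) ^ 4 + (2 + c) * τ ^ 2 * (‖x‖ ^ 2 * (inner ℝ θ x : ℝ) ^ 2)
      + (2 + 3 * c) / 2 * τ ^ 4 * ‖x‖ ^ 4 + (-s * lam + lam ^ 2 / 2)) ∂P := by
    unfold meanPerturb
    congr 1
    ext x
    ring
  have i12 : Integrable (fun x => (s - lam) * (inner ℝ θ x : ℝ) ^ 2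
      + 1 / 2 * (inner ℝ θ x : ℝ) ^ 4) P := i1.add i2
  have i123 : Integrable (fun x => (s - lam) * (inner ℝ θ x : ℝ) ^ 2
      + 1 / 2 * (inner ℝ θ x : ℝ) ^ 4 + (2 + c) * τ ^ 2 * (‖x‖ ^ 2 * (inner ℝ θ x : ℝ) ^ 2)) P :=
    i12.add i3
  have i1234 : Integrable (fun x => (s - lam) * (inner ℝ θ x : ℝ) ^ 2
      + 1 / 2 * (inner ℝ θ x : ℝ) ^ 4 + (2 + c) * τ ^ 2 * (‖x‖ ^ 2 * (inner ℝ θ x : ℝ) ^ 2)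
      + (2 + 3 * c) / 2 * τ ^ 4 * ‖x‖ ^ 4) P := i123.add i4
  rw [h, integral_add i1234 i5, integral_add i123 i4, integral_add i12 i3, integral_add i1 i2]
  simp only [integral_const_mul, integral_const, probReal_univ, one_smul]
  ring

lemma measurable_perturb_inner (s lam τ : ℝ) :
    Measurable fun q : E × E => perturb s lam (τ ^ 2 * ‖q.2‖ ^ 2) (inner ℝ q.1 q.2 : ℝ) := by
  unfold perturb
  fun_prop

lemma integrable_perturb_inner (hP : MemLp (fun x : E => x) 4 P) (s lam τ : ℝ) (θ : E) :
    Integrable (fun x => perturb s lam (τ ^ 2 * ‖x‖ ^ 2) (inner ℝ θ x : ℝ)) P := by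
  have h := (((((integrable_inner_sq hP θ).const_mul (s - lam)).add
    ((integrable_inner_pow_four hP θ).const_mul (1 / 2))).add
    ((integrable_norm_sq_mul_inner_sq hP θ).const_mul ((c - 1) * τ ^ 2))).add
    ((integrable_norm_pow_four hP).const_mul ((1 + c) / 2 * τ ^ 4))).add
    (((integrable_norm_sq hP).const_mul ((lam - s) * τ ^ 2)).add
    (integrable_const (μ := P) (1 - s * lam + lam ^ 2 / 2)))
  refine h.congr (Filter.Eventually.of_forall fun x => ?_)
  simp only [Pi.add_apply, perturb]
  ring

variable (P) in
/-- The Laplace transform of the logarithm of the perturbation. -/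
def laplace (s lam τ : ℝ) (θ : EuclideanSpace ℝ (Fin d)) : ℝ :=
  ∫ x, perturb s lam (τ ^ 2 * ‖x‖ ^ 2) (inner ℝ θ x : ℝ) ∂P

lemma measurable_laplace (s lam τ : ℝ) : Measurable (laplace P s lam τ) := by
  have := (measurable_perturb_inner (d := d) s lam τ).stronglyMeasurable
  exact (this.integral_prod_right (ν := P)).measurable

lemma half_le_laplace (hP : MemLp (fun x : E => x) 4 P) {s : ℝ} (hs : s ^ 2 = 1) (lam τ : ℝ)
    (θ : E) : 1 / 2 ≤ laplace P s lam τ θ := by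
  have h : ∫ _, (1 / 2 : ℝ) ∂P = 1 / 2 := by simp
  rw [← h]
  exact integral_mono (integrable_const _) (integrable_perturb_inner hP s lam τ θ)
    fun x => half_le_perturb hs (by positivity) _

lemma integral_gauss_comp_inner (θ x : E) (τ : ℝ) {f : ℝ → ℝ} (hf : Measurable f) :
    ∫ g, f (inner ℝ (θ + τ • g) x) ∂(gauss d)
      = ∫ w, f (inner ℝ θ x + w) ∂(gaussianReal 0 (τ ^ 2 * ‖x‖ ^ 2).toNNReal) := by
  have hm : Measurable fun w => f (inner ℝ θ x + w) := hf.comp (by fun_prop)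
  rw [← map_inner_gauss, integral_map (by fun_prop) hm.aestronglyMeasurable]
  simp_rw [inner_add_left]

lemma integrable_gauss_comp_inner (θ x : E) (τ : ℝ) {f : ℝ → ℝ} (hf : Measurable f)
    (h : Integrable (fun w => f (inner ℝ θ x + w))
      (gaussianReal 0 (τ ^ 2 * ‖x‖ ^ 2).toNNReal)) :
    Integrable (fun g => f (inner ℝ (θ + τ • g) x)) (gauss d) := by
  have hm : Measurable fun w => f (inner ℝ θ x + w) := hf.comp (by fun_prop)
  rw [← map_inner_gauss, integrable_map_measure hm.aestronglyMeasurable (by fun_prop)] at h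
  refine h.congr (Filter.Eventually.of_forall fun g => ?_)
  simp [inner_add_left]

lemma integral_gauss_perturb (s lam τ : ℝ) (θ x : E) :
    ∫ g, perturb s lam (τ ^ 2 * ‖x‖ ^ 2) (inner ℝ (θ + τ • g) x) ∂(gauss d)
      = 1 + (s * ((inner ℝ θ x : ℝ) ^ 2 - lam) + ((inner ℝ θ x : ℝ) ^ 2 - lam) ^ 2 / 2
        + (2 + c) * (τ ^ 2 * ‖x‖ ^ 2 * (inner ℝ θ x : ℝ) ^ 2)
        + (2 + 3 * c) / 2 * (τ ^ 2 * ‖x‖ ^ 2) ^ 2) := by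
  rw [integral_gauss_comp_inner θ x τ (measurable_perturb s lam _)]
  have h := integral_perturb (τ ^ 2 * ‖x‖ ^ 2).toNNReal s lam (inner ℝ θ x)
  rw [Real.coe_toNNReal _ (by positivity)] at h
  rw [h]
  ring

lemma integrable_gauss_perturb (s lam τ : ℝ) (θ x : E) :
    Integrable (fun g => perturb s lam (τ ^ 2 * ‖x‖ ^ 2) (inner ℝ (θ + τ • g) x)) (gauss d) := by
  refine integrable_gauss_comp_inner θ x τ (measurable_perturb s lam _) ?_
  have h := integrable_perturb (τ ^ 2 * ‖x‖ ^ 2).toNNReal s lam (inner ℝ θ x)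
  rwa [Real.coe_toNNReal _ (by positivity)] at h

/-- Positivity of the perturbed polynomial lets the norm be dropped, so the inner Gaussian integral
is explicit, and the fourth moment makes it integrable under P. -/
lemma integrable_prod_perturb (hP : MemLp (fun x : E => x) 4 P) {s : ℝ} (hs : s ^ 2 = 1)
    (lam τ : ℝ) (θ : E) :
    Integrable (fun q : E × E => perturb s lam (τ ^ 2 * ‖q.1‖ ^ 2) (inner ℝ (θ + τ • q.2) q.1))
      (P.prod (gauss d)) := by
  rw [integrable_prod_iff]
  · refine ⟨Filter.Eventually.of_forall fun x => integrable_gauss_perturb s lam τ θ x, ?_⟩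
    have h : ∀ x : E, ∫ g, ‖perturb s lam (τ ^ 2 * ‖x‖ ^ 2) (inner ℝ (θ + τ • g) x)‖ ∂(gauss d)
        = 1 + (s * ((inner ℝ θ x : ℝ) ^ 2 - lam) + ((inner ℝ θ x : ℝ) ^ 2 - lam) ^ 2 / 2
        + (2 + c) * (τ ^ 2 * ‖x‖ ^ 2 * (inner ℝ θ x : ℝ) ^ 2)
        + (2 + 3 * c) / 2 * (τ ^ 2 * ‖x‖ ^ 2) ^ 2) := by
      intro x
      rw [← integral_gauss_perturb]
      congr 1
      ext g
      exact Real.norm_of_nonneg (perturb_pos hs (by positivity) _).le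
    simp_rw [h]
    exact (integrable_const 1).add (integrable_meanPerturb hP s lam τ θ)
  · apply Measurable.aestronglyMeasurable
    unfold perturb
    fun_prop

lemma integrable_laplace (hP : MemLp (fun x : E => x) 4 P) {s : ℝ} (hs : s ^ 2 = 1)
    (lam τ : ℝ) (θ : E) :
    Integrable (fun g => laplace P s lam τ (θ + τ • g)) (gauss d) :=
  (integrable_prod_perturb hP hs lam τ θ).integral_prod_right

lemma integral_laplace (hP : MemLp (fun x : E => x) 4 P) {s : ℝ} (hs : s ^ 2 = 1)
    (lam τ : ℝ) (θ : E) :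
    ∫ g, laplace P s lam τ (θ + τ • g) ∂(gauss d) = 1 + meanPerturb P s lam τ θ := by
  unfold laplace
  have := integral_integral_swap (μ := P) (ν := gauss d)
    (f := fun x g => perturb s lam (τ ^ 2 * ‖x‖ ^ 2) (inner ℝ (θ + τ • g) x))
    (integrable_prod_perturb hP hs lam τ θ)
  rw [← this]
  simp_rw [integral_gauss_perturb]
  rw [integral_add (integrable_const _) (integrable_meanPerturb hP s lam τ θ)]
  simp [meanPerturb]

variable (P) in
/-- The exponent of the exponential moment inequality. -/
def exponent {n : ℕ} (s lam τ : ℝ) (x : Fin n → EuclideanSpace ℝ (Fin d))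
    (θ : EuclideanSpace ℝ (Fin d)) : ℝ :=
  ∑ i, Real.log (perturb s lam (τ ^ 2 * ‖x i‖ ^ 2) (inner ℝ θ (x i)))
    - n * Real.log (laplace P s lam τ θ)

lemma measurable_exponent {n : ℕ} (s lam τ : ℝ) :
    Measurable fun q : (Fin n → E) × E => exponent P s lam τ q.1 q.2 := by
  have h1 : ∀ i : Fin n, Measurable fun q : (Fin n → E) × E =>
      perturb s lam (τ ^ 2 * ‖q.1 i‖ ^ 2) (inner ℝ q.2 (q.1 i) : ℝ) := by
    intro i
    unfold perturb
    fun_prop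
  have h2 : Measurable fun q : (Fin n → E) × E => laplace P s lam τ q.2 :=
    (measurable_laplace s lam τ).comp measurable_snd
  have h3 : Measurable fun q : (Fin n → E) × E =>
      ∑ i, Real.log (perturb s lam (τ ^ 2 * ‖q.1 i‖ ^ 2) (inner ℝ q.2 (q.1 i) : ℝ)) :=
    Finset.measurable_sum _ fun i _ => (h1 i).log
  exact h3.sub (h2.log.const_mul _)

lemma exp_exponent (hP : MemLp (fun x : E => x) 4 P) {s : ℝ} (hs : s ^ 2 = 1) {n : ℕ} (lam τ : ℝ)
    (x : Fin n → E) (θ : E) : Real.exp (exponent P s lam τ x θ)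
      = ∏ i, (perturb s lam (τ ^ 2 * ‖x i‖ ^ 2) (inner ℝ θ (x i)) / laplace P s lam τ θ) := by
  have hl : 0 < laplace P s lam τ θ := by linarith [half_le_laplace hP hs lam τ θ]
  unfold exponent
  rw [Real.exp_sub, Real.exp_sum, Finset.prod_div_distrib, Real.exp_nat_mul, Real.exp_log hl]
  simp only [Finset.prod_const, Finset.card_univ, Fintype.card_fin]
  congr 1
  exact Finset.prod_congr rfl fun i _ => Real.exp_log (perturb_pos hs (by positivity) _)

/-- Under the product law the exponential factorises over the sample, and dividing by `laplace`
gives each factor mean one. -/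
lemma lintegral_exp_exponent (hP : MemLp (fun x : E => x) 4 P) {s : ℝ} (hs : s ^ 2 = 1) {n : ℕ}
    (lam τ : ℝ) (θ : E) :
    ∫⁻ x : Fin n → E, ENNReal.ofReal (Real.exp (exponent P s lam τ x θ))
      ∂(Measure.pi fun _ => P) = 1 := by
  have hl : 0 < laplace P s lam τ θ := by linarith [half_le_laplace hP hs lam τ θ]
  simp_rw [exp_exponent hP hs lam τ]
  have hint : Integrable (fun x => perturb s lam (τ ^ 2 * ‖x‖ ^ 2) (inner ℝ θ x : ℝ)
      / laplace P s lam τ θ) P := (integrable_perturb_inner hP s lam τ θ).div_const _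
  rw [← ofReal_integral_eq_lintegral_ofReal]
  · rw [integral_fintype_prod_eq_prod (f := fun _ x => perturb s lam (τ ^ 2 * ‖x‖ ^ 2)
      (inner ℝ θ x : ℝ) / laplace P s lam τ θ)]
    rw [integral_div, ← laplace, div_self hl.ne']
    simp
  · exact Integrable.fintype_prod (f := fun _ x => perturb s lam (τ ^ 2 * ‖x‖ ^ 2)
      (inner ℝ θ x : ℝ) / laplace P s lam τ θ) fun _ => hint
  · refine Filter.Eventually.of_forall fun x => Finset.prod_nonneg fun i _ => ?_
    exact div_nonneg (perturb_pos hs (by positivity) _).le hl.le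

lemma measurable_exponent_right {n : ℕ} (s lam τ : ℝ) (x : Fin n → E) :
    Measurable (exponent P s lam τ x) := by
  have h1 : ∀ i : Fin n, Measurable fun θ : E =>
      perturb s lam (τ ^ 2 * ‖x i‖ ^ 2) (inner ℝ θ (x i) : ℝ) := by
    intro i
    unfold perturb
    fun_prop
  have h2 : Measurable fun θ : E =>
      ∑ i, Real.log (perturb s lam (τ ^ 2 * ‖x i‖ ^ 2) (inner ℝ θ (x i) : ℝ)) :=
    Finset.measurable_sum _ fun i _ => (h1 i).log
  exact h2.sub ((measurable_laplace s lam τ).log.const_mul _)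

lemma integrable_gauss_log_perturb {s : ℝ} (hs : s ^ 2 = 1) (lam τ : ℝ) (θ x : E) :
    Integrable (fun g => Real.log (perturb s lam (τ ^ 2 * ‖x‖ ^ 2)
      (inner ℝ (θ + τ • g) x))) (gauss d) := by
  refine integrable_gauss_comp_inner θ x τ
    (f := fun u => Real.log (perturb s lam (τ ^ 2 * ‖x‖ ^ 2) u))
    (measurable_perturb s lam _).log ?_
  have h := integrable_log_perturb (τ ^ 2 * ‖x‖ ^ 2).toNNReal hs lam (inner ℝ θ x)
  rwa [Real.coe_toNNReal _ (by positivity)] at h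

lemma log_laplace_le (hP : MemLp (fun x : E => x) 4 P) {s : ℝ} (hs : s ^ 2 = 1) (lam τ : ℝ)
    (θ : E) : Real.log (laplace P s lam τ θ) ≤ laplace P s lam τ θ - 1 :=
  Real.log_le_sub_one_of_pos (by linarith [half_le_laplace hP hs lam τ θ])

lemma integrable_log_laplace (hP : MemLp (fun x : E => x) 4 P) {s : ℝ} (hs : s ^ 2 = 1)
    (lam τ : ℝ) (θ : E) :
    Integrable (fun g => Real.log (laplace P s lam τ (θ + τ • g))) (gauss d) := by
  have hm : Measurable fun g => laplace P s lam τ (θ + τ • g) :=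
    (measurable_laplace s lam τ).comp (by fun_prop)
  refine ((integrable_laplace hP hs lam τ θ).add (integrable_const (Real.log 2))).mono'
    hm.log.aestronglyMeasurable (Filter.Eventually.of_forall fun g => ?_)
  have h1 := neg_log_two_le_log (half_le_laplace hP hs lam τ (θ + τ • g))
  have h2 := log_laplace_le hP hs lam τ (θ + τ • g)
  have h3 := half_le_laplace hP hs lam τ (θ + τ • g)
  have h4 := Real.log_pos (by norm_num : (1 : ℝ) < 2)
  rw [Real.norm_eq_abs, abs_le]
  simp only [Pi.add_apply]
  constructor <;> linarith

lemma integral_log_laplace_le (hP : MemLp (fun x : E => x) 4 P) {s : ℝ} (hs : s ^ 2 = 1)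
    (lam τ : ℝ) (θ : E) :
    ∫ g, Real.log (laplace P s lam τ (θ + τ • g)) ∂(gauss d) ≤ meanPerturb P s lam τ θ := by
  have h := integral_mono (integrable_log_laplace hP hs lam τ θ)
    ((integrable_laplace hP hs lam τ θ).sub (integrable_const 1))
    (fun g => log_laplace_le hP hs lam τ (θ + τ • g))
  have h' : ∫ g, (laplace P s lam τ (θ + τ • g) - 1) ∂(gauss d) = meanPerturb P s lam τ θ := by
    rw [integral_sub (integrable_laplace hP hs lam τ θ) (integrable_const 1),
      integral_laplace hP hs]
    simp
  exact h.trans h'.le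

lemma psi_le_integral_gauss {s : ℝ} (hs : s ^ 2 = 1) (lam τ : ℝ) (θ x : E) :
    psi (s * ((inner ℝ θ x : ℝ) ^ 2 - lam))
      ≤ ∫ g, Real.log (perturb s lam (τ ^ 2 * ‖x‖ ^ 2) (inner ℝ (θ + τ • g) x)) ∂(gauss d) := by
  rw [integral_gauss_comp_inner θ x τ
    (f := fun u => Real.log (perturb s lam (τ ^ 2 * ‖x‖ ^ 2) u))
    (measurable_perturb s lam _).log]
  have h := psi_le_integral_log_perturb (τ ^ 2 * ‖x‖ ^ 2).toNNReal hs lam (inner ℝ θ x)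
  rwa [Real.coe_toNNReal _ (by positivity)] at h

/-- On the event where the prior average of the exponential is below 1/ρ, the shift inequality
bounds the exponent averaged around any θ. Its empirical part dominates the sum of ψ, and log ℓ ≤ ℓ
− 1 controls the Laplace part. -/
lemma sum_psi_le (hP : MemLp (fun x : E => x) 4 P) {s : ℝ} (hs : s ^ 2 = 1) {n : ℕ}
    (lam : ℝ) {τ ρ : ℝ} (hτ : 0 < τ) (hρ : 0 < ρ) {x : Fin n → E}
    (hx : ∫⁻ g, ENNReal.ofReal (Real.exp (exponent P s lam τ x (τ • g))) ∂(gauss d)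
      < ENNReal.ofReal (1 / ρ)) (θ : E) :
    ∑ i, psi (s * ((inner ℝ θ (x i) : ℝ) ^ 2 - lam))
      ≤ n * meanPerturb P s lam τ θ + ‖θ‖ ^ 2 / (2 * τ ^ 2) + Real.log (1 / ρ) := by
  have iV := integrable_log_laplace hP hs lam τ θ
  have iW := fun i => integrable_gauss_log_perturb hs lam τ θ (x i)
  have iS : Integrable (fun g => ∑ i, Real.log (perturb s lam (τ ^ 2 * ‖x i‖ ^ 2)
      (inner ℝ (θ + τ • g) (x i)))) (gauss d) := integrable_finsetSum _ fun i _ => iW i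
  have hint : Integrable (fun g => exponent P s lam τ x (θ + τ • g)) (gauss d) :=
    iS.sub (iV.const_mul _)
  have h1 := (exp_integral_shift_le (measurable_exponent_right (P := P) s lam τ x) hτ θ
    hint).trans_lt hx
  rw [ENNReal.ofReal_lt_ofReal_iff (by positivity),
    ← Real.lt_log_iff_exp_lt (by positivity)] at h1
  have h2 : ∫ g, exponent P s lam τ x (θ + τ • g) ∂(gauss d)
      = ∑ i, ∫ g, Real.log (perturb s lam (τ ^ 2 * ‖x i‖ ^ 2)
          (inner ℝ (θ + τ • g) (x i))) ∂(gauss d)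
        - n * ∫ g, Real.log (laplace P s lam τ (θ + τ • g)) ∂(gauss d) := by
    unfold exponent
    rw [integral_sub iS (iV.const_mul _), integral_finsetSum _ fun i _ => iW i,
      integral_const_mul]
  have h3 := Finset.sum_le_sum fun i (_ : i ∈ Finset.univ) =>
    psi_le_integral_gauss hs lam τ θ (x i)
  have h4 := integral_log_laplace_le hP hs lam τ θ
  have h5 : (n : ℝ) * ∫ g, Real.log (laplace P s lam τ (θ + τ • g)) ∂(gauss d)
      ≤ n * meanPerturb P s lam τ θ := by gcongr
  linarith

/-- The PAC-Bayesian deviation inequality, uniformly over all directions. -/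
lemma exists_pacBayes_event (hP : MemLp (fun x : E => x) 4 P) {s : ℝ} (hs : s ^ 2 = 1) (n : ℕ)
    (lam : ℝ) {τ ρ : ℝ} (hτ : 0 < τ) (hρ : 0 < ρ) :
    ∃ D : Set (Fin n → E), MeasurableSet D ∧ (Measure.pi fun _ => P) Dᶜ ≤ ENNReal.ofReal ρ ∧
      ∀ x ∈ D, ∀ θ : E, ∑ i, psi (s * ((inner ℝ θ (x i) : ℝ) ^ 2 - lam))
        ≤ n * meanPerturb P s lam τ θ + ‖θ‖ ^ 2 / (2 * τ ^ 2) + Real.log (1 / ρ) := by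
  set Z : (Fin n → E) → ENNReal := fun x =>
    ∫⁻ g, ENNReal.ofReal (Real.exp (exponent P s lam τ x (τ • g))) ∂(gauss d) with hZ
  have hm : Measurable fun q : (Fin n → E) × E =>
      ENNReal.ofReal (Real.exp (exponent P s lam τ q.1 (τ • q.2))) := by
    have h1 : Measurable fun q : (Fin n → E) × E => (q.1, τ • q.2) := by fun_prop
    have := (measurable_exponent (P := P) (n := n) s lam τ).comp h1
    exact (Real.measurable_exp.comp this).ennreal_ofReal
  have hZm : Measurable Z := hm.lintegral_prod_right'
  -- Tonelli: the prior is fixed before the sample is drawn. The event therefore does not depend on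
  -- θ, and Markov's inequality is applied only once.
  have hZ1 : ∫⁻ x, Z x ∂(Measure.pi fun _ => P) = 1 := by
    simp only [hZ]
    rw [lintegral_lintegral_swap hm.aemeasurable]
    simp_rw [lintegral_exp_exponent hP hs lam τ]
    simp
  refine ⟨{x | Z x < ENNReal.ofReal (1 / ρ)}, measurableSet_lt hZm measurable_const, ?_, ?_⟩
  · have h := mul_meas_ge_le_lintegral (μ := Measure.pi fun _ : Fin n => P) hZm
      (ENNReal.ofReal (1 / ρ))
    rw [hZ1] at h
    have e : {x | Z x < ENNReal.ofReal (1 / ρ)}ᶜ = {x | ENNReal.ofReal (1 / ρ) ≤ Z x} := by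
      ext x; simp
    rw [e]
    have h0 : ENNReal.ofReal ρ * ENNReal.ofReal (1 / ρ) = 1 := by
      rw [← ENNReal.ofReal_mul hρ.le, mul_one_div_cancel hρ.ne', ENNReal.ofReal_one]
    have h2 := mul_le_mul_right h (ENNReal.ofReal ρ)
    rwa [← mul_assoc, h0, one_mul, mul_one] at h2
  · exact fun x hx θ => sum_psi_le hP hs lam hτ hρ hx θ

end FourthMoment

end PacBayes

/-! ### Positivity of the parameters -/

namespace Params

variable {p : Params}

lemma Admissible.s_pos (hp : p.Admissible) : 0 < p.s := hp.sigma_pos.trans_le hp.sigma_le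

lemma Admissible.kappa_pos (hp : p.Admissible) : 0 < p.κ := by linarith [hp.kappa_ge]

lemma zeta_pos (hκ : 0 < p.κ) (hs : 0 < p.s) {t : ℝ} (ht : 0 < t) : 0 < p.zeta t := by
  have hc := c_pos
  have hk : 0 < Real.sqrt p.κ := Real.sqrt_pos.2 hκ
  have h2 : 0 < Real.sqrt (2 * (2 + c) * Real.sqrt p.κ * p.s / t) := Real.sqrt_pos.2 (by positivity)
  unfold zeta
  positivity

lemma Admissible.n_pos (hp : p.Admissible) : 0 < (p.n : ℝ) := by
  have h := zeta_pos hp.kappa_pos hp.s_pos hp.sigma_pos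
  have : 0 < Real.sqrt p.n := by linarith [hp.zeta_le]
  exact Real.sqrt_pos.1 this

lemma K_pos : 0 < p.K := by unfold K; omega

lemma level_pos (hs : 0 < p.s) (j : ℕ) : 0 < p.level j := by unfold level; positivity

lemma Admissible.beta_pos (hp : p.Admissible) (j : ℕ) : 0 < p.beta j := by
  have hc := c_pos
  have h1 := hp.s_pos
  have h2 := hp.n_pos
  have h3 := Real.sqrt_pos.2 hp.kappa_pos
  have h4 := level_pos h1 j
  unfold beta
  exact Real.sqrt_pos.2 (by positivity)

end Params

/-! ### Energy and mixed fourth moments of the law -/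

section Population

variable {d : ℕ}

local notation "E" => EuclideanSpace ℝ (Fin d)

variable {P : Measure (EuclideanSpace ℝ (Fin d))}

variable (P) in
/-- The energy `N(θ) = 𝔼 ⟨θ, X⟩²`. -/
def energy (θ : EuclideanSpace ℝ (Fin d)) : ℝ := ∫ x, (inner ℝ θ x : ℝ) ^ 2 ∂P

lemma energy_nonneg (θ : E) : 0 ≤ energy P θ := integral_nonneg fun _ => sq_nonneg _

lemma energy_smul (α : ℝ) (θ : E) : energy P (α • θ) = α ^ 2 * energy P θ := by
  unfold energy
  rw [← integral_const_mul]
  congr 1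
  ext x
  rw [real_inner_smul_left, mul_pow]

lemma integral_norm_pow_four : ∫ x : E, ‖x‖ ^ 4 ∂P = s4sq P ^ 2 := by
  rw [s4sq, Real.sq_sqrt (integral_nonneg fun x => by positivity)]

variable [IsProbabilityMeasure P]

/-- In directions of zero energy both sides vanish. Otherwise the ratio is below the supremum; a
positive `kurtosis` ensures that the set is bounded, since the real `sSup` of an unbounded set is 0.
-/
lemma fourth_moment_le (hP : MemLp (fun x : E => x) 4 P) (hκ : 0 < kurtosis P) (θ : E) :
    ∫ x, (inner ℝ θ x : ℝ) ^ 4 ∂P ≤ kurtosis P * energy P θ ^ 2 := by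
  rcases (energy_nonneg (P := P) θ).eq_or_lt with h0 | h0
  · have h1 : (fun x : E => (inner ℝ θ x : ℝ) ^ 2) =ᵐ[P] 0 := by
      exact (integral_eq_zero_iff_of_nonneg (fun x => sq_nonneg _)
        (integrable_inner_sq hP θ)).1 h0.symm
    have h2 : ∫ x, (inner ℝ θ x : ℝ) ^ 4 ∂P = 0 := by
      rw [integral_eq_zero_of_ae]
      filter_upwards [h1] with x hx
      have : (inner ℝ θ x : ℝ) = 0 := by simpa using hx
      simp [this]
    rw [h2, ← h0]
    simp
  · have hb : BddAbove {k : ℝ | ∃ θ : E, 0 < ∫ x, (inner ℝ θ x) ^ 2 ∂P ∧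
        k = (∫ x, (inner ℝ θ x) ^ 4 ∂P) / (∫ x, (inner ℝ θ x) ^ 2 ∂P) ^ 2} := by
      by_contra hb
      rw [kurtosis, Real.sSup_of_not_bddAbove hb] at hκ
      exact lt_irrefl _ hκ
    have h1 : (∫ x, (inner ℝ θ x) ^ 4 ∂P) / energy P θ ^ 2 ≤ kurtosis P :=
      le_csSup hb ⟨θ, h0, rfl⟩
    rwa [div_le_iff₀ (by positivity)] at h1



lemma sq_integral_mul_le {α : Type*} [MeasurableSpace α] {μ : Measure α} {f g : α → ℝ}
    (hf : Integrable (fun a => f a ^ 2) μ) (hg : Integrable (fun a => g a ^ 2) μ)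
    (hfg : Integrable (fun a => f a * g a) μ) :
    (∫ a, f a * g a ∂μ) ^ 2 ≤ (∫ a, f a ^ 2 ∂μ) * ∫ a, g a ^ 2 ∂μ := by
  have h : ∀ t : ℝ, 0 ≤ (∫ a, f a ^ 2 ∂μ) * (t * t) + (-2 * ∫ a, f a * g a ∂μ) * t
      + ∫ a, g a ^ 2 ∂μ := by
    intro t
    have h0 : 0 ≤ ∫ a, (t * f a - g a) ^ 2 ∂μ := integral_nonneg fun a => sq_nonneg _
    have e : ∀ a, (t * f a - g a) ^ 2 = t ^ 2 * f a ^ 2 - 2 * t * (f a * g a) + g a ^ 2 := by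
      intro a; ring
    simp_rw [e] at h0
    have i1 : Integrable (fun a => t ^ 2 * f a ^ 2 - 2 * t * (f a * g a)) μ :=
      (hf.const_mul _).sub (hfg.const_mul _)
    rw [integral_add i1 hg, integral_sub (hf.const_mul _) (hfg.const_mul _), integral_const_mul,
      integral_const_mul] at h0
    linarith
  have := discrim_le_zero h
  unfold discrim at this
  linarith

lemma integral_norm_sq_mul_inner_sq_le (hP : MemLp (fun x : E => x) 4 P) (hκ : 0 < kurtosis P)
    (θ : E) : ∫ x, ‖x‖ ^ 2 * (inner ℝ θ x : ℝ) ^ 2 ∂P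
      ≤ Real.sqrt (kurtosis P) * s4sq P * energy P θ := by
  have e1 : ∀ x : E, (‖x‖ ^ 2) ^ 2 = ‖x‖ ^ 4 := fun x => by ring
  have e2 : ∀ x : E, ((inner ℝ θ x : ℝ) ^ 2) ^ 2 = (inner ℝ θ x : ℝ) ^ 4 := fun x => by ring
  have h := sq_integral_mul_le (μ := P) (f := fun x : E => ‖x‖ ^ 2)
    (g := fun x => (inner ℝ θ x : ℝ) ^ 2)
    (by simpa only [e1] using integrable_norm_pow_four hP)
    (by simpa only [e2] using integrable_inner_pow_four hP θ)
    (integrable_norm_sq_mul_inner_sq hP θ)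
  simp only [e1, e2] at h
  have hs : 0 ≤ s4sq P := Real.sqrt_nonneg _
  have hN := energy_nonneg (P := P) θ
  refine abs_le_of_sq_le_sq' (h.trans ?_) (by positivity) |>.2
  rw [integral_norm_pow_four, mul_pow, mul_pow, Real.sq_sqrt hκ.le]
  have := fourth_moment_le hP hκ θ
  nlinarith [sq_nonneg (s4sq P)]

lemma integral_norm_sq_le (hP : MemLp (fun x : E => x) 4 P) : ∫ x : E, ‖x‖ ^ 2 ∂P ≤ s4sq P := by
  have e1 : ∀ x : E, (‖x‖ ^ 2) ^ 2 = ‖x‖ ^ 4 := fun x => by ring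
  have h := sq_integral_mul_le (μ := P) (f := fun x : E => ‖x‖ ^ 2) (g := fun _ => 1)
    (by simpa only [e1] using integrable_norm_pow_four hP) (integrable_const _)
    (by simpa using integrable_norm_sq hP)
  simp only [e1, mul_one, one_pow] at h
  rw [integral_norm_pow_four] at h
  simp only [integral_const, probReal_univ, one_smul, mul_one] at h
  exact (abs_le_of_sq_le_sq' h (Real.sqrt_nonneg _)).2

lemma energy_le (hP : MemLp (fun x : E => x) 4 P) {θ : E} (hθ : ‖θ‖ = 1) :
    energy P θ ≤ s4sq P := by
  refine le_trans ?_ (integral_norm_sq_le hP)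
  refine integral_mono (integrable_inner_sq hP θ) (integrable_norm_sq hP) fun x => ?_
  have := inner_sq_le θ x
  rwa [hθ, one_pow, one_mul] at this

/-! ### The confidence region contains the energy -/

/-- The perturbation has variance τ² = 1/β, so the entropy cost ‖θ‖²/(2τ²) is β‖θ‖²/2. The fourth
moment is bounded through κ, and the mixed moment by Cauchy–Schwarz. -/
lemma meanPerturb_le_slack (hP : MemLp (fun x : E => x) 4 P) {p : Params} (hp : p.Admissible)
    (hκ : kurtosis P = p.κ) (hs : s4sq P = p.s) (s : ℝ) (j : ℕ) (θ : E) :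
    meanPerturb P s (p.lam j) (Real.sqrt (p.beta j))⁻¹ θ
        + (p.beta j * ‖θ‖ ^ 2 / 2 + Real.log (p.K / p.ε)) / p.n
      ≤ s * (energy P θ - p.lam j) + p.slack j (energy P θ) (‖θ‖ ^ 2) := by
  have hc := c_pos
  have hκ0 : 0 < kurtosis P := hκ ▸ hp.kappa_pos
  have hb := hp.beta_pos j
  have hn := hp.n_pos
  have e1 : (Real.sqrt (p.beta j))⁻¹ ^ 2 = (p.beta j)⁻¹ := by rw [inv_pow, Real.sq_sqrt hb.le]
  have e2 : (Real.sqrt (p.beta j))⁻¹ ^ 4 = (p.beta j ^ 2)⁻¹ := by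
    rw [show 4 = 2 * 2 from rfl, pow_mul, e1, inv_pow]
  have h4 := fourth_moment_le hP hκ0 θ
  have h22 := integral_norm_sq_mul_inner_sq_le hP hκ0 θ
  rw [hκ] at h4
  rw [hκ, hs] at h22
  rw [integral_meanPerturb hP, integral_norm_pow_four, hs, e1, e2]
  change s * (energy P θ - _) + (_ - 2 * p.lam j * energy P θ + p.lam j ^ 2) / 2 + _ + _ + _ ≤ _
  have h5 : (2 + c) * (p.beta j)⁻¹ * ∫ x, ‖x‖ ^ 2 * (inner ℝ θ x : ℝ) ^ 2 ∂P
      ≤ (2 + c) * (p.beta j)⁻¹ * (Real.sqrt p.κ * p.s * energy P θ) := by gcongr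
  have h6 : (2 + c) * (p.beta j)⁻¹ * (Real.sqrt p.κ * p.s * energy P θ)
      = (2 + c) * Real.sqrt p.κ * p.s * energy P θ / p.beta j := by field_simp
  have h7 : (2 + 3 * c) / 2 * (p.beta j ^ 2)⁻¹ * p.s ^ 2
      = (2 + 3 * c) * p.s ^ 2 / (2 * p.beta j ^ 2) := by field_simp
  have h8 : (p.beta j * ‖θ‖ ^ 2 / 2 + Real.log (p.K / p.ε)) / p.n
      = p.beta j * ‖θ‖ ^ 2 / (2 * p.n) + Real.log (p.K / p.ε) / p.n := by field_simp
  unfold Params.slack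
  linarith

lemma mul_risk {p : Params} (s lam : ℝ) (hs : s = 1 ∨ s = -1)
    (x : Fin p.n → E) (θ : E) :
    s * risk x lam θ = (∑ i, psi (s * ((inner ℝ θ (x i) : ℝ) ^ 2 - lam))) / p.n := by
  unfold risk
  rcases hs with rfl | rfl
  · simp [div_eq_inv_mul]
  · simp_rw [neg_one_mul, psi_neg]
    rw [Finset.sum_neg_distrib, div_eq_inv_mul, mul_neg]

/-- With probability at least `1 - 2 ε` the energy belongs to the confidence region in every
direction. -/
lemma exists_event_energy_mem_region (hP : MemLp (fun x : E => x) 4 P) {p : Params}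
    (hp : p.Admissible) (hκ : kurtosis P = p.κ) (hs : s4sq P = p.s) (hε : 0 < p.ε) :
    ∃ D : Set (Fin p.n → E), MeasurableSet D ∧
      (Measure.pi fun _ => P) Dᶜ ≤ ENNReal.ofReal (2 * p.ε) ∧
      ∀ x ∈ D, ∀ θ : E, energy P θ ∈ p.region x θ := by
  have hn := hp.n_pos
  have hK : 0 < (p.K : ℝ) := by exact_mod_cast Params.K_pos
  have hρ : 0 < p.ε / p.K := by positivity
  have hτ : ∀ j, 0 < (Real.sqrt (p.beta j))⁻¹ := fun j =>
    inv_pos.2 (Real.sqrt_pos.2 (hp.beta_pos j))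
  have key : ∀ (j : ℕ) (s : ℝ), s ^ 2 = 1 → _ := fun j s hs' =>
    exists_pacBayes_event hP hs' p.n (p.lam j) (hτ j) hρ
  choose D hDm hDμ hD using key
  have h1 : (1 : ℝ) ^ 2 = 1 := one_pow 2
  have h2 : (-1 : ℝ) ^ 2 = 1 := by norm_num
  -- Each of the K levels is used with both signs, at confidence ε/K: the total failure probability
  -- is at most 2ε. Uniformity over θ covers all scalings α at no extra cost.
  refine ⟨⋂ j ∈ Finset.range p.K, D j 1 h1 ∩ D j (-1) h2, ?_, ?_, ?_⟩
  · exact Finset.measurableSet_biInter _ fun j _ => (hDm j 1 h1).inter (hDm j (-1) h2)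
  · rw [Set.compl_iInter₂]
    refine (measure_biUnion_finset_le _ _).trans ?_
    have : ∀ j ∈ Finset.range p.K, (Measure.pi fun _ : Fin p.n => P) (D j 1 h1 ∩ D j (-1) h2)ᶜ
        ≤ ENNReal.ofReal (2 * (p.ε / p.K)) := by
      intro j _
      rw [Set.compl_inter, two_mul, ENNReal.ofReal_add hρ.le hρ.le]
      exact (measure_union_le _ _).trans (add_le_add (hDμ j 1 h1) (hDμ j (-1) h2))
    refine (Finset.sum_le_sum this).trans (le_of_eq ?_)
    rw [Finset.sum_const, Finset.card_range, nsmul_eq_mul, ← ENNReal.ofReal_natCast,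
      ← ENNReal.ofReal_mul (by positivity)]
    congr 1
    field_simp
  · intro x hx θ
    refine ⟨energy_nonneg θ, fun j hj α _ => ?_⟩
    have hxj := Set.mem_iInter₂.1 hx j (Finset.mem_range.2 hj)
    have main : ∀ s : ℝ, (s = 1 ∨ s = -1) → (∀ θ : E,
        ∑ i, psi (s * ((inner ℝ θ (x i) : ℝ) ^ 2 - p.lam j))
          ≤ p.n * meanPerturb P s (p.lam j) (Real.sqrt (p.beta j))⁻¹ θ
            + ‖θ‖ ^ 2 / (2 * (Real.sqrt (p.beta j))⁻¹ ^ 2) + Real.log (1 / (p.ε / p.K))) →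
        s * (risk x (p.lam j) (α • θ) - (α ^ 2 * energy P θ - p.lam j))
          ≤ p.slack j (α ^ 2 * energy P θ) (α ^ 2 * ‖θ‖ ^ 2) := by
      intro s hs' h
      have h3 := h (α • θ)
      have h4 := meanPerturb_le_slack hP hp hκ hs s j (α • θ)
      have e1 : (Real.sqrt (p.beta j))⁻¹ ^ 2 = (p.beta j)⁻¹ := by
        rw [inv_pow, Real.sq_sqrt (hp.beta_pos j).le]
      have e2 : ‖α • θ‖ ^ 2 = α ^ 2 * ‖θ‖ ^ 2 := by
        rw [norm_smul, mul_pow, Real.norm_eq_abs, sq_abs]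
      rw [energy_smul, e2] at h4
      rw [e1, e2, one_div_div] at h3
      have h5 := mul_risk s (p.lam j) hs' x (α • θ)
      have h6 : s * risk x (p.lam j) (α • θ)
          ≤ meanPerturb P s (p.lam j) (Real.sqrt (p.beta j))⁻¹ (α • θ)
            + (p.beta j * (α ^ 2 * ‖θ‖ ^ 2) / 2 + Real.log (p.K / p.ε)) / p.n := by
        rw [h5, div_le_iff₀ hn]
        refine h3.trans (le_of_eq ?_)
        have := (hp.beta_pos j).ne'
        field_simp
        ring
      linarith
    rw [abs_le]
    constructor
    · have := main (-1) (Or.inr rfl) (hD j (-1) h2 x hxj.2)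
      linarith
    · have := main 1 (Or.inl rfl) (hD j 1 h1 x hxj.1)
      linarith

end Population

/-! ### The width of the confidence region -/

/-- The normalised deviation `½ λ (κ ρ² - 2 ρ + κ) + ρ D`. -/
def normSlack (κ lam D ρ : ℝ) : ℝ := lam * (κ * ρ ^ 2 - 2 * ρ + κ) / 2 + ρ * D

section Width

variable {κ lam D₁ D₂ X r₁ r₂ : ℝ}

/-- The inequality at μ = 1 contains κλρ²/2 with ρ = r₂ − 1, which is useless for large ρ. The
choice μ = 1/r₂ first confines ρ, and μ = 1 then gives the sharp bound. The condition κ ≥ 3/2 enters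
through κ ≤ 3(κ − 1). -/
lemma width_above (hκ : 3 / 2 ≤ κ) (hlam : 0 ≤ lam) (hD₁ : 0 ≤ D₁) (hD₂ : 0 ≤ D₂)
    (hX : (κ - 1) * lam + D₁ + D₂ ≤ X) (hX8 : X ≤ 1 / 8) (h0 : 0 ≤ r₁) (h1 : r₁ ≤ 1)
    (h2 : 1 < r₂)
    (h : ∀ μ : ℝ, 0 ≤ μ → μ * (r₂ - r₁)
      ≤ normSlack κ lam D₁ (μ * r₂) + normSlack κ lam D₁ (μ * r₁) + 2 * μ * D₂) :
    r₂ - 1 ≤ 2 * (X / (1 - 4 * X)) := by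
  have hκl : κ * lam ≤ 3 * ((κ - 1) * lam) := by nlinarith
  have hlam1 : lam ≤ 1 := by nlinarith
  have h' : ∀ μ : ℝ, 0 ≤ μ → μ * (r₂ - 1)
      ≤ normSlack κ lam D₁ (μ * r₂) + normSlack κ lam D₁ μ + 2 * μ * D₂ := by
    intro μ hμ
    have h3 := h μ hμ
    -- Because λ ≤ 1, replacing r₁ by 1 weakens the hypothesis, so the lower point may be taken at
    -- 1.
    have h4 : normSlack κ lam D₁ (μ * r₁) - normSlack κ lam D₁ μ ≤ μ * (1 - r₁) := by
      have e : normSlack κ lam D₁ μ - normSlack κ lam D₁ (μ * r₁) + μ * (1 - r₁)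
          = κ * lam * μ ^ 2 * (1 - r₁) * (1 + r₁) / 2 + μ * (1 - r₁) * (1 - lam)
            + μ * (1 - r₁) * D₁ := by
        unfold normSlack; ring
      have h5 : 0 ≤ 1 - r₁ := by linarith
      have h6 : 0 ≤ 1 - lam := by linarith
      have h7 : 0 ≤ κ := by linarith
      have : 0 ≤ κ * lam * μ ^ 2 * (1 - r₁) * (1 + r₁) / 2 + μ * (1 - r₁) * (1 - lam)
            + μ * (1 - r₁) * D₁ := by positivity
      linarith
    linarith
  have hr2 : 0 < r₂ := by linarith
  have hsmall : r₂ - 1 ≤ 5 / 11 := by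
    have h3 := h' (1 / r₂) (by positivity)
    set r := 1 / r₂ with hr
    have hr0 : 0 < r := by positivity
    have hr1 : r ≤ 1 := by rw [hr, div_le_one hr2]; exact h2.le
    have hrr : r * r₂ = 1 := by rw [hr]; field_simp
    rw [hrr, mul_sub, hrr] at h3
    have h4 : lam * (κ * r ^ 2 - 2 * r + κ) ≤ lam * (3 * (κ - 1)) := by
      refine mul_le_mul_of_nonneg_left ?_ hlam
      nlinarith [mul_nonneg hr0.le (sub_nonneg.2 hr1)]
    have h5 : r * D₁ ≤ D₁ := mul_le_of_le_one_left hD₁ hr1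
    have h6 : r * D₂ ≤ D₂ := mul_le_of_le_one_left hD₂ hr1
    unfold normSlack at h3
    -- The right side is at most (5/2)X ≤ 5/16, so 1/r₂ ≥ 11/16, that is, r₂ − 1 ≤ 5/11.
    have h7 : 11 / 16 ≤ r := by nlinarith
    nlinarith
  have h3 := h' 1 zero_le_one
  have h8 : 0 < 1 - 4 * X := by linarith
  rw [mul_div_assoc', le_div_iff₀ h8]
  set ρ := r₂ - 1 with hρ
  have e : r₂ = 1 + ρ := by rw [hρ]; ring
  rw [e] at h3
  have hρ0 : 0 < ρ := by linarith
  unfold normSlack at h3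
  have e2 : lam * (κ * (1 * (1 + ρ)) ^ 2 - 2 * (1 * (1 + ρ)) + κ) / 2 + 1 * (1 + ρ) * D₁
      + (lam * (κ * 1 ^ 2 - 2 * 1 + κ) / 2 + 1 * D₁) + 2 * 1 * D₂
      = 2 * ((κ - 1) * lam + D₁ + D₂) + ρ * ((κ - 1) * lam + D₁) + κ * lam * ρ ^ 2 / 2 := by ring
  rw [e2] at h3
  have h9 : ρ * ((κ - 1) * lam + D₁) ≤ ρ * X := by gcongr; linarith
  have h10 : (κ - 1) * lam ≤ X := by linarith
  have hX0 : 0 ≤ X := le_trans (by nlinarith) h10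
  have h11 : κ * lam * ρ ^ 2 / 2 ≤ 3 * X * (5 / 11 * ρ) / 2 := by
    have : ρ ^ 2 ≤ 5 / 11 * ρ := by nlinarith
    have h12 : κ * lam ≤ 3 * X := by linarith
    gcongr
  nlinarith [mul_nonneg hX0 hρ0.le]

/-- Here the deviation 1 − r₁ is automatically at most 1, so the quadratic term is harmless and the
single scale μ = 1 suffices. -/
lemma width_below (hκ : 3 / 2 ≤ κ) (hlam : 0 ≤ lam) (hD₁ : 0 ≤ D₁) (hD₂ : 0 ≤ D₂)
    (hX : (κ - 1) * lam + D₁ + D₂ ≤ X) (hX8 : X ≤ 1 / 8) (h0 : 0 ≤ r₁) (h1 : r₁ ≤ 1)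
    (h : 1 - r₁ ≤ normSlack κ lam D₁ 1 + normSlack κ lam D₁ r₁ + 2 * D₂) :
    1 - r₁ ≤ 2 * (X / (1 - 4 * X)) := by
  have hκl : κ * lam ≤ 3 * ((κ - 1) * lam) := by nlinarith
  have hlam0 : 0 ≤ (κ - 1) * lam := mul_nonneg (by linarith) hlam
  have h8 : 0 < 1 - 4 * X := by linarith
  rw [mul_div_assoc', le_div_iff₀ h8]
  set ρ := 1 - r₁ with hρ
  have e : r₁ = 1 - ρ := by rw [hρ]; ring
  rw [e] at h
  have hρ0 : 0 ≤ ρ := by linarith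
  have hρ1 : ρ ≤ 1 := by linarith
  unfold normSlack at h
  have e2 : lam * (κ * 1 ^ 2 - 2 * 1 + κ) / 2 + 1 * D₁
      + (lam * (κ * (1 - ρ) ^ 2 - 2 * (1 - ρ) + κ) / 2 + (1 - ρ) * D₁) + 2 * D₂
      = 2 * ((κ - 1) * lam + D₁ + D₂) - ρ * ((κ - 1) * lam + D₁) + κ * lam * ρ ^ 2 / 2 := by ring
  rw [e2] at h
  have h10 : (κ - 1) * lam ≤ X := by linarith
  have hX0 : 0 ≤ X := hlam0.trans h10
  have h9 : 0 ≤ ρ * ((κ - 1) * lam + D₁) := by positivity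
  have h11 : κ * lam * ρ ^ 2 / 2 ≤ 3 * X * ρ / 2 := by
    have : ρ ^ 2 ≤ ρ := by nlinarith
    have h12 : κ * lam ≤ 3 * X := by linarith
    gcongr
  nlinarith [mul_nonneg hX0 hρ0]

end Width

/-! ### Choice of a grid level and rescaling of the region -/

namespace Params

variable {p : Params}

lemma zeta_div_le (hp : p.Admissible) {u : ℝ} (hu : p.σ ≤ u) :
    p.zeta u / Real.sqrt p.n ≤ 1 / 8 := by
  have hn := Real.sqrt_pos.2 hp.n_pos
  have h := p.zeta_anti hp.s_pos.le (by linarith [hp.kappa_ge]) hp.sigma_pos hu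
  rw [div_le_iff₀ hn]
  linarith [hp.zeta_le]

lemma log_K_div_pos (hε : 0 < p.ε) (hε1 : p.ε < 1) : 0 < Real.log (p.K / p.ε) := by
  apply Real.log_pos
  rw [lt_div_iff₀ hε]
  have : (1 : ℝ) ≤ p.K := by exact_mod_cast K_pos
  linarith

/-- Every admissible energy is below some level of the grid, up to a factor `e^a`. -/
lemma exists_level (hp : p.Admissible) (ha : 0 < p.a) {u : ℝ} (hu : p.σ ≤ u) (hus : u ≤ p.s) :
    ∃ j < p.K, u ≤ p.level j ∧ p.level j ≤ u * Real.exp p.a := by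
  have hc := c_pos
  have hs := hp.s_pos
  have hn := hp.n_pos
  have hk := Real.sqrt_pos.2 hp.kappa_pos
  have hσ := hp.sigma_pos
  have hu0 : 0 < u := hσ.trans_le hu
  have hsu : 1 ≤ p.s / u := by rwa [one_le_div hu0]
  have hlog : 0 ≤ Real.log (p.s / u) := Real.log_nonneg hsu
  have hj1 := Nat.floor_le (div_nonneg hlog ha.le)
  have hj2 := Nat.lt_floor_add_one (Real.log (p.s / u) / p.a)
  refine ⟨⌊Real.log (p.s / u) / p.a⌋₊, ?_, ?_, ?_⟩
  -- The second term of ζ(σ) alone gives 128(2 + c)√κ s/σ ≤ n, so s/u is at most the argument of the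
  -- logarithm in `K`, and the grid reaches down to u.
  · have hz : 8 * Real.sqrt (2 * (2 + c) * Real.sqrt p.κ * p.s / p.σ) ≤ Real.sqrt p.n := by
      refine le_trans ?_ hp.zeta_le
      unfold zeta
      have h1 : Real.sqrt (2 * (2 + c) * Real.sqrt p.κ * p.s / p.σ)
          ≤ Real.sqrt (2 * (2 + c) * Real.sqrt p.κ * p.s / p.σ) * Real.cosh (p.a / 2) :=
        le_mul_of_one_le_right (Real.sqrt_nonneg _) (Real.one_le_cosh _)
      have h2 : 0 ≤ Real.sqrt (2 * (p.κ - 1) * ((2 + 3 * c) * p.s / (4 * (2 + c) * Real.sqrt p.κ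
        * p.σ) + Real.log (p.K / p.ε))) * Real.cosh (p.a / 4) := by positivity
      linarith
    have hz2 := pow_le_pow_left₀ (by positivity) hz 2
    rw [mul_pow, Real.sq_sqrt (by positivity), Real.sq_sqrt hn.le] at hz2
    have h3 : p.s / u ≤ p.n / (72 * (2 + c) * Real.sqrt p.κ) := by
      have h4 : p.s / u ≤ p.s / p.σ := by gcongr
      refine h4.trans ?_
      rw [le_div_iff₀ (by positivity)]
      have e : 8 ^ 2 * (2 * (2 + c) * Real.sqrt p.κ * p.s / p.σ)
        = p.s / p.σ * (72 * (2 + c) * Real.sqrt p.κ)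
          + p.s / p.σ * (56 * (2 + c) * Real.sqrt p.κ) := by ring
      have : 0 ≤ p.s / p.σ * (56 * (2 + c) * Real.sqrt p.κ) := by positivity
      linarith
    have h5 : Real.log (p.s / u) / p.a
        ≤ p.a⁻¹ * Real.log (p.n / (72 * (2 + c) * Real.sqrt p.κ)) := by
      rw [div_eq_inv_mul]
      have := Real.log_le_log (by positivity) h3
      gcongr
    have h6 : (⌊Real.log (p.s / u) / p.a⌋₊ : ℝ)
        ≤ ⌈p.a⁻¹ * Real.log (p.n / (72 * (2 + c) * Real.sqrt p.κ))⌉₊ :=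
      hj1.trans (h5.trans (Nat.le_ceil _))
    have h7 : ⌊Real.log (p.s / u) / p.a⌋₊
        ≤ ⌈p.a⁻¹ * Real.log (p.n / (72 * (2 + c) * Real.sqrt p.κ))⌉₊ := by exact_mod_cast h6
    unfold K
    omega
  · rw [le_div_iff₀ ha] at hj1
    unfold level
    rw [Real.exp_neg, ← div_eq_mul_inv, le_div_iff₀ (Real.exp_pos _)]
    have h8 := Real.exp_le_exp.2 hj1
    rw [Real.exp_log (by positivity), le_div_iff₀ hu0] at h8
    linarith
  · rw [div_lt_iff₀ ha] at hj2
    unfold level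
    have h8 := Real.exp_le_exp.2 hj2.le
    rw [Real.exp_log (by positivity), add_mul, one_mul, Real.exp_add, div_le_iff₀ hu0] at h8
    rw [Real.exp_neg, ← div_eq_mul_inv, div_le_iff₀ (Real.exp_pos _)]
    linarith

/-- This is the equation that determines λ_j: the terms of the slack independent of θ combine with
λ²/2 into κλ²/2. -/
lemma lam_sq (hp : p.Admissible) (hL : 0 < Real.log (p.K / p.ε)) (j : ℕ) :
    (2 + 3 * c) * p.s ^ 2 / (2 * p.beta j ^ 2) + Real.log (p.K / p.ε) / p.n
      = (p.κ - 1) * p.lam j ^ 2 / 2 := by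
  have hc := c_pos
  have hs := hp.s_pos
  have hn := hp.n_pos
  have hk := Real.sqrt_pos.2 hp.kappa_pos
  have ht := level_pos hs j
  have hκ : 0 < p.κ - 1 := by linarith [hp.kappa_ge]
  unfold lam beta
  rw [Real.sq_sqrt (by positivity), Real.sq_sqrt (by positivity)]
  field_simp
  ring

lemma lam_pos (hp : p.Admissible) (hL : 0 < Real.log (p.K / p.ε)) (j : ℕ) : 0 < p.lam j := by
  have hc := c_pos
  have hs := hp.s_pos
  have hn := hp.n_pos
  have hk := Real.sqrt_pos.2 hp.kappa_pos
  have ht := level_pos hs j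
  have hκ : 0 < p.κ - 1 := by linarith [hp.kappa_ge]
  unfold lam
  exact Real.sqrt_pos.2 (by positivity)

/-- β_j minimises Q/β + β/(2nt) at t = t_j, where Q = (2 + c)√κ s. At u instead of t_j the sum is
the optimal value times cosh(½ log(t_j/u)), hence the factor cosh(a/2). The λ term needs only t_j ≥
u. -/
lemma sum_le_zeta (hp : p.Admissible) (hL : 0 < Real.log (p.K / p.ε)) {u : ℝ}
    (hu : 0 < u) {j : ℕ} (h1 : u ≤ p.level j) (h2 : p.level j ≤ u * Real.exp p.a) :
    (p.κ - 1) * p.lam j + (2 + c) * Real.sqrt p.κ * p.s / p.beta j + p.beta j / (2 * p.n * u)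
      ≤ p.zeta u / Real.sqrt p.n := by
  have hc := c_pos
  have hs := hp.s_pos
  have hn := hp.n_pos
  have hk := Real.sqrt_pos.2 hp.kappa_pos
  have ht := level_pos hs j
  have hκ : 0 < p.κ - 1 := by linarith [hp.kappa_ge]
  have hsn := Real.sqrt_pos.2 hn
  have hsn2 := Real.sq_sqrt hn.le
  set Q := (2 + c) * Real.sqrt p.κ * p.s with hQ
  have hQ0 : 0 < Q := by positivity
  have hfirst : (p.κ - 1) * p.lam j * Real.sqrt p.n
      ≤ Real.sqrt (2 * (p.κ - 1) * ((2 + 3 * c) * p.s / (4 * (2 + c) * Real.sqrt p.κ * u)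
      + Real.log (p.K / p.ε))) * Real.cosh (p.a / 4) := by
    refine le_trans ?_ (le_mul_of_one_le_right (Real.sqrt_nonneg _) (Real.one_le_cosh _))
    apply Real.le_sqrt_of_sq_le
    rw [mul_pow, mul_pow, hsn2]
    unfold lam
    rw [Real.sq_sqrt (by positivity)]
    have e : ∀ z, (p.κ - 1) ^ 2 * (2 / (p.n * (p.κ - 1)) * z) * p.n = 2 * (p.κ - 1) * z := by
      intro z; field_simp
    rw [e]
    gcongr
  have hsecond : (Q / p.beta j + p.beta j / (2 * p.n * u)) * Real.sqrt p.n
      ≤ Real.sqrt (2 * Q / u) * Real.cosh (p.a / 2) := by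
    set τ := Real.log (p.level j / u) / 2 with hτ
    have hτ0 : 0 ≤ τ := by
      have : 0 ≤ Real.log (p.level j / u) := Real.log_nonneg (by rwa [one_le_div hu])
      positivity
    have hτa : τ ≤ p.a / 2 := by
      have : Real.log (p.level j / u) ≤ p.a := by
        rw [Real.log_le_iff_le_exp (by positivity), div_le_iff₀ hu]; linarith
      rw [hτ]; linarith
    have hlev : p.level j = u * Real.exp τ ^ 2 := by
      rw [← Real.exp_nat_mul, hτ]
      push_cast
      rw [mul_div_cancel₀ _ (two_ne_zero), Real.exp_log (by positivity)]
      field_simp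
    have hb : p.beta j = Real.sqrt (2 * Q / u) * Real.sqrt p.n * u * Real.exp τ := by
      unfold beta
      rw [Real.sqrt_eq_iff_mul_self_eq (by positivity) (by positivity), hlev]
      have e1 := Real.sq_sqrt (show 0 ≤ 2 * Q / u by positivity)
      have : Real.sqrt (2 * Q / u) * Real.sqrt p.n * u * Real.exp τ *
          (Real.sqrt (2 * Q / u) * Real.sqrt p.n * u * Real.exp τ)
          = Real.sqrt (2 * Q / u) ^ 2 * Real.sqrt p.n ^ 2 * u ^ 2 * Real.exp τ ^ 2 := by ring
      rw [this, e1, hsn2, hQ]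
      field_simp
    have hcosh : Real.cosh τ ≤ Real.cosh (p.a / 2) := by
      rw [Real.cosh_le_cosh, abs_of_nonneg hτ0, abs_of_nonneg (hτ0.trans hτa)]
      exact hτa
    refine le_trans (le_of_eq ?_) (mul_le_mul_of_nonneg_left hcosh (Real.sqrt_nonneg _))
    have hR := Real.sqrt_pos.2 (show 0 < 2 * Q / u by positivity)
    have hR2 := Real.sq_sqrt (show 0 ≤ 2 * Q / u by positivity)
    have hQR : Q = Real.sqrt (2 * Q / u) ^ 2 * u / 2 := by rw [hR2]; field_simp
    rw [hb, Real.cosh_eq, Real.exp_neg]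
    generalize Real.sqrt (2 * Q / u) = R at *
    generalize Real.sqrt p.n = S at *
    rw [hQR, ← hsn2]
    have := Real.exp_pos τ
    field_simp
    ring
  rw [le_div_iff₀ hsn]
  have e : 2 * Q / u = 2 * (2 + c) * Real.sqrt p.κ * p.s / u := by rw [hQ]; ring
  rw [e] at hsecond
  unfold zeta
  nlinarith

/-- With α² = λμ/u the slack becomes homogeneous: a factor λ comes out, and energies appear only
through their ratio to u. -/
lemma slack_eq (hp : p.Admissible) (hL : 0 < Real.log (p.K / p.ε)) (j : ℕ) {u : ℝ} (hu : 0 < u)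
    (μ r : ℝ) : p.slack j (p.lam j * μ / u * (r * u)) (p.lam j * μ / u)
      = p.lam j * (normSlack p.κ (p.lam j) ((2 + c) * Real.sqrt p.κ * p.s / p.beta j) (μ * r)
        + μ * (p.beta j / (2 * p.n * u))) := by
  have hn := hp.n_pos
  have hb := hp.beta_pos j
  have h := lam_sq hp hL j
  have e : p.lam j * μ / u * (r * u) = p.lam j * (μ * r) := by field_simp
  unfold slack normSlack
  rw [e]
  have h1 : p.beta j * (p.lam j * μ / u) / (2 * p.n) = p.lam j * (μ * (p.beta j / (2 * p.n * u))) := by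
    field_simp
  have h2 : (2 + c) * Real.sqrt p.κ * p.s * (p.lam j * (μ * r)) / p.beta j
      = p.lam j * (μ * r * ((2 + c) * Real.sqrt p.κ * p.s / p.beta j)) := by field_simp
  rw [h1, h2]
  linear_combination h

variable {d : ℕ} {x : Fin p.n → EuclideanSpace ℝ (Fin d)} {θ : EuclideanSpace ℝ (Fin d)}

/-- Both points are compared with the same empirical risk at the same scale, so the risk cancels and
only the two slacks remain. -/
lemma sub_le_of_mem_region (hp : p.Admissible) (hL : 0 < Real.log (p.K / p.ε)) (hθ : ‖θ‖ = 1)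
    {t₁ t₂ : ℝ} (h1 : t₁ ∈ p.region x θ) (h2 : t₂ ∈ p.region x θ) {j : ℕ} (hj : j < p.K)
    {u : ℝ} (hu : 0 < u) {μ : ℝ} (hμ : 0 ≤ μ) :
    μ * (t₂ / u - t₁ / u)
      ≤ normSlack p.κ (p.lam j) ((2 + c) * Real.sqrt p.κ * p.s / p.beta j) (μ * (t₂ / u))
        + normSlack p.κ (p.lam j) ((2 + c) * Real.sqrt p.κ * p.s / p.beta j) (μ * (t₁ / u))
        + 2 * μ * (p.beta j / (2 * p.n * u)) := by
  have hl := lam_pos hp hL j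
  have hw : 0 ≤ p.lam j * μ / u := by positivity
  have h3 := h1.2 j hj (Real.sqrt (p.lam j * μ / u)) (Real.sqrt_nonneg _)
  have h4 := h2.2 j hj (Real.sqrt (p.lam j * μ / u)) (Real.sqrt_nonneg _)
  rw [Real.sq_sqrt hw, hθ, one_pow, mul_one] at h3 h4
  have e1 : t₁ = t₁ / u * u := by field_simp
  have e2 : t₂ = t₂ / u * u := by field_simp
  rw [abs_le] at h3 h4
  have h5 := slack_eq hp hL j hu μ (t₁ / u)
  have h6 := slack_eq hp hL j hu μ (t₂ / u)
  rw [← e1] at h5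
  rw [← e2] at h6
  have h7 : p.lam j * (μ * (t₂ / u - t₁ / u))
      = p.lam j * μ / u * t₂ - p.lam j * μ / u * t₁ := by field_simp
  refine le_of_mul_le_mul_left ?_ hl
  rw [h7]
  linarith [h3.2, h4.1]

/-- The width of the confidence region. -/
lemma abs_sub_le_of_mem_region (hp : p.Admissible) (ha : 0 < p.a)
    (hL : 0 < Real.log (p.K / p.ε)) (hθ : ‖θ‖ = 1) {N t : ℝ} (hN : N ∈ p.region x θ)
    (hNs : N ≤ p.s) (ht : t ∈ p.region x θ) :
    |t - N| ≤ 2 * max N p.σ * (p.zeta (max N p.σ) / Real.sqrt p.n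
      / (1 - 4 * (p.zeta (max N p.σ) / Real.sqrt p.n))) + p.σ := by
  set u := max N p.σ with hu
  have hσ := hp.sigma_pos
  have hσu : p.σ ≤ u := le_max_right _ _
  have hNu : N ≤ u := le_max_left _ _
  have hu0 : 0 < u := hσ.trans_le hσu
  have hus : u ≤ p.s := max_le hNs hp.sigma_le
  have hN0 : 0 ≤ N := hN.1
  have ht0 : 0 ≤ t := ht.1
  obtain ⟨j, hj, hj1, hj2⟩ := exists_level hp ha hσu hus
  have hX := sum_le_zeta hp hL hu0 hj1 hj2
  have hX8 := zeta_div_le hp hσu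
  set X := p.zeta u / Real.sqrt p.n with hXdef
  have hX0 : 0 < X := div_pos (zeta_pos hp.kappa_pos hp.s_pos hu0) (Real.sqrt_pos.2 hp.n_pos)
  have hb := hp.beta_pos j
  have hn := hp.n_pos
  have hc := c_pos
  have hs := hp.s_pos
  have hD1 : 0 ≤ (2 + c) * Real.sqrt p.κ * p.s / p.beta j := by positivity
  have hD2 : 0 ≤ p.beta j / (2 * p.n * u) := by positivity
  have hl := (lam_pos hp hL j).le
  have hY : 0 ≤ X / (1 - 4 * X) := div_nonneg hX0.le (by linarith)
  have huN : u - N ≤ p.σ := by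
    rcases max_cases N p.σ with h | h <;> rw [hu, h.1] <;> linarith
  have hpos : 0 ≤ 2 * u * (X / (1 - 4 * X)) := by positivity
  rw [abs_le]
  constructor
  · rcases lt_or_ge t N with htN | htN
    -- Below the threshold there is nothing to estimate: t ≥ 0 already gives N − t ≤ N < σ.
    · rcases le_or_gt p.σ N with hσN | hσN
      · have huN' : u = N := max_eq_left hσN
        have h := sub_le_of_mem_region hp hL hθ ht hN hj hu0 zero_le_one
        rw [← huN', div_self hu0.ne'] at h
        simp only [one_mul, mul_one] at h
        have h' := width_below hp.kappa_ge hl hD1 hD2 hX hX8 (div_nonneg ht0 hu0.le)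
          (by rw [div_le_one hu0]; linarith) h
        rw [sub_le_iff_le_add, ← sub_le_iff_le_add', le_div_iff₀ hu0] at h'
        nlinarith
      · linarith
    · linarith
  · rcases le_or_gt t u with htu | htu
    · linarith
    · have h' := width_above hp.kappa_ge hl hD1 hD2 hX hX8 (div_nonneg hN0 hu0.le)
        (by rw [div_le_one hu0]; exact hNu) (by rw [one_lt_div hu0]; exact htu)
        (fun μ hμ => sub_le_of_mem_region hp hL hθ hN ht hj hu0 hμ)
      rw [sub_le_iff_le_add, div_le_iff₀ hu0] at h'
      nlinarith

end Params

/-! ### Regularity of the bound -/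

namespace Params

variable (p : Params)

/-- The real number `n^{-1/2} ζ(t) / (1 - 4 n^{-1/2} ζ(t))`. -/
def relBound (t : ℝ) : ℝ :=
  p.zeta t / Real.sqrt p.n / (1 - 4 * (p.zeta t / Real.sqrt p.n))

variable {p}

lemma toReal_Bstar (hp : p.Admissible) (t : ℝ) :
    (p.Bstar t).toReal = p.relBound (max t p.σ) := by
  have h := p.Bstar_ne_top hp t
  unfold Bstar at h ⊢
  split_ifs at h ⊢ with h1
  · rw [EReal.toReal_coe]
    unfold relBound
    rw [div_eq_inv_mul (p.zeta _), mul_assoc]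
  · exact absurd rfl h

variable {u v : ℝ}

lemma zeta_div_pos (hp : p.Admissible) (hu : p.σ ≤ u) : 0 < p.zeta u / Real.sqrt p.n :=
  div_pos (zeta_pos hp.kappa_pos hp.s_pos (hp.sigma_pos.trans_le hu)) (Real.sqrt_pos.2 hp.n_pos)

lemma relBound_nonneg (hp : p.Admissible) (hu : p.σ ≤ u) : 0 ≤ p.relBound u :=
  div_nonneg (zeta_div_pos hp hu).le (by linarith [zeta_div_le hp hu])

lemma relBound_le (hp : p.Admissible) (hu : p.σ ≤ u) : p.relBound u ≤ 1 / 4 := by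
  have h := zeta_div_le hp hu
  unfold relBound
  rw [div_le_iff₀ (by linarith)]
  linarith

lemma relBound_anti (hp : p.Admissible) (hu : p.σ ≤ u) (huv : u ≤ v) :
    p.relBound v ≤ p.relBound u := by
  have hz := p.zeta_anti hp.s_pos.le (by linarith [hp.kappa_ge]) (hp.sigma_pos.trans_le hu) huv
  have hz' : p.zeta v / Real.sqrt p.n ≤ p.zeta u / Real.sqrt p.n := by gcongr
  have h1 := zeta_div_le hp hu
  have h2 := zeta_div_le hp (hu.trans huv)
  have h3 := zeta_div_pos hp hu
  unfold relBound
  exact div_le_div₀ h3.le hz' (by linarith) (by linarith)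

/-- Equivalently √t ζ(t) is nondecreasing: the factor √t cancels every 1/t under the roots and
multiplies the logarithmic term by t. -/
lemma sqrt_mul_zeta_le (hp : p.Admissible) (hL : 0 ≤ Real.log (p.K / p.ε)) (hu : 0 < u)
    (huv : u ≤ v) : Real.sqrt (u / v) * p.zeta u ≤ p.zeta v := by
  have hv : 0 < v := hu.trans_le huv
  have hc := c_pos
  have hs := hp.s_pos
  have hk := Real.sqrt_pos.2 hp.kappa_pos
  have hκ : 0 < p.κ - 1 := by linarith [hp.kappa_ge]
  unfold zeta
  rw [mul_add, ← mul_assoc, ← mul_assoc, ← Real.sqrt_mul (by positivity),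
    ← Real.sqrt_mul (by positivity)]
  refine add_le_add (mul_le_mul_of_nonneg_right (Real.sqrt_le_sqrt ?_) (Real.cosh_pos _).le)
    (mul_le_mul_of_nonneg_right (Real.sqrt_le_sqrt ?_) (Real.cosh_pos _).le)
  · have e : u / v * (2 * (p.κ - 1) * ((2 + 3 * c) * p.s / (4 * (2 + c) * Real.sqrt p.κ * u)
        + Real.log (p.K / p.ε))) = 2 * (p.κ - 1) * ((2 + 3 * c) * p.s
          / (4 * (2 + c) * Real.sqrt p.κ * v) + u / v * Real.log (p.K / p.ε)) := by
      field_simp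
    rw [e]
    gcongr
    exact mul_le_of_le_one_left hL ((div_le_one hv).2 huv)
  · refine le_of_eq ?_
    field_simp

/-- With r = √(u/v) and x = ζ(u)/√n, it reduces to (1 − r)(1 − 4x(1 + r)) ≥ 0, which is where x ≤
1/8 is needed. -/
lemma mul_relBound_mono (hp : p.Admissible) (hL : 0 ≤ Real.log (p.K / p.ε)) (hu : p.σ ≤ u)
    (huv : u ≤ v) : u * p.relBound u ≤ v * p.relBound v := by
  have hu0 : 0 < u := hp.sigma_pos.trans_le hu
  have hv : 0 < v := hu0.trans_le huv
  have hz := sqrt_mul_zeta_le hp hL hu0 huv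
  set r := Real.sqrt (u / v) with hr
  have hr0 : 0 < r := Real.sqrt_pos.2 (by positivity)
  have hr1 : r ≤ 1 := Real.sqrt_le_one.2 ((div_le_one hv).2 huv)
  have hur : u = r ^ 2 * v := by rw [hr, Real.sq_sqrt (by positivity)]; field_simp
  have hsn := Real.sqrt_pos.2 hp.n_pos
  set x := p.zeta u / Real.sqrt p.n with hx
  set y := p.zeta v / Real.sqrt p.n with hy
  have hx0 : 0 < x := zeta_div_pos hp hu
  have hx8 : x ≤ 1 / 8 := zeta_div_le hp hu
  have hy8 : y ≤ 1 / 8 := zeta_div_le hp (hu.trans huv)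
  have hxy : r * x ≤ y := by
    rw [hx, hy, mul_div_assoc']
    gcongr
  have h1 : r ^ 2 * (x / (1 - 4 * x)) ≤ r * x / (1 - 4 * (r * x)) := by
    have hrx : r * x ≤ x := mul_le_of_le_one_left hx0.le hr1
    rw [mul_div_assoc', div_le_div_iff₀ (by linarith) (by linarith)]
    have : 0 ≤ r * x * ((1 - r) * (1 - 4 * x * (1 + r))) := by
      have : 0 ≤ 1 - 4 * x * (1 + r) := by nlinarith
      have : 0 ≤ 1 - r := by linarith
      positivity
    nlinarith
  have h2 : r * x / (1 - 4 * (r * x)) ≤ y / (1 - 4 * y) :=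
    div_le_div₀ ((by positivity : 0 ≤ r * x).trans hxy) hxy (by linarith) (by linarith)
  change u * (x / (1 - 4 * x)) ≤ v * (y / (1 - 4 * y))
  calc u * (x / (1 - 4 * x)) = v * (r ^ 2 * (x / (1 - 4 * x))) := by rw [hur]; ring
    _ ≤ _ := by gcongr; exact h1.trans h2

/-- The main term `2 max(t, σ) B_*(min(t, s₄²))` of the bound. -/
def mainTerm (p : Params) (t : ℝ) : ℝ :=
  2 * max t p.σ * p.relBound (min (max t p.σ) p.s)

lemma B_eq (hp : p.Admissible) (δ g t : ℝ) : p.B δ g t = p.mainTerm t + 7 * δ * g + p.σ := by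
  unfold B mainTerm
  rw [toReal_Bstar hp, max_min_distrib_right, max_eq_left hp.sigma_le]

lemma mainTerm_nonneg (hp : p.Admissible) (t : ℝ) : 0 ≤ p.mainTerm t := by
  have h := relBound_nonneg hp (le_min (le_max_right t p.σ) hp.sigma_le)
  have : 0 < max t p.σ := hp.sigma_pos.trans_le (le_max_right _ _)
  unfold mainTerm
  positivity

lemma mainTerm_mono (hp : p.Admissible) (hL : 0 ≤ Real.log (p.K / p.ε)) {t t' : ℝ}
    (h : t ≤ t') : p.mainTerm t ≤ p.mainTerm t' := by
  have hw : max t p.σ ≤ max t' p.σ := max_le_max_right _ h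
  have hσ : p.σ ≤ max t p.σ := le_max_right _ _
  unfold mainTerm
  generalize max t p.σ = w at *
  generalize max t' p.σ = w' at *
  have hw0 : 0 < w := hp.sigma_pos.trans_le hσ
  rcases le_total p.s w with hs | hs
  · rw [min_eq_right hs, min_eq_right (hs.trans hw)]
    have := relBound_nonneg hp hp.sigma_le
    gcongr
  · rw [min_eq_left hs]
    have h1 : w ≤ min w' p.s := le_min hw hs
    have h2 := mul_relBound_mono hp hL hσ h1
    have h3 : min w' p.s * p.relBound (min w' p.s) ≤ w' * p.relBound (min w' p.s) :=
      mul_le_mul_of_nonneg_right (min_le_left _ _) (relBound_nonneg hp (hσ.trans h1))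
    linarith

/-- The relative bound is nonincreasing and at most 1/4, so only the increment of the prefactor 2
max(t, σ) counts. -/
lemma mainTerm_lipschitz (hp : p.Admissible) {t t' : ℝ}
    (h : t ≤ t') : p.mainTerm t' ≤ p.mainTerm t + (t' - t) / 2 := by
  have hw : max t p.σ ≤ max t' p.σ := max_le_max_right _ h
  have hd : max t' p.σ - max t p.σ ≤ t' - t := by
    rcases max_cases t' p.σ with h1 | h1 <;> rw [h1.1]
    · linarith [le_max_left t p.σ]
    · linarith [le_max_right t p.σ]
  have hσ : p.σ ≤ max t p.σ := le_max_right _ _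
  unfold mainTerm
  generalize max t p.σ = w at *
  generalize max t' p.σ = w' at *
  have hw0 : 0 < w := hp.sigma_pos.trans_le hσ
  have hm : p.σ ≤ min w p.s := le_min hσ hp.sigma_le
  have h1 : p.relBound (min w' p.s) ≤ p.relBound (min w p.s) :=
    relBound_anti hp hm (min_le_min_right _ hw)
  have h2 := relBound_le hp hm
  have h3 : 2 * w' * p.relBound (min w' p.s) ≤ 2 * w' * p.relBound (min w p.s) :=
    mul_le_mul_of_nonneg_left h1 (by linarith)
  nlinarith

lemma B_mono (hp : p.Admissible) (hL : 0 ≤ Real.log (p.K / p.ε)) (δ g : ℝ) :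
    Monotone (p.B δ g) := by
  intro t t' h
  rw [B_eq hp, B_eq hp]
  linarith [mainTerm_mono hp hL h]

lemma B_lipschitz (hp : p.Admissible) (δ g : ℝ) {t t' : ℝ} (h : t ≤ t') :
    p.B δ g t' ≤ p.B δ g t + (t' - t) / 2 := by
  rw [B_eq hp, B_eq hp]
  linarith [mainTerm_lipschitz hp h]

lemma B_nonneg (hp : p.Admissible) {δ g : ℝ} (hδ : 0 ≤ δ) (hg : 0 ≤ g) (t : ℝ) :
    0 ≤ p.B δ g t := by
  rw [B_eq hp]
  have := mainTerm_nonneg hp t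
  have := hp.sigma_pos
  positivity

end Params

/-! ### From the net to the sphere -/

section Net

variable {d : ℕ}

local notation "E" => EuclideanSpace ℝ (Fin d)

/-- The bilinear form of a matrix. -/
def bil (M : Matrix (Fin d) (Fin d) ℝ) (a b : EuclideanSpace ℝ (Fin d)) : ℝ :=
  ∑ i, ∑ j, a i * M i j * b j

lemma frob_sq (M : Matrix (Fin d) (Fin d) ℝ) : frob M ^ 2 = ∑ i, ∑ j, M i j ^ 2 := by
  have h : Matrix.trace (M.transpose * M) = ∑ i, ∑ j, M i j ^ 2 := by
    simp only [Matrix.trace, Matrix.diag, Matrix.mul_apply, Matrix.transpose_apply]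
    rw [Finset.sum_comm]
    exact Finset.sum_congr rfl fun i _ => Finset.sum_congr rfl fun j _ => by ring
  unfold frob
  rw [h, Real.sq_sqrt (by positivity)]

lemma frob_nonneg (M : Matrix (Fin d) (Fin d) ℝ) : 0 ≤ frob M := Real.sqrt_nonneg _

lemma abs_bil_le (M : Matrix (Fin d) (Fin d) ℝ) (a b : E) :
    |bil M a b| ≤ frob M * (‖a‖ * ‖b‖) := by
  apply abs_le_of_sq_le_sq _ (mul_nonneg (frob_nonneg M) (by positivity))
  have h := Finset.sum_mul_sq_le_sq_mul_sq (Finset.univ : Finset (Fin d × Fin d))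
    (fun q => M q.1 q.2) (fun q => a q.1 * b q.2)
  have e1 : bil M a b = ∑ q : Fin d × Fin d, M q.1 q.2 * (a q.1 * b q.2) := by
    rw [Fintype.sum_prod_type]
    exact Finset.sum_congr rfl fun i _ => Finset.sum_congr rfl fun j _ => by ring
  have e2 : ∑ q : Fin d × Fin d, M q.1 q.2 ^ 2 = frob M ^ 2 := by
    rw [Fintype.sum_prod_type, frob_sq]
  have e3 : ∑ q : Fin d × Fin d, (a q.1 * b q.2) ^ 2 = ‖a‖ ^ 2 * ‖b‖ ^ 2 := by
    rw [Fintype.sum_prod_type, EuclideanSpace.real_norm_sq_eq, EuclideanSpace.real_norm_sq_eq,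
      Finset.sum_mul_sum]
    exact Finset.sum_congr rfl fun i _ => Finset.sum_congr rfl fun j _ => by ring
  rw [e1, mul_pow, mul_pow, ← e3, ← e2]
  exact h

lemma quad_sub_quad (M : Matrix (Fin d) (Fin d) ℝ) (a b : E) :
    quad M a - quad M b = bil M a (a - b) + bil M (a - b) b := by
  unfold quad bil
  rw [← Finset.sum_sub_distrib, ← Finset.sum_add_distrib]
  refine Finset.sum_congr rfl fun i _ => ?_
  rw [← Finset.sum_sub_distrib, ← Finset.sum_add_distrib]
  refine Finset.sum_congr rfl fun j _ => ?_
  simp only [PiLp.sub_apply]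
  ring

lemma abs_quad_sub_quad_le (M : Matrix (Fin d) (Fin d) ℝ) {a b : E} (ha : ‖a‖ = 1) (hb : ‖b‖ = 1)
    {δ : ℝ} (h : ‖a - b‖ ≤ δ) : |quad M a - quad M b| ≤ 2 * δ * frob M := by
  rw [quad_sub_quad]
  refine (abs_add_le _ _).trans ?_
  have h1 := abs_bil_le M a (a - b)
  have h2 := abs_bil_le M (a - b) b
  rw [ha, one_mul] at h1
  rw [hb, mul_one] at h2
  have h3 : frob M * ‖a - b‖ ≤ frob M * δ := mul_le_mul_of_nonneg_left h (frob_nonneg M)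
  linarith

lemma quad_gram {P : Measure (EuclideanSpace ℝ (Fin d))} [IsProbabilityMeasure P]
    (hP : MemLp (fun x : E => x) 4 P) (θ : E) : quad (gram P) θ = energy P θ := by
  have hij : ∀ i j : Fin d, Integrable (fun x : E => x i * x j) P := by
    intro i j
    refine (integrable_norm_sq hP).mono' (by fun_prop) (Filter.Eventually.of_forall fun x => ?_)
    rw [norm_mul, sq]
    exact mul_le_mul (PiLp.norm_apply_le x i) (PiLp.norm_apply_le x j) (norm_nonneg _)
      (norm_nonneg _)
  have e : ∀ x : E, (inner ℝ θ x : ℝ) ^ 2 = ∑ i, ∑ j, θ i * θ j * (x i * x j) := by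
    intro x
    rw [sq, PiLp.inner_apply, Finset.sum_mul_sum]
    refine Finset.sum_congr rfl fun i _ => Finset.sum_congr rfl fun j _ => ?_
    simp
    ring
  unfold energy quad gram
  simp_rw [e]
  rw [integral_finsetSum _ fun i _ => integrable_finsetSum _ fun j _ => (hij i j).const_mul _]
  refine Finset.sum_congr rfl fun i _ => ?_
  rw [integral_finsetSum _ fun j _ => (hij i j).const_mul _]
  refine Finset.sum_congr rfl fun j _ => ?_
  rw [integral_const_mul, Matrix.of_apply]
  ring

lemma gram_isSymm (P : Measure (EuclideanSpace ℝ (Fin d))) : (gram P).IsSymm := by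
  ext i j
  simp only [gram, Matrix.transpose_apply, Matrix.of_apply]
  simp_rw [mul_comm]

/-- Moving to a net point costs 2δ‖Q‖_F ≤ 2δ‖G‖_F for Q, 2δ‖G‖_F for G, and half of the latter
inside the main term: 5δ‖G‖_F in all, within the 7δ‖G‖_F allowed. The norm of Q is controlled
because G is a competitor in the minimisation. -/
lemma abs_quad_sub_energy_le {P : Measure (EuclideanSpace ℝ (Fin d))} [IsProbabilityMeasure P]
    (hP : MemLp (fun x : E => x) 4 P) {p : Params} (hp : p.Admissible) (ha : 0 < p.a)
    (hL : 0 < Real.log (p.K / p.ε)) (hs : s4sq P = p.s) {x : Fin p.n → E}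
    (hx : ∀ θ, energy P θ ∈ p.region x θ) {δ : ℝ} (hδ : 0 < δ) {Θ : Finset E} (hΘ : IsNet δ Θ)
    {Q : Matrix (Fin d) (Fin d) ℝ} (hQ : p.IsEstimate x Θ Q) {θ : E} (hθ : ‖θ‖ = 1) :
    |quad Q θ - energy P θ| ≤ p.B δ (frob (gram P)) (energy P θ) := by
  have hfeas : gram P ∈ p.feasible x Θ := by
    refine ⟨gram_isSymm P, fun ξ _ => ?_⟩
    rw [quad_gram hP]
    exact subset_convexHull ℝ _ (hx ξ)
  obtain ⟨⟨-, hQΘ⟩, hmin⟩ := hQ.2 ⟨_, hfeas⟩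
  have hQG := hmin _ hfeas
  obtain ⟨ξ, hξΘ, hξ⟩ := hΘ.2 θ hθ
  have hξ1 := hΘ.1 ξ hξΘ
  have hEs : energy P ξ ≤ p.s := hs ▸ energy_le hP hξ1
  have hnet : |quad Q ξ - energy P ξ| ≤ p.mainTerm (energy P ξ) + p.σ := by
    have hsub : p.interval x ξ ⊆ {t | |t - energy P ξ| ≤ p.mainTerm (energy P ξ) + p.σ} := by
      refine convexHull_min (fun t ht => ?_) ?_
      · have := Params.abs_sub_le_of_mem_region hp ha hL hξ1 (hx ξ) hEs ht
        unfold Params.mainTerm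
        rw [min_eq_left (max_le hEs hp.sigma_le)]
        exact this
      · have : {t | |t - energy P ξ| ≤ p.mainTerm (energy P ξ) + p.σ}
            = Metric.closedBall (energy P ξ) (p.mainTerm (energy P ξ) + p.σ) := by
          ext t; simp [Real.dist_eq]
        rw [this]
        exact convex_closedBall _ _
    exact hsub (hQΘ ξ hξΘ)
  have h1 := abs_quad_sub_quad_le Q hθ hξ1 hξ
  have h2 := abs_quad_sub_quad_le (gram P) hθ hξ1 hξ
  rw [quad_gram hP, quad_gram hP] at h2
  have h3 : 2 * δ * frob Q ≤ 2 * δ * frob (gram P) := by gcongr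
  have hg : 0 ≤ δ * frob (gram P) := mul_nonneg hδ.le (frob_nonneg _)
  have h4 : p.mainTerm (energy P ξ) ≤ p.mainTerm (energy P θ) + δ * frob (gram P) := by
    rcases le_total (energy P θ) (energy P ξ) with h | h
    · have := Params.mainTerm_lipschitz hp h
      have := (abs_le.1 h2).1
      linarith
    · have := Params.mainTerm_mono hp hL.le h
      linarith
  rw [Params.B_eq hp]
  rw [abs_le] at *
  constructor <;> linarith [h1.1, h1.2, h2.1, h2.2, hnet.1, hnet.2]

end Net

/-! ### Functional calculus and Frobenius norm -/

section Spectral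

variable {d : ℕ}

local notation "E" => EuclideanSpace ℝ (Fin d)

variable {A C : Matrix (Fin d) (Fin d) ℝ} (hA : A.IsHermitian) (hC : C.IsHermitian)

lemma cfc_apply_eq_sum (f : ℝ → ℝ) (i j : Fin d) :
    cfc f A i j = ∑ k, f (hA.eigenvalues k) * (hA.eigenvectorBasis k i * hA.eigenvectorBasis k j) := by
  rw [hA.cfc_eq, Matrix.IsHermitian.cfc, Unitary.conjStarAlgAut_apply, Matrix.mul_apply]
  refine Finset.sum_congr rfl fun k _ => ?_
  rw [Matrix.mul_diagonal, Matrix.star_apply, Matrix.IsHermitian.eigenvectorUnitary_apply,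
    Matrix.IsHermitian.eigenvectorUnitary_apply]
  simp
  ring

lemma quad_cfc (f : ℝ → ℝ) (θ : E) :
    quad (cfc f A) θ = ∑ k, f (hA.eigenvalues k) * (inner ℝ (hA.eigenvectorBasis k) θ : ℝ) ^ 2 := by
  unfold quad
  simp_rw [cfc_apply_eq_sum hA f, PiLp.inner_apply, sq, Finset.sum_mul_sum, Finset.mul_sum,
    Finset.sum_mul]
  rw [Finset.sum_comm]
  rw [Finset.sum_congr rfl fun y _ => Finset.sum_comm]
  rw [Finset.sum_comm]
  refine Finset.sum_congr rfl fun k _ => ?_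
  rw [Finset.sum_comm]
  refine Finset.sum_congr rfl fun i _ => Finset.sum_congr rfl fun j _ => ?_
  simp
  ring

lemma quad_eq_sum (θ : E) :
    quad A θ = ∑ k, hA.eigenvalues k * (inner ℝ (hA.eigenvectorBasis k) θ : ℝ) ^ 2 := by
  have h := quad_cfc hA id θ
  rw [cfc_id ℝ A hA.isSelfAdjoint] at h
  simpa using h

/-- The squared cosines between the eigenvectors of two symmetric matrices. -/
def cosSq (k l : Fin d) : ℝ := (inner ℝ (hA.eigenvectorBasis k) (hC.eigenvectorBasis l) : ℝ) ^ 2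

lemma cosSq_nonneg (k l : Fin d) : 0 ≤ cosSq hA hC k l := sq_nonneg _

lemma sum_cosSq_left (l : Fin d) : ∑ k, cosSq hA hC k l = 1 := by
  have := hA.eigenvectorBasis.sum_sq_inner_right (hC.eigenvectorBasis l)
  rwa [hC.eigenvectorBasis.norm_eq_one, one_pow] at this

lemma sum_cosSq_right (k : Fin d) : ∑ l, cosSq hA hC k l = 1 := by
  have := hC.eigenvectorBasis.sum_sq_inner_left (hA.eigenvectorBasis k)
  rwa [hA.eigenvectorBasis.norm_eq_one, one_pow] at this

lemma sum_cfc_mul_cfc (f g : ℝ → ℝ) : ∑ i, ∑ j, cfc f A i j * cfc g C i j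
    = ∑ k, ∑ l, f (hA.eigenvalues k) * g (hC.eigenvalues l) * cosSq hA hC k l := by
  have h : ∀ i j, cfc f A i j * cfc g C i j = ∑ k, ∑ l, f (hA.eigenvalues k) * g (hC.eigenvalues l)
      * ((hA.eigenvectorBasis k i * hC.eigenvectorBasis l i)
        * (hA.eigenvectorBasis k j * hC.eigenvectorBasis l j)) := by
    intro i j
    rw [cfc_apply_eq_sum hA, cfc_apply_eq_sum hC, Finset.sum_mul_sum]
    refine Finset.sum_congr rfl fun k _ => Finset.sum_congr rfl fun l _ => ?_
    ring
  have hc : ∀ k l, cosSq hA hC k l = ∑ i, ∑ j, (hA.eigenvectorBasis k i * hC.eigenvectorBasis l i)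
        * (hA.eigenvectorBasis k j * hC.eigenvectorBasis l j) := by
    intro k l
    rw [← Finset.sum_mul_sum, ← sq, cosSq, PiLp.inner_apply]
    congr 1
    refine Finset.sum_congr rfl fun i _ => ?_
    simp
    ring
  simp_rw [h, hc, Finset.mul_sum]
  rw [Finset.sum_congr rfl fun i _ => Finset.sum_comm, Finset.sum_comm]
  refine Finset.sum_congr rfl fun k _ => ?_
  rw [Finset.sum_congr rfl fun i _ => Finset.sum_comm, Finset.sum_comm]

/-- Expanding the square, the cross term is a sum against the squared cosines; the two pure terms
take the same form because rows and columns of that matrix sum to one. -/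
lemma frob_cfc_sub_cfc_sq (f g : ℝ → ℝ) : frob (cfc f A - cfc g C) ^ 2
    = ∑ k, ∑ l, (f (hA.eigenvalues k) - g (hC.eigenvalues l)) ^ 2 * cosSq hA hC k l := by
  have h1 : frob (cfc f A - cfc g C) ^ 2 = ∑ i, ∑ j, cfc f A i j * cfc f A i j
      - 2 * ∑ i, ∑ j, cfc f A i j * cfc g C i j + ∑ i, ∑ j, cfc g C i j * cfc g C i j := by
    rw [frob_sq]
    simp_rw [Finset.mul_sum, ← Finset.sum_sub_distrib, ← Finset.sum_add_distrib]
    refine Finset.sum_congr rfl fun i _ => Finset.sum_congr rfl fun j _ => ?_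
    rw [Matrix.sub_apply]
    ring
  have hself : ∀ {M : Matrix (Fin d) (Fin d) ℝ} (hM : M.IsHermitian) (f : ℝ → ℝ),
      ∑ i, ∑ j, cfc f M i j * cfc f M i j = ∑ k, f (hM.eigenvalues k) ^ 2 := by
    intro M hM f
    rw [sum_cfc_mul_cfc hM hM]
    refine Finset.sum_congr rfl fun k _ => ?_
    rw [Finset.sum_eq_single k]
    · rw [cosSq, real_inner_self_eq_norm_sq, hM.eigenvectorBasis.norm_eq_one]
      ring
    · intro l _ hl
      rw [cosSq, hM.eigenvectorBasis.orthonormal.2 hl.symm]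
      ring
    · simp
  have h2 : ∑ k, ∑ l, (f (hA.eigenvalues k) - g (hC.eigenvalues l)) ^ 2 * cosSq hA hC k l
      = ∑ k, ∑ l, f (hA.eigenvalues k) ^ 2 * cosSq hA hC k l
        - 2 * ∑ k, ∑ l, f (hA.eigenvalues k) * g (hC.eigenvalues l) * cosSq hA hC k l
        + ∑ k, ∑ l, g (hC.eigenvalues l) ^ 2 * cosSq hA hC k l := by
    simp_rw [Finset.mul_sum, ← Finset.sum_sub_distrib, ← Finset.sum_add_distrib]
    refine Finset.sum_congr rfl fun i _ => Finset.sum_congr rfl fun j _ => ?_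
    ring
  rw [h1, h2, hself hA, hself hC, sum_cfc_mul_cfc hA hC, Finset.sum_comm (f := fun k l =>
    g (hC.eigenvalues l) ^ 2 * cosSq hA hC k l)]
  simp_rw [← Finset.mul_sum, sum_cosSq_left, sum_cosSq_right, mul_one]

lemma quad_eigenvector_left (l : Fin d) : quad A (hC.eigenvectorBasis l)
    = ∑ k, hA.eigenvalues k * cosSq hA hC k l := quad_eq_sum hA _

lemma quad_eigenvector_right (k : Fin d) : quad C (hA.eigenvectorBasis k)
    = ∑ l, hC.eigenvalues l * cosSq hA hC k l := by
  rw [quad_eq_sum hC]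
  refine Finset.sum_congr rfl fun l _ => ?_
  rw [cosSq, real_inner_comm]

lemma quad_eigenvector (l : Fin d) : quad A (hA.eigenvectorBasis l) = hA.eigenvalues l := by
  rw [quad_eq_sum hA, Finset.sum_eq_single l]
  · rw [real_inner_self_eq_norm_sq, hA.eigenvectorBasis.norm_eq_one]
    ring
  · intro k _ hk
    rw [hA.eigenvectorBasis.orthonormal.2 hk]
    ring
  · simp

lemma trace_eq_sum : A.trace = ∑ k, hA.eigenvalues k := by
  simpa using hA.trace_eq_sum_eigenvalues

lemma eigenvalue_le_topEig (k : Fin d) : hA.eigenvalues k ≤ topEig A :=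
  le_csSup A.finite_real_spectrum.bddAbove (hA.eigenvalues_mem_spectrum_real k)

lemma quad_le_topEig {A : Matrix (Fin d) (Fin d) ℝ} (hA : A.IsHermitian) {θ : E} (hθ : ‖θ‖ = 1) : quad A θ ≤ topEig A := by
  have h := hA.eigenvectorBasis.sum_sq_inner_right θ
  rw [hθ, one_pow] at h
  rw [quad_eq_sum hA, ← mul_one (topEig A), ← h, Finset.mul_sum]
  exact Finset.sum_le_sum fun k _ =>
    mul_le_mul_of_nonneg_right (eigenvalue_le_topEig hA k) (sq_nonneg _)

/-- Lipschitz functions are Lipschitz for the Frobenius norm. -/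
lemma frob_cfc_sub_cfc_le {A C : Matrix (Fin d) (Fin d) ℝ} (hA : A.IsHermitian)
    (hC : C.IsHermitian) {f : ℝ → ℝ} {r : NNReal} (hf : LipschitzWith r f) (g : ℝ → ℝ) :
    frob (cfc f A - cfc (f ∘ g) C) ≤ r * frob (cfc (id : ℝ → ℝ) A - cfc g C) := by
  apply le_of_sq_le_sq _ (mul_nonneg r.2 (frob_nonneg _))
  rw [mul_pow, frob_cfc_sub_cfc_sq hA hC, frob_cfc_sub_cfc_sq hA hC, Finset.mul_sum]
  refine Finset.sum_le_sum fun k _ => ?_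
  rw [Finset.mul_sum]
  refine Finset.sum_le_sum fun l _ => ?_
  rw [← mul_assoc, ← mul_pow]
  refine mul_le_mul_of_nonneg_right ?_ (cosSq_nonneg hA hC k l)
  apply sq_le_sq.2
  rw [abs_mul, abs_of_nonneg r.2]
  have := hf.dist_le_mul (hA.eigenvalues k) (g (hC.eigenvalues l))
  rwa [Real.dist_eq, Real.dist_eq] at this

/-- The spectral comparison: a positive semidefinite `A`, and a symmetric `C` whose quadratic form
is close to that of `A`, with thresholded eigenvalues `φ`. -/
lemma frob_sub_cfc_sq_le {A C : Matrix (Fin d) (Fin d) ℝ} (hA : A.IsHermitian)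
    (hC : C.IsHermitian) {b : ℝ} (hb : 0 ≤ b) (h0 : ∀ k, 0 ≤ hA.eigenvalues k) {φ : ℝ → ℝ}
    (hφ0 : ∀ l, 0 ≤ φ (hC.eigenvalues l))
    (hφ1 : ∀ l, φ (hC.eigenvalues l) * φ (hC.eigenvalues l)
      ≤ φ (hC.eigenvalues l) * quad A (hC.eigenvectorBasis l))
    (hφ2 : ∀ l, hC.eigenvalues l - 3 / 2 * b ≤ φ (hC.eigenvalues l))
    (hquad : ∀ k, hA.eigenvalues k - b ≤ quad C (hA.eigenvectorBasis k)) :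
    frob (cfc (id : ℝ → ℝ) A - cfc φ C) ^ 2 ≤ 5 * b * A.trace := by
  -- The cross term is 2Σφ_l · q_lᵀAq_l ≥ 2Σφ_l², since a nonzero φ_l does not exceed the energy in
  -- its own direction.
  have hupper : frob (cfc (id : ℝ → ℝ) A - cfc φ C) ^ 2
      ≤ ∑ k, hA.eigenvalues k ^ 2 - ∑ l, φ (hC.eigenvalues l) ^ 2 := by
    have e : ∀ k l, (id (hA.eigenvalues k) - φ (hC.eigenvalues l)) ^ 2 * cosSq hA hC k l
        = hA.eigenvalues k ^ 2 * cosSq hA hC k l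
          + φ (hC.eigenvalues l) ^ 2 * cosSq hA hC k l
          - 2 * φ (hC.eigenvalues l) * (hA.eigenvalues k * cosSq hA hC k l) := by
      intro k l
      simp only [id]
      ring
    rw [frob_cfc_sub_cfc_sq hA hC]
    simp_rw [e, Finset.sum_sub_distrib, Finset.sum_add_distrib]
    rw [Finset.sum_comm (f := fun k l => φ (hC.eigenvalues l) ^ 2 * cosSq hA hC k l),
      Finset.sum_comm (f := fun k l =>
        2 * φ (hC.eigenvalues l) * (hA.eigenvalues k * cosSq hA hC k l))]
    simp_rw [← Finset.mul_sum, sum_cosSq_left, sum_cosSq_right, mul_one, ← quad_eigenvector_left]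
    have : ∑ l, φ (hC.eigenvalues l) ^ 2
        ≤ ∑ l, φ (hC.eigenvalues l) * quad A (hC.eigenvectorBasis l) :=
      Finset.sum_le_sum fun l _ => by rw [sq]; exact hφ1 l
    have e2 : ∑ l, 2 * φ (hC.eigenvalues l) * quad A (hC.eigenvectorBasis l)
        = 2 * ∑ l, φ (hC.eigenvalues l) * quad A (hC.eigenvectorBasis l) := by
      rw [Finset.mul_sum]
      exact Finset.sum_congr rfl fun l _ => by ring
    rw [e2]
    linarith
  -- Cauchy–Schwarz for the probability weights of row k. The loss 5b/2 is b from the quadratic form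
  -- and 3b/2 from thresholding.
  have hlower : ∀ k, max (hA.eigenvalues k - 5 / 2 * b) 0 ^ 2
      ≤ ∑ l, φ (hC.eigenvalues l) ^ 2 * cosSq hA hC k l := by
    intro k
    have h1 : hA.eigenvalues k - 5 / 2 * b ≤ ∑ l, φ (hC.eigenvalues l) * cosSq hA hC k l := by
      have h2 : ∑ l, (hC.eigenvalues l - 3 / 2 * b) * cosSq hA hC k l
          ≤ ∑ l, φ (hC.eigenvalues l) * cosSq hA hC k l :=
        Finset.sum_le_sum fun l _ =>
          mul_le_mul_of_nonneg_right (hφ2 l) (cosSq_nonneg hA hC k l)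
      simp_rw [sub_mul, Finset.sum_sub_distrib, ← Finset.mul_sum, sum_cosSq_right,
        ← quad_eigenvector_right] at h2
      linarith [hquad k]
    have h3 : 0 ≤ ∑ l, φ (hC.eigenvalues l) * cosSq hA hC k l :=
      Finset.sum_nonneg fun l _ => mul_nonneg (hφ0 l) (cosSq_nonneg hA hC k l)
    have h5 := Finset.sum_mul_sq_le_sq_mul_sq Finset.univ
      (fun l => φ (hC.eigenvalues l) * Real.sqrt (cosSq hA hC k l))
      (fun l => Real.sqrt (cosSq hA hC k l))
    simp_rw [mul_pow, mul_assoc, Real.mul_self_sqrt (cosSq_nonneg hA hC k _),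
      Real.sq_sqrt (cosSq_nonneg hA hC k _), sum_cosSq_right, mul_one] at h5
    exact (pow_le_pow_left₀ (le_max_right _ _) (max_le h1 h3) 2).trans h5
  have hsum : ∑ k, max (hA.eigenvalues k - 5 / 2 * b) 0 ^ 2 ≤ ∑ l, φ (hC.eigenvalues l) ^ 2 := by
    refine (Finset.sum_le_sum fun k _ => hlower k).trans ?_
    rw [Finset.sum_comm]
    simp_rw [← Finset.mul_sum, sum_cosSq_left, mul_one]
    exact le_rfl
  have hfin : ∑ k, hA.eigenvalues k ^ 2 - ∑ k, max (hA.eigenvalues k - 5 / 2 * b) 0 ^ 2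
      ≤ 5 * b * A.trace := by
    rw [trace_eq_sum hA, Finset.mul_sum, ← Finset.sum_sub_distrib]
    refine Finset.sum_le_sum fun k _ => ?_
    have := h0 k
    rcases max_cases (hA.eigenvalues k - 5 / 2 * b) 0 with h | h <;> rw [h.1] <;>
      nlinarith [mul_nonneg hb this, sq_nonneg b]
  linarith

end Spectral

/-! ### The estimator -/

section Estimator

variable {d : ℕ}

local notation "E" => EuclideanSpace ℝ (Fin d)

variable {Q : Matrix (Fin d) (Fin d) ℝ}

/-- On a finite spectrum every function is continuous, so functional calculi compose without any
regularity of B or f. -/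
lemma cfc_tildeG (hQ : Q.IsHermitian) (p : Params) (δ g : ℝ) (f : ℝ → ℝ) :
    cfc f (tildeG p δ g Q)
      = cfc (f ∘ fun t : ℝ => max (max t 0 - p.B δ g (max t 0)) 0) Q := by
  have hfin := Q.finite_real_spectrum
  have h1 : tildeG p δ g Q = cfc (fun t : ℝ => max (max t 0 - p.B δ g (max t 0)) 0) Q := by
    unfold tildeG hatG
    rw [← cfc_comp' (fun t : ℝ => max (t - p.B δ g t) 0) (fun t : ℝ => max t 0) Q
      ((hfin.image _).continuousOn _) (hfin.continuousOn _) hQ.isSelfAdjoint]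
  rw [h1, ← cfc_comp _ _ Q hQ.isSelfAdjoint ((hfin.image _).continuousOn _) (hfin.continuousOn _)]

lemma frob_cfc_gram_sub_le {P : Measure (EuclideanSpace ℝ (Fin d))} [IsProbabilityMeasure P]
    (hP : MemLp (fun x : E => x) 4 P) {p : Params} (hp : p.Admissible)
    (hL : 0 ≤ Real.log (p.K / p.ε)) {δ : ℝ} (hδ : 0 ≤ δ) (hQ : Q.IsHermitian)
    (h : ∀ θ : E, ‖θ‖ = 1 → |quad Q θ - energy P θ| ≤ p.B δ (frob (gram P)) (energy P θ))
    {f : ℝ → ℝ} {r : NNReal} (hf : LipschitzWith r f) :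
    frob (cfc f (gram P) - cfc f (tildeG p δ (frob (gram P)) Q))
      ≤ r * Real.sqrt (worstCase p δ (gram P)) := by
  have hG : (gram P).IsHermitian := by
    rw [Matrix.IsHermitian, Matrix.conjTranspose_eq_transpose_of_trivial]
    exact gram_isSymm P
  set g := frob (gram P) with hg
  have hg0 : 0 ≤ g := frob_nonneg _
  set b := p.B δ g (topEig (gram P)) with hb
  have hb0 : 0 ≤ b := Params.B_nonneg hp hδ hg0 _
  have hmono := Params.B_mono hp hL δ g
  have hEtop : ∀ θ : E, ‖θ‖ = 1 → energy P θ ≤ topEig (gram P) := fun θ hθ => by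
    rw [← quad_gram hP]; exact quad_le_topEig hG hθ
  have hEb : ∀ θ : E, ‖θ‖ = 1 → p.B δ g (energy P θ) ≤ b := fun θ hθ => hmono (hEtop θ hθ)
  set φ : ℝ → ℝ := fun t => max (max t 0 - p.B δ g (max t 0)) 0 with hφ
  have hnorm : ∀ l, ‖hQ.eigenvectorBasis l‖ = 1 := fun l => hQ.eigenvectorBasis.norm_eq_one l
  have h0 : ∀ k, 0 ≤ hG.eigenvalues k := fun k => by
    rw [← quad_eigenvector hG, quad_gram hP]; exact energy_nonneg _
  have key : frob (cfc (id : ℝ → ℝ) (gram P) - cfc φ Q) ^ 2 ≤ 5 * b * (gram P).trace := by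
    refine frob_sub_cfc_sq_le hG hQ hb0 h0 (fun l => le_max_right _ _) ?_ ?_ ?_
    · intro l
      have h1 := h _ (hnorm l)
      rw [quad_eigenvector] at h1
      rw [quad_gram hP]
      set μ := hQ.eigenvalues l
      set N := energy P (hQ.eigenvectorBasis l)
      have hN0 : 0 ≤ N := energy_nonneg _
      -- It remains to see that the thresholded eigenvalue is at most N. If μ₊ ≤ N this is clear;
      -- otherwise B(N) ≤ B(μ₊) by monotonicity, so subtracting B(μ₊) undoes the possible
      -- overestimation.
      refine mul_le_mul_of_nonneg_left ?_ (le_max_right _ _)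
      refine max_le ?_ hN0
      rcases le_total (max μ 0) N with h2 | h2
      · linarith [Params.B_nonneg hp hδ hg0 (max μ 0)]
      · have h3 : p.B δ g N ≤ p.B δ g (max μ 0) := hmono h2
        rcases max_cases μ 0 with h4 | h4
        · rw [h4.1] at h3 ⊢
          linarith [(abs_le.1 h1).2]
        · rw [h4.1] at h2 ⊢
          linarith [Params.B_nonneg hp hδ hg0 0]
    · intro l
      have h1 := h _ (hnorm l)
      rw [quad_eigenvector] at h1
      have h2 := hEb _ (hnorm l)
      have h3 := hEtop _ (hnorm l)
      set μ := hQ.eigenvalues l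
      have h4 : μ ≤ topEig (gram P) + b := by linarith [(abs_le.1 h1).2]
      have htop : 0 ≤ topEig (gram P) := (energy_nonneg _).trans h3
      have h5 : max μ 0 ≤ topEig (gram P) + b := max_le h4 (by linarith)
      -- An eigenvalue of Q may exceed λ₁ by at most b, and B is 1/2-Lipschitz.
      have h6 : p.B δ g (max μ 0) ≤ 3 / 2 * b := by
        have := Params.B_lipschitz hp δ g (t := topEig (gram P)) (t' := topEig (gram P) + b)
          (by linarith)
        have h7 : p.B δ g (max μ 0) ≤ p.B δ g (topEig (gram P) + b) := hmono h5
        linarith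
      refine le_trans ?_ (le_max_left _ _)
      linarith [le_max_left μ 0]
    · intro k
      have hn : ‖hG.eigenvectorBasis k‖ = 1 := hG.eigenvectorBasis.norm_eq_one k
      have h1 := h _ hn
      have h2 := hEb _ hn
      have h3 := quad_eigenvector hG k
      rw [quad_gram hP] at h3
      rw [h3] at h1 h2
      linarith [(abs_le.1 h1).1]
  rw [cfc_tildeG hQ]
  refine (frob_cfc_sub_cfc_le hG hQ hf φ).trans (mul_le_mul_of_nonneg_left ?_ r.2)
  apply Real.le_sqrt_of_sq_le
  refine key.trans ?_
  have htr : 0 ≤ (gram P).trace := by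
    rw [trace_eq_sum hG]; exact Finset.sum_nonneg fun k _ => h0 k
  unfold worstCase
  nlinarith [mul_nonneg hb0 htr, sq_nonneg b]

end Estimator

/-! ### The event of large probability -/

section Event

variable {d : ℕ}

local notation "E" => EuclideanSpace ℝ (Fin d)

/-- The variables are only almost everywhere measurable, so the preimage of D is null measurable and
is replaced by a measurable subset of equal measure. -/
lemma exists_measurableSet_event {P : Measure (EuclideanSpace ℝ (Fin d))} [IsProbabilityMeasure P]
    {Ω : Type*} [MeasurableSpace Ω] {μ : Measure Ω} [IsProbabilityMeasure μ] {n : ℕ}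
    {X : Fin n → Ω → E} (hX : ∀ i, HasLaw (X i) P μ) (hind : iIndepFun X μ) {D : Set (Fin n → E)}
    (hD : MeasurableSet D) {r : ℝ} (h0 : 0 ≤ r)
    (hr : (Measure.pi fun _ => P) Dᶜ ≤ ENNReal.ofReal r) :
    ∃ A : Set Ω, MeasurableSet A ∧ ENNReal.ofReal (1 - r) ≤ μ A ∧
      ∀ ω ∈ A, (fun i => X i ω) ∈ D := by
  have hXm : ∀ i, AEMeasurable (X i) μ := fun i => (hX i).aemeasurable
  have hYm : AEMeasurable (fun ω i => X i ω) μ := aemeasurable_pi_lambda _ hXm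
  have hmap : μ.map (fun ω i => X i ω) = Measure.pi fun _ => P := by
    rw [hind.map_fun_eq_pi_map hXm]
    congr 1
    ext1 i
    exact (hX i).map_eq
  have hnull : NullMeasurableSet ((fun ω i => X i ω) ⁻¹' D) μ := hYm.nullMeasurable hD
  obtain ⟨A, hAsub, hAm, hAeq⟩ := hnull.exists_measurable_subset_ae_eq
  refine ⟨A, hAm, ?_, fun ω hω => hAsub hω⟩
  rw [measure_congr hAeq, ← Measure.map_apply_of_aemeasurable hYm hD, hmap]
  have h1 := prob_add_prob_compl (μ := Measure.pi fun _ : Fin n => P) hD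
  rw [ENNReal.ofReal_sub _ h0, ENNReal.ofReal_one, ← h1, tsub_le_iff_right]
  gcongr

end Event

/-! ### The worst-case rate -/

section Rate

variable {d : ℕ}

local notation "E" => EuclideanSpace ℝ (Fin d)

variable {P : Measure (EuclideanSpace ℝ (Fin d))} [IsProbabilityMeasure P]

lemma integrable_coord_sq (hP : MemLp (fun x : E => x) 4 P) (i : Fin d) :
    Integrable (fun x : E => x i ^ 2) P := by
  refine (integrable_norm_sq hP).mono' (by fun_prop) (Filter.Eventually.of_forall fun x => ?_)
  rw [norm_pow]
  exact pow_le_pow_left₀ (norm_nonneg _) (PiLp.norm_apply_le x i) 2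

lemma trace_gram (hP : MemLp (fun x : E => x) 4 P) :
    (gram P).trace = ∫ x : E, ‖x‖ ^ 2 ∂P := by
  simp_rw [EuclideanSpace.real_norm_sq_eq]
  rw [integral_finsetSum _ fun i _ => integrable_coord_sq hP i]
  refine Finset.sum_congr rfl fun i _ => ?_
  simp only [gram, Matrix.diag, Matrix.of_apply]
  simp_rw [← sq]

lemma frob_gram_le (hP : MemLp (fun x : E => x) 4 P) : frob (gram P) ≤ (gram P).trace := by
  have htr : 0 ≤ (gram P).trace := by
    rw [trace_gram hP]; exact integral_nonneg fun x => by positivity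
  apply le_of_sq_le_sq _ htr
  rw [frob_sq, sq, Matrix.trace, Finset.sum_mul_sum]
  refine Finset.sum_le_sum fun i _ => Finset.sum_le_sum fun j _ => ?_
  have hij : Integrable (fun x : E => x i * x j) P := by
    refine (integrable_norm_sq hP).mono' (by fun_prop) (Filter.Eventually.of_forall fun x => ?_)
    rw [norm_mul, sq]
    exact mul_le_mul (PiLp.norm_apply_le x i) (PiLp.norm_apply_le x j) (norm_nonneg _)
      (norm_nonneg _)
  have := sq_integral_mul_le (μ := P) (integrable_coord_sq hP i) (integrable_coord_sq hP j) hij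
  simp only [gram, Matrix.diag, Matrix.of_apply]
  simp_rw [← sq]
  exact this

lemma topEig_gram_le (hP : MemLp (fun x : E => x) 4 P) : topEig (gram P) ≤ s4sq P := by
  have hG : (gram P).IsHermitian := by
    rw [Matrix.IsHermitian, Matrix.conjTranspose_eq_transpose_of_trivial]
    exact gram_isSymm P
  -- Nonnegativity of the bound also covers dimension 0, where the spectrum is empty and its
  -- supremum is 0.
  refine Real.sSup_le (fun t ht => ?_) (Real.sqrt_nonneg _)
  rw [hG.spectrum_real_eq_range_eigenvalues] at ht
  obtain ⟨k, rfl⟩ := ht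
  rw [← quad_eigenvector hG, quad_gram hP]
  exact energy_le hP (hG.eigenvectorBasis.norm_eq_one k)

/-- λ₁, the trace and the Frobenius norm of G are all at most s, and B is monotone. The law thus
disappears from the bound. -/
lemma worstCase_le (hP : MemLp (fun x : E => x) 4 P) {p : Params} (hp : p.Admissible)
    (hL : 0 ≤ Real.log (p.K / p.ε)) (hs : s4sq P = p.s) {δ : ℝ} (hδ : 0 ≤ δ) {b : ℝ}
    (hb : 2 * p.s * p.relBound p.s + 7 * δ * p.s + p.σ ≤ b) :
    worstCase p δ (gram P) ≤ 11 * p.s * b + 13 * b ^ 2 := by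
  have htr : (gram P).trace ≤ p.s := by
    rw [trace_gram hP, ← hs]; exact integral_norm_sq_le hP
  have htr0 : 0 ≤ (gram P).trace := by
    rw [trace_gram hP]; exact integral_nonneg fun x => by positivity
  have hg : frob (gram P) ≤ p.s := (frob_gram_le hP).trans htr
  have htop : topEig (gram P) ≤ p.s := hs ▸ topEig_gram_le hP
  have hB0 := Params.B_nonneg hp hδ (frob_nonneg (gram P)) (topEig (gram P))
  have hB : p.B δ (frob (gram P)) (topEig (gram P)) ≤ b := by
    refine (Params.B_mono hp hL δ _ htop).trans (le_trans ?_ hb)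
    rw [Params.B_eq hp, Params.mainTerm, max_eq_left hp.sigma_le, min_self]
    gcongr
  have hs0 := hp.s_pos
  unfold worstCase
  gcongr

end Rate

/-! ### Growth of the parameters with threshold n^{-1/2} -/

section Asymptotics

open Filter Real

variable (a ε κ s : ℝ)

/-- The parameters with the threshold `n^{-1/2}`. -/
def rateParams (n : ℕ) : Params := ⟨n, a, ε, κ, s, (n : ℝ) ^ (-(1 / 2) : ℝ)⟩

lemma tendsto_log_natCast : Tendsto (fun n : ℕ => log (n : ℝ)) atTop atTop :=
  tendsto_log_atTop.comp tendsto_natCast_atTop_atTop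

lemma tendsto_K (ha : 0 < a) (hκ : 0 < κ) :
    Tendsto (fun n : ℕ => ((rateParams a ε κ s n).K : ℝ)) atTop atTop := by
  have hc := c_pos
  have hk := Real.sqrt_pos.2 hκ
  have h1 : Tendsto (fun n : ℕ => a⁻¹ * log (n / (72 * (2 + c) * Real.sqrt κ))) atTop atTop := by
    refine Tendsto.const_mul_atTop (by positivity) (tendsto_log_atTop.comp ?_)
    exact tendsto_natCast_atTop_atTop.atTop_div_const (by positivity)
  refine tendsto_atTop_mono (fun n => ?_) h1
  simp only [Params.K, rateParams]
  push_cast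
  linarith [Nat.le_ceil (a⁻¹ * log (n / (72 * (2 + c) * Real.sqrt κ)))]

lemma eventually_log_K_nonneg (ha : 0 < a) (hε : 0 < ε) (hκ : 0 < κ) :
    ∀ᶠ n : ℕ in atTop, 0 ≤ log ((rateParams a ε κ s n).K / ε) := by
  filter_upwards [(tendsto_K a ε κ s ha hκ).eventually_ge_atTop ε] with n hn
  apply log_nonneg
  rwa [one_le_div hε]

lemma eventually_log_K_le (ha : 0 < a) (hε : 0 < ε) (hκ : 3 / 2 ≤ κ) : ∃ C₁ : ℝ, 0 < C₁ ∧
    ∀ᶠ n : ℕ in atTop, log ((rateParams a ε κ s n).K / ε) ≤ C₁ * log (log n) := by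
  refine ⟨1 + |log ((2 + a⁻¹) / ε)|, by positivity, ?_⟩
  have hll := tendsto_log_atTop.comp tendsto_log_natCast
  filter_upwards [hll.eventually_ge_atTop 1, tendsto_log_natCast.eventually_ge_atTop 1,
    eventually_gt_atTop 0] with n h1 h2 hn
  have hn0 : (0 : ℝ) < n := by exact_mod_cast hn
  have hc := c_pos
  have hk : 1 ≤ Real.sqrt κ := Real.one_le_sqrt.2 (by linarith)
  have hK : ((rateParams a ε κ s n).K : ℝ) ≤ (2 + a⁻¹) * log n := by
    simp only [Params.K, rateParams]
    push_cast
    have h3 : log (n / (72 * (2 + c) * Real.sqrt κ)) ≤ log n := by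
      apply log_le_log (by positivity)
      apply div_le_self hn0.le
      nlinarith
    have h4 : ⌈a⁻¹ * log (n / (72 * (2 + c) * Real.sqrt κ))⌉₊ ≤ ⌈a⁻¹ * log n⌉₊ := by
      apply Nat.ceil_mono
      gcongr
    have h5 : (⌈a⁻¹ * log n⌉₊ : ℝ) < a⁻¹ * log n + 1 := Nat.ceil_lt_add_one (by positivity)
    have h6 : (⌈a⁻¹ * log (n / (72 * (2 + c) * Real.sqrt κ))⌉₊ : ℝ) ≤ ⌈a⁻¹ * log n⌉₊ := by
      exact_mod_cast h4
    nlinarith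
  have hK0 : (0 : ℝ) < (rateParams a ε κ s n).K := by exact_mod_cast Params.K_pos
  have hlog0 : 0 < log (n : ℝ) := by linarith
  have h7 : log ((rateParams a ε κ s n).K / ε) ≤ log ((2 + a⁻¹) / ε) + log (log n) := by
    rw [← log_mul (by positivity) (by positivity)]
    apply log_le_log (by positivity)
    rw [div_mul_eq_mul_div]
    gcongr
  have h8 : (1 : ℝ) ≤ log (log n) := h1
  have h9 := le_abs_self (log ((2 + a⁻¹) / ε))
  nlinarith [abs_nonneg (log ((2 + a⁻¹) / ε))]

lemma rpow_neg_half (n : ℕ) : (n : ℝ) ^ (-(1 / 2) : ℝ) = (Real.sqrt n)⁻¹ := by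
  rw [rpow_neg (by positivity), sqrt_eq_rpow]

/-- At t = n^{-1/2} each term of ζ is O(n^{1/4}), negligible against √n. The constants `M₁` and `M₂`
make each term at most √n/16, so that eight times their sum is at most √n. -/
lemma eventually_admissible (ha : 0 < a) (hε : 0 < ε) (hκ : 3 / 2 ≤ κ) (hs : 0 < s) :
    ∀ᶠ n : ℕ in atTop, (rateParams a ε κ s n).Admissible := by
  obtain ⟨C₁, hC₁, hK⟩ := eventually_log_K_le a ε κ s ha hε hκ
  have hc := c_pos
  have hk : 0 < Real.sqrt κ := Real.sqrt_pos.2 (by linarith)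
  have hκ1 : 0 < κ - 1 := by linarith
  have hsqrt : Tendsto (fun n : ℕ => Real.sqrt (n : ℝ)) atTop atTop :=
    tendsto_sqrt_atTop.comp tendsto_natCast_atTop_atTop
  set M₁ := 256 * cosh (a / 4) ^ 2 * (2 * (κ - 1) * ((2 + 3 * c) * s / (4 * (2 + c) * Real.sqrt κ)
    + 2 * C₁)) with hM₁
  set M₂ := 256 * cosh (a / 2) ^ 2 * (2 * (2 + c) * Real.sqrt κ * s) with hM₂
  filter_upwards [hK, hsqrt.eventually_ge_atTop M₁, hsqrt.eventually_ge_atTop M₂,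
    hsqrt.eventually_ge_atTop s⁻¹, hsqrt.eventually_ge_atTop 1,
    tendsto_log_natCast.eventually_ge_atTop 1] with n hKn h1 h2 h3 h4 h5
  set S := Real.sqrt (n : ℝ) with hS
  have hS0 : 0 < S := by linarith
  have hσ : (rateParams a ε κ s n).σ = S⁻¹ := rpow_neg_half n
  have hnS : (n : ℝ) = S ^ 2 := (Real.sq_sqrt (by positivity)).symm
  have hll : log (log n) ≤ 2 * S := by
    have h6 : log (log n) ≤ log n := (log_le_sub_one_of_pos (by linarith)).trans (by linarith)
    have h7 : log (n : ℝ) = 2 * log S := by rw [hnS, log_pow]; norm_num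
    have h8 : log S ≤ S - 1 := log_le_sub_one_of_pos hS0
    linarith
  refine ⟨?_, ?_, ?_, hκ⟩
  · rw [hσ]; positivity
  · rw [hσ]; exact inv_le_of_inv_le₀ hs h3
  · change 8 * (rateParams a ε κ s n).zeta (rateParams a ε κ s n).σ ≤ S
    rw [hσ]
    have hz1 : Real.sqrt (2 * (κ - 1) * ((2 + 3 * c) * s / (4 * (2 + c) * Real.sqrt κ * S⁻¹)
        + log ((rateParams a ε κ s n).K / ε))) * cosh (a / 4) ≤ S / 16 := by
      rw [← le_div_iff₀ (cosh_pos _)]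
      apply Real.sqrt_le_iff.2 ⟨by have := cosh_pos (a / 4); positivity, ?_⟩
      have hch := cosh_pos (a / 4)
      rw [div_pow, le_div_iff₀ (by positivity)]
      have h6 : (2 + 3 * c) * s / (4 * (2 + c) * Real.sqrt κ * S⁻¹)
          = (2 + 3 * c) * s / (4 * (2 + c) * Real.sqrt κ) * S := by field_simp
      have h7 : log ((rateParams a ε κ s n).K / ε) ≤ 2 * C₁ * S :=
        hKn.trans (by nlinarith)
      rw [h6]
      calc _ ≤ 2 * (κ - 1) * ((2 + 3 * c) * s / (4 * (2 + c) * Real.sqrt κ) * S + 2 * C₁ * S)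
            * cosh (a / 4) ^ 2 := by gcongr
        _ = M₁ * S / 256 := by rw [hM₁]; ring
        _ ≤ S * S / 256 := by gcongr
        _ = _ := by ring
    have hz2 : Real.sqrt (2 * (2 + c) * Real.sqrt κ * s / S⁻¹) * cosh (a / 2) ≤ S / 16 := by
      rw [← le_div_iff₀ (cosh_pos _)]
      apply Real.sqrt_le_iff.2 ⟨by have := cosh_pos (a / 2); positivity, ?_⟩
      have hch := cosh_pos (a / 2)
      rw [div_pow, le_div_iff₀ (by positivity), div_inv_eq_mul]
      calc _ = M₂ * S / 256 := by rw [hM₂]; ring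
        _ ≤ S * S / 256 := by gcongr
        _ = _ := by ring
    change 8 * (Real.sqrt (2 * (κ - 1) * ((2 + 3 * c) * s / (4 * (2 + c) * Real.sqrt κ * S⁻¹)
        + log ((rateParams a ε κ s n).K / ε))) * cosh (a / 4)
        + Real.sqrt (2 * (2 + c) * Real.sqrt κ * s / S⁻¹) * cosh (a / 2)) ≤ S
    linarith

/-- At the fixed energy s only log(K/ε) grows with n, and it is O(log log n) because K = O(log n).
-/
lemma exists_zeta_le (ha : 0 < a) (hε : 0 < ε) (hκ : 3 / 2 ≤ κ) (hs : 0 < s) :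
    ∃ C₃ : ℝ, 0 ≤ C₃ ∧ ∀ᶠ n : ℕ in atTop,
      (rateParams a ε κ s n).zeta s ≤ C₃ * Real.sqrt (log (log n)) := by
  obtain ⟨C₁, hC₁, hK⟩ := eventually_log_K_le a ε κ s ha hε hκ
  have hc := c_pos
  have hk : 0 < Real.sqrt κ := Real.sqrt_pos.2 (by linarith)
  have hκ1 : 0 < κ - 1 := by linarith
  have hch4 := cosh_pos (a / 4)
  have hch2 := cosh_pos (a / 2)
  set A := (2 + 3 * c) * s / (4 * (2 + c) * Real.sqrt κ * s) with hA
  have hA0 : 0 ≤ A := by positivity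
  set B := 2 * (2 + c) * Real.sqrt κ * s / s with hB
  have hB0 : 0 ≤ B := by positivity
  refine ⟨Real.sqrt (2 * (κ - 1) * (A + C₁)) * cosh (a / 4) + Real.sqrt B * cosh (a / 2),
    by positivity, ?_⟩
  have hll := tendsto_log_atTop.comp tendsto_log_natCast
  filter_upwards [hK, hll.eventually_ge_atTop 1] with n hKn h1
  have hl : 1 ≤ log (log n) := h1
  change Real.sqrt (2 * (κ - 1) * (A + log ((rateParams a ε κ s n).K / ε))) * cosh (a / 4)
    + Real.sqrt B * cosh (a / 2) ≤ _
  have e1 : Real.sqrt (2 * (κ - 1) * (A + log ((rateParams a ε κ s n).K / ε)))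
      ≤ Real.sqrt (2 * (κ - 1) * (A + C₁)) * Real.sqrt (log (log n)) := by
    rw [← Real.sqrt_mul (by positivity)]
    apply Real.sqrt_le_sqrt
    have hkey : A + log ((rateParams a ε κ s n).K / ε) ≤ (A + C₁) * log (log n) := by
      nlinarith [mul_nonneg hA0 (sub_nonneg.2 hl)]
    rw [mul_assoc (2 * (κ - 1))]
    exact mul_le_mul_of_nonneg_left hkey (by positivity)
  have e2 : Real.sqrt B ≤ Real.sqrt B * Real.sqrt (log (log n)) :=
    le_mul_of_one_le_right (Real.sqrt_nonneg _) (Real.one_le_sqrt.2 hl)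
  calc _ ≤ Real.sqrt (2 * (κ - 1) * (A + C₁)) * Real.sqrt (log (log n)) * cosh (a / 4)
        + Real.sqrt B * Real.sqrt (log (log n)) * cosh (a / 2) := by gcongr
    _ = _ := by ring

lemma exists_rate (ha : 0 < a) (hε : 0 < ε) (hκ : 3 / 2 ≤ κ) (hs : 0 < s) :
    ∃ C : ℝ, ∀ᶠ n : ℕ in atTop, (rateParams a ε κ s n).Admissible ∧
      ∀ (d : ℕ) (P : Measure (EuclideanSpace ℝ (Fin d))) [IsProbabilityMeasure P],
        MemLp (fun x => x) 4 P → s4sq P = s → ∀ δ : ℝ, 0 < δ → δ ≤ (n : ℝ) ^ (-(1 / 2) : ℝ) →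
          Real.sqrt (worstCase (rateParams a ε κ s n) δ (gram P))
            ≤ C * (log (log n)) ^ (1 / 4 : ℝ) * (n : ℝ) ^ (-(1 / 4) : ℝ) := by
  obtain ⟨C₃, hC₃, hz⟩ := exists_zeta_le a ε κ s ha hε hκ hs
  set C₄ := 4 * s * C₃ + 7 * s + 1 with hC₄
  have hC₄0 : 0 < C₄ := by positivity
  refine ⟨Real.sqrt (11 * s * C₄ + 13 * C₄ ^ 2), ?_⟩
  have hll := tendsto_log_atTop.comp tendsto_log_natCast
  filter_upwards [hz, eventually_admissible a ε κ s ha hε hκ hs,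
    eventually_log_K_nonneg a ε κ s ha hε (by linarith), hll.eventually_ge_atTop 1,
    eventually_gt_atTop 0] with n hzn hp hL h1 hn
  refine ⟨hp, fun d P _ hP hsP δ hδ hδn => ?_⟩
  have hl : 1 ≤ log (log n) := h1
  have hn0 : (0 : ℝ) < n := by exact_mod_cast hn
  have hlogn : 0 < log (n : ℝ) := by
    by_contra hneg
    have hn1 : (1 : ℝ) ≤ n := by exact_mod_cast hn
    have : log (n : ℝ) = 0 := le_antisymm (not_lt.1 hneg) (log_nonneg hn1)
    rw [this, log_zero] at hl
    linarith
  set ℓ := Real.sqrt (log (log n)) with hℓ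
  set S := Real.sqrt (n : ℝ) with hS
  have hS0 : 0 < S := Real.sqrt_pos.2 hn0
  have hℓ1 : 1 ≤ ℓ := Real.one_le_sqrt.2 hl
  have hℓS : ℓ ≤ S := by
    apply Real.sqrt_le_sqrt
    have h6 : log (log n) ≤ log n := (log_le_sub_one_of_pos hlogn).trans (by linarith)
    have h7 : log (n : ℝ) ≤ n - 1 := log_le_sub_one_of_pos hn0
    linarith
  rw [rpow_neg_half] at hδn
  have hx8 := Params.zeta_div_le hp hp.sigma_le
  have hx0 := Params.zeta_div_pos hp hp.sigma_le
  have hrel : (rateParams a ε κ s n).relBound s ≤ 2 * C₃ * ℓ / S := by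
    have h2 : (rateParams a ε κ s n).zeta s / S ≤ C₃ * ℓ / S := by gcongr
    change (rateParams a ε κ s n).zeta s / S ≤ 1 / 8 at hx8
    change 0 < (rateParams a ε κ s n).zeta s / S at hx0
    change (rateParams a ε κ s n).zeta s / S / (1 - 4 * ((rateParams a ε κ s n).zeta s / S)) ≤ _
    -- Since ζ(s)/√n ≤ 1/8, the denominator is at least 1/2, which accounts for the factor 2.
    rw [div_le_iff₀ (by linarith)]
    have e : 2 * C₃ * ℓ / S = 2 * (C₃ * ℓ / S) := by ring
    rw [e]
    nlinarith
  have hb : 2 * s * (rateParams a ε κ s n).relBound s + 7 * δ * s + (n : ℝ) ^ (-(1 / 2) : ℝ)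
      ≤ C₄ * (ℓ / S) := by
    rw [rpow_neg_half]
    have h2 : S⁻¹ ≤ ℓ / S := by rw [inv_eq_one_div]; gcongr
    have h3 : 7 * δ * s ≤ 7 * (ℓ / S) * s := by
      have : δ ≤ ℓ / S := hδn.trans h2
      gcongr
    calc _ ≤ 2 * s * (2 * C₃ * ℓ / S) + 7 * (ℓ / S) * s + ℓ / S := by gcongr
      _ = _ := by rw [hC₄]; ring
  have hw := worstCase_le hP hp hL hsP hδ.le hb
  have hq1 : ℓ / S ≤ 1 := (div_le_one hS0).2 hℓS
  have hq0 : 0 ≤ ℓ / S := by positivity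
  have hw2 : worstCase (rateParams a ε κ s n) δ (gram P)
      ≤ (11 * s * C₄ + 13 * C₄ ^ 2) * (ℓ / S) := by
    refine hw.trans ?_
    change 11 * s * (C₄ * (ℓ / S)) + 13 * (C₄ * (ℓ / S)) ^ 2 ≤ _
    have : (ℓ / S) ^ 2 ≤ ℓ / S := by nlinarith
    nlinarith [mul_le_mul_of_nonneg_left this (by positivity : 0 ≤ 13 * C₄ ^ 2)]
  refine (Real.sqrt_le_sqrt hw2).trans (le_of_eq ?_)
  have hℓ4 : Real.sqrt ℓ = log (log n) ^ (1 / 4 : ℝ) := by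
    rw [hℓ, sqrt_eq_rpow, sqrt_eq_rpow, ← rpow_mul (by linarith)]
    norm_num
  have hS4 : (Real.sqrt S)⁻¹ = (n : ℝ) ^ (-(1 / 4) : ℝ) := by
    rw [hS, sqrt_eq_rpow, sqrt_eq_rpow, ← rpow_mul hn0.le, ← rpow_neg hn0.le]
    norm_num
  rw [Real.sqrt_mul (by positivity), Real.sqrt_div (by positivity), div_eq_mul_inv, hℓ4, hS4,
    ← mul_assoc]

end Asymptotics

end RobustPCA

end

/-! ### Assembly of the probability bound and the rate -/

theorem mainTheorem6 (a ε : ℝ) (ha : 0 < a) (hε : 0 < ε) :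
    -- the bound in probability
    (∀ (d n : ℕ) (P : Measure (EuclideanSpace ℝ (Fin d))) [IsProbabilityMeasure P]
      (_ : MemLp (fun x => x) 4 P) (σ δ : ℝ) (_ : 0 < δ) (p : RobustPCA.Params)
      (_ : p = ⟨n, a, ε, RobustPCA.kurtosis P, RobustPCA.s4sq P, σ⟩) (_ : p.Admissible)
      (Θ : Finset (EuclideanSpace ℝ (Fin d))) (_ : RobustPCA.IsNet δ Θ)
      (Ω : Type*) [MeasurableSpace Ω] (μ : Measure Ω) [IsProbabilityMeasure μ]
      (X : Fin p.n → Ω → EuclideanSpace ℝ (Fin d)) (_ : ∀ i, HasLaw (X i) P μ)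
      (_ : iIndepFun X μ) (Q : Ω → Matrix (Fin d) (Fin d) ℝ)
      (_ : ∀ ω, p.IsEstimate (fun i => X i ω) Θ (Q ω)),
      ∃ A : Set Ω, MeasurableSet A ∧ ENNReal.ofReal (1 - 2 * ε) ≤ μ A ∧
        ∀ ω ∈ A, ∀ (L : ℝ) (f : ℝ → ℝ), 0 < L → LipschitzWith (Real.toNNReal (1 / L)) f →
          RobustPCA.frob (cfc f (RobustPCA.gram P) -
              cfc f (RobustPCA.tildeG p δ (RobustPCA.frob (RobustPCA.gram P)) (Q ω)))
            ≤ L⁻¹ * Real.sqrt (RobustPCA.worstCase p δ (RobustPCA.gram P)))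
    ∧
    -- the worst-case rate of the bound
    (∀ κ s : ℝ, 3 / 2 ≤ κ → 0 < s → ∃ C : ℝ, ∃ n₀ : ℕ, ∀ n : ℕ, n₀ ≤ n →
      ∀ p : RobustPCA.Params, p = ⟨n, a, ε, κ, s, (n : ℝ) ^ (-(1 / 2) : ℝ)⟩ →
        p.Admissible ∧
        ∀ (d : ℕ) (P : Measure (EuclideanSpace ℝ (Fin d))) [IsProbabilityMeasure P],
          MemLp (fun x => x) 4 P → RobustPCA.kurtosis P = κ → RobustPCA.s4sq P = s →
          ∀ δ L : ℝ, 0 < δ → δ ≤ (n : ℝ) ^ (-(1 / 2) : ℝ) → 0 < L →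
            L⁻¹ * Real.sqrt (RobustPCA.worstCase p δ (RobustPCA.gram P))
              ≤ L⁻¹ * (C * (Real.log (Real.log n)) ^ (1 / 4 : ℝ) * (n : ℝ) ^ (-(1 / 4) : ℝ))) := by
  refine ⟨?_, ?_⟩
  · intro d n P _ hP σ δ hδ p hpdef hp Θ hΘ Ω _ μ _ X hX hind Q hQ
    -- For ε ≥ 1/2 the required probability is zero and the empty event does. Otherwise ε < 1 ≤ K,
    -- so log(K/ε) is positive, as the choice of λ_j requires.
    rcases le_or_gt (1 / 2) ε with hε2 | hε2
    · exact ⟨∅, MeasurableSet.empty, by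
        rw [ENNReal.ofReal_of_nonpos (by linarith)]; exact bot_le, by simp⟩
    have hpa : p.a = a := by rw [hpdef]
    have hpε : p.ε = ε := by rw [hpdef]
    have hκ : RobustPCA.kurtosis P = p.κ := by rw [hpdef]
    have hs : RobustPCA.s4sq P = p.s := by rw [hpdef]
    obtain ⟨D, hD, hDr, hDx⟩ :=
      RobustPCA.exists_event_energy_mem_region hP hp hκ hs (by rwa [hpε])
    rw [hpε] at hDr
    obtain ⟨A, hA, hAμ, hAD⟩ :=
      RobustPCA.exists_measurableSet_event hX hind hD (by positivity) hDr
    have hL : 0 < Real.log (p.K / p.ε) :=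
      RobustPCA.Params.log_K_div_pos (by rwa [hpε]) (by rw [hpε]; linarith)
    refine ⟨A, hA, hAμ, fun ω hω L f hL0 hf => ?_⟩
    have hQh : (Q ω).IsHermitian := by
      rw [Matrix.IsHermitian, Matrix.conjTranspose_eq_transpose_of_trivial]
      exact (hQ ω).1
    have h := RobustPCA.frob_cfc_gram_sub_le hP hp hL.le hδ.le hQh (fun θ hθ =>
      RobustPCA.abs_quad_sub_energy_le hP hp (by rwa [hpa]) hL hs (hDx _ (hAD ω hω)) hδ hΘ
        (hQ ω) hθ) hf
    rwa [Real.coe_toNNReal _ (by positivity), one_div] at h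
  · intro κ s hκ hs
    obtain ⟨C, hC⟩ := RobustPCA.exists_rate a ε κ s ha hε hκ hs
    obtain ⟨n₀, hn₀⟩ := Filter.eventually_atTop.1 hC
    refine ⟨C, n₀, fun n hn p hp => ?_⟩
    obtain ⟨hadm, hbound⟩ := hn₀ n hn
    rw [hp]
    refine ⟨hadm, fun d P _ hP _ hsP δ L hδ hδn hL => ?_⟩
    exact mul_le_mul_of_nonneg_left (hbound d P hP hsP δ hδ hδn) (by positivity)
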